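/- Let $M$ be a compact $n$-dimensional smooth manifold without boundary, let $\mathbb T=\mathbb R/\mathbb Z$, and let $\omega=\sum_j dp^j\wedge dq^j$ be the canonical symplectic form of $T^*M$. Let $H\in C^\infty(\mathbb T\times T^*M)$ be a Hamiltonian whose vector field $X_H$, defined by $\omega(X_H(t,x),\xi)=-D_xH(t,x)[\xi]$, has solutions existing for all times, and let $$\phi_t(s,x_0)=(s+t,\varphi_{s+t}(s,x_0)),\qquad \partial_t\varphi_t(s,x_0)=X_H(t,\varphi_t(s,x_0)),\quad \varphi_s(s,x_0)=x_0,$$ be the resulting flow on $\mathbb T\times T^*M$. Let $\pi:T^*M\to M$ be the projection and $T^v_xT^*M=\ker D\pi(x)$ the vertical subspace. Let $\mu(\lambda,\lambda_0)\in\frac12\mathbb Z$ be the Robbin--Salamon Maslov index of a continuous path $\lambda$ of Lagrangian subspaces of $(\mathbb R^{2n},\sum_j dp^j\wedge dq^j)$ with respect to a Lagrangian subspace $\lambda_0$. It is additive under juxtaposition and invariant under symplectic isomorphisms, and it is normalized by $\mu(\lambda,\lambda_0)=\frac12(\operatorname{sign}S(b)-\operatorname{sign}S(a))$ when $\lambda_0=(0)\times\mathbb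 R^n$ and $\lambda(t)=\{(q,p): q=S(t)p\}$, $t\in[a,b]$, with $S(t)$ symmetric. For $t\ge 0$ and $(s,x_0)\in\mathbb T\times T^*M$ put $$\mu_t(s,x_0)=\mu(\lambda^U|_{[s,s+t]},\lambda_0)-\frac n2,\qquad \lambda^U(\tau)=U(\tau)^{-1}D_x\varphi_\tau(s,x_0)\,T^v_{x_0}T^*M,\quad \lambda_0=(0)\times\mathbb R^n,$$ where $U(\tau):\mathbb R^{2n}\to T_{\varphi_\tau(s,x_0)}T^*M$ is any continuous symplectic trivialization along the orbit mapping $\lambda_0$ onto the vertical subspaces; $\mu_t$ does not depend on $U$. Put $$\hat\mu(z)=\lim_{k\to\infty,\ k\in\mathbb N}\frac{\mu_k(z)}k,\qquad \hat\mu(\nu)=\int_{\mathbb T\times T^*M}\hat\mu\,d\nu .$$ Let $(\eta_j)_{j\in\mathbb N}$ be $\phi$-invariant Borel probability measures on $\mathbb T\times T^*M$ converging narrowly (that is, against bounded continuous functions) to a Borel probability measure $\eta$. Assume that for every $t\ge 0$ the function $\mu_t$ is uniformly integrable with respect to $(\eta_j)$: $$\lim_{c\to+\infty}\ \sup_{j}\int_{\{|\mu_t|\ge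 c\}}|\mu_t|\,d\eta_j=0 .$$ Then $\eta$ is $\phi$-invariant. For each $\nu\in\{\eta\}\cup\{\eta_j: j\in\mathbb N\}$ the asymptotic Maslov index $\hat\mu(\nu)$ is well defined: every $\mu_t$, $t\ge0$, is in $L^1(\nu)$, the limit $\hat\mu(z)$ exists for $\nu$-almost every $z$ and is in $L^1(\nu)$, and $$\hat\mu(\nu)=\int\hat\mu\,d\nu=\lim_{t\to+\infty,\ t\in\mathbb R}\frac1t\int\mu_t\,d\nu .$$ Moreover $\hat\mu(\eta_j)\to\hat\mu(\eta)$ as $j\to\infty$. -/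

import Mathlib

open Set Filter Topology MeasureTheory
open scoped Manifold ContDiff ENNReal

/-! ### Linear symplectic algebra and the Maslov index -/

/-- The dual `(ℝⁿ)*`, in which the momenta `p` live. -/
abbrev MomentumSpace (n : ℕ) : Type := EuclideanSpace ℝ (Fin n) →L[ℝ] ℝ

/-- The standard symplectic space `ℝ²ⁿ = ℝⁿ × (ℝⁿ)*`, with elements `(q, p)`. -/
abbrev StdSpace (n : ℕ) : Type := EuclideanSpace ℝ (Fin n) × MomentumSpace n

/-- The standard symplectic form `ω₀ = ∑ dpʲ ∧ dqʲ`, that is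
`ω₀((q, p), (q', p')) = p(q') - p'(q)`. -/
noncomputable def stdForm (n : ℕ) : LinearMap.BilinForm ℝ (StdSpace n) :=
  LinearMap.mk₂ ℝ (fun x y => x.2 y.1 - y.2 x.1)
    (by intro x x' y; simp; ring) (by intro c x y; simp; ring)
    (by intro x y y'; simp; ring) (by intro c x y; simp; ring)

/-- Lagrangian subspaces: `n`-dimensional subspaces on which `ω₀` vanishes. -/
def IsLagrangian {n : ℕ} (lam : Submodule ℝ (StdSpace n)) : Prop :=
  Module.finrank ℝ lam = n ∧ ∀ x ∈ lam, ∀ y ∈ lam, stdForm n x y = 0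

/-- The vertical Lagrangian subspace `λ₀ = (0) × ℝⁿ`. -/
def stdVertical (n : ℕ) : Submodule ℝ (StdSpace n) :=
  LinearMap.ker (LinearMap.fst ℝ (EuclideanSpace ℝ (Fin n)) (MomentumSpace n))

/-- For a splitting `ℝ²ⁿ = lam0 ⊕ lam1`, the quadratic form `w = v + u ↦ ω₀(v, u)`
(`v ∈ lam0`, `u ∈ lam1`) on the subspace `lam`.  If `lam` is transverse to `lam1`, then
`lam = {v + S v | v ∈ lam0}` is the graph of a linear map `S : lam0 → lam1`, and this is the form
`v ↦ ω₀(v, S v)`, read on `lam` through the isomorphism `v ↦ v + S v`.  In particular it is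
`p ↦ ⟨S p, p⟩` when `lam0 = (0) × ℝⁿ`, `lam1 = ℝⁿ × (0)` and `lam = {(S p, p)}`. -/
noncomputable def relForm {n : ℕ} {lam0 lam1 : Submodule ℝ (StdSpace n)} (h : IsCompl lam0 lam1)
    (lam : Submodule ℝ (StdSpace n)) : QuadraticForm ℝ lam :=
  (LinearMap.BilinMap.toQuadraticMap
    ((stdForm n).compl₁₂ (lam0.projection lam1 h) (lam1.projection lam0 h.symm))).comp lam.subtype

/-- The signature (number of positive minus number of negative squares) of `relForm`. -/
noncomputable def relSign {n : ℕ} {lam0 lam1 : Submodule ℝ (StdSpace n)} (h : IsCompl lam0 lam1)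
    (lam : Submodule ℝ (StdSpace n)) : ℤ :=
  (sigPos (R := ℝ) (M := lam) (relForm h lam) : ℤ) - (sigNeg (R := ℝ) (M := lam) (relForm h lam) : ℤ)

/-- `m` is the Maslov index `μ(lam, lam0)` (with the half-integer convention at the end-points) of
the path `lam : [a, b] → ℒ(n)`: there are a subdivision `a = τ₀ ≤ ⋯ ≤ τ_N = b` and Lagrangian
complements `lam1 k` of `lam0` such that `lam t` is transverse to `lam1 k` for
`t ∈ [τ k, τ (k + 1)]`, so that `lam t` is there the graph of a path `S k t` of symmetric maps
`lam0 → lam1 k`, and `m = ∑ k, (sign S k (τ (k + 1)) - sign S k (τ k)) / 2`.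
For a continuous path such an `m` exists and is unique. -/
def IsMaslovIndex {n : ℕ} (lam : ℝ → Submodule ℝ (StdSpace n)) (lam0 : Submodule ℝ (StdSpace n))
    (a b m : ℝ) : Prop :=
  ∃ (N : ℕ) (τ : ℕ → ℝ) (lam1 : ℕ → Submodule ℝ (StdSpace n)) (h : ∀ k, IsCompl lam0 (lam1 k)),
    Monotone τ ∧ τ 0 = a ∧ τ N = b ∧ (∀ k, IsLagrangian (lam1 k)) ∧
    (∀ k < N, ∀ t ∈ Icc (τ k) (τ (k + 1)), IsCompl (lam t) (lam1 k)) ∧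
    m = ∑ k ∈ Finset.range N,
      ((relSign (h k) (lam (τ (k + 1))) : ℝ) - (relSign (h k) (lam (τ k)) : ℝ)) / 2

/-- The Maslov index `μ(lam|[a,b], lam0)` of a continuous path of Lagrangian subspaces. -/
noncomputable def maslovIndex {n : ℕ} (lam : ℝ → Submodule ℝ (StdSpace n))
    (lam0 : Submodule ℝ (StdSpace n)) (a b : ℝ) : ℝ :=
  Classical.epsilon (IsMaslovIndex lam lam0 a b)

/-! ### Cotangent bundles -/

section Cotangent

variable (n : ℕ) (M : Type*) [TopologicalSpace M] [ChartedSpace (EuclideanSpace ℝ (Fin n)) M]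

/-- The total space `T*M` of the cotangent bundle. -/
abbrev CotangentBundle [IsManifold (𝓡 n) ∞ M] : Type _ :=
  Bundle.TotalSpace (MomentumSpace n)
    (fun x : M => TangentSpace (𝓡 n) x →L[ℝ] Bundle.Trivial M ℝ x)

/-- The model with corners of `T*M`, whose charts are cotangent coordinates `(q, p)`. -/
noncomputable abbrev cotangentModel :=
  (𝓡 n).prod 𝓘(ℝ, MomentumSpace n)

/-- The extended phase space `𝕋 × T*M`, where `𝕋 = ℝ / ℤ`. -/
abbrev ExtPhaseSpace [IsManifold (𝓡 n) ∞ M] : Type _ :=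
  UnitAddCircle × CotangentBundle n M

end Cotangent

section Hamiltonian

variable {n : ℕ} {M : Type*} [TopologicalSpace M] [ChartedSpace (EuclideanSpace ℝ (Fin n)) M]
  [IsManifold (𝓡 n) ∞ M]

/-- The canonical symplectic form `ω = ∑ dpʲ ∧ dqʲ` on `T_x T*M`.  A vector of
`TangentSpace (cotangentModel n) x` is by definition the pair of its components in the preferred
chart at `x` of the bundle `T*M`, and that chart is the system of cotangent coordinates `(q, p)`
induced by a chart of `M`. -/
noncomputable def canonicalForm (x : CotangentBundle n M) :
    LinearMap.BilinForm ℝ (TangentSpace (cotangentModel n) x) :=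
  stdForm n

/-- The vertical subspace `T^v_x T*M = ker Dπ(x)`. -/
noncomputable def verticalSpace (x : CotangentBundle n M) :
    Submodule ℝ (TangentSpace (cotangentModel n) x) :=
  LinearMap.ker (mfderiv (cotangentModel n) (𝓡 n)
    (fun y : CotangentBundle n M => y.proj) x).toLinearMap

/-- `H ∈ C^∞(𝕋 × T*M)`, read on the covering `ℝ × T*M`. -/
def IsSmoothHamiltonian (H : ExtPhaseSpace n M → ℝ) : Prop :=
  ContMDiff (𝓘(ℝ, ℝ).prod (cotangentModel n)) 𝓘(ℝ, ℝ) ∞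
    (fun z : ℝ × CotangentBundle n M => H ((z.1 : UnitAddCircle), z.2))

/-- `X` is the value `X_H(s, x)` of the Hamiltonian vector field:
`ω(X, ξ) = - D_x H(s, x)[ξ]` for all `ξ`. -/
def IsHamiltonianVector (H : ExtPhaseSpace n M → ℝ) (s : UnitAddCircle) (x : CotangentBundle n M)
    (X : TangentSpace (cotangentModel n) x) : Prop :=
  ∀ ξ : TangentSpace (cotangentModel n) x, canonicalForm x X ξ =
    - (show ℝ from mfderiv (cotangentModel n) 𝓘(ℝ, ℝ) (fun y => H (s, y)) x ξ)

/-- The curve `γ` satisfies `γ'(t) = X_H(s + t, γ(t))` for all `t ∈ ℝ`. -/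
def IsHamiltonianOrbit (H : ExtPhaseSpace n M → ℝ) (s : UnitAddCircle)
    (γ : ℝ → CotangentBundle n M) : Prop :=
  ∀ t : ℝ, ∃ X : TangentSpace (cotangentModel n) (γ t),
    IsHamiltonianVector H (s + (t : UnitAddCircle)) (γ t) X ∧
    HasMFDerivAt 𝓘(ℝ, ℝ) (cotangentModel n) γ t ((1 : ℝ →L[ℝ] ℝ).smulRight X)

/-- `X_H` generates a global flow: all solutions of the Cauchy problem exist for all times. -/
def GeneratesGlobalFlow (H : ExtPhaseSpace n M → ℝ) : Prop :=
  ∀ (s : UnitAddCircle) (x : CotangentBundle n M),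
    ∃ γ : ℝ → CotangentBundle n M, γ 0 = x ∧ IsHamiltonianOrbit H s γ

/-- The point `φ_{s+t}(s, x)` of `T*M` reached at time `s + t` by the orbit which is at `x` at
time `s` (the orbit is unique when `H` is smooth). -/
noncomputable def evolution {H : ExtPhaseSpace n M → ℝ} (hH : GeneratesGlobalFlow H)
    (s : UnitAddCircle) (t : ℝ) (x : CotangentBundle n M) : CotangentBundle n M :=
  (hH s x).choose t

/-- The flow `φ_t(s, x) = (s + t, φ_{s+t}(s, x))` on the extended phase space. -/
noncomputable def extFlow {H : ExtPhaseSpace n M → ℝ} (hH : GeneratesGlobalFlow H)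
    (t : ℝ) (z : ExtPhaseSpace n M) : ExtPhaseSpace n M :=
  (z.1 + (t : UnitAddCircle), evolution hH z.1 t z.2)

/-! ### The functions `μ_t` and the asymptotic Maslov index -/

/-- `U` is a (continuous) symplectic trivialization of `γ^*(TT*M)` mapping `(0) × ℝⁿ` onto the
vertical subspaces. -/
def IsVerticalTrivialization (γ : ℝ → CotangentBundle n M)
    (U : ∀ t : ℝ, StdSpace n ≃L[ℝ] TangentSpace (cotangentModel n) (γ t)) : Prop :=
  Continuous (fun z : ℝ × StdSpace n =>
    (⟨γ z.1, U z.1 z.2⟩ : TangentBundle (cotangentModel n) (CotangentBundle n M))) ∧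
  (∀ t v w, canonicalForm (γ t) (U t v) (U t w) = stdForm n v w) ∧
  (∀ t, (stdVertical n).map (U t).toLinearEquiv.toLinearMap = verticalSpace (γ t))

/-- The path `λ^U(t) = U(t)⁻¹ (D_x φ_{s+t}(s, x) T^v_x T*M)` of Lagrangian subspaces of `ℝ²ⁿ`. -/
noncomputable def trivializedPath {H : ExtPhaseSpace n M → ℝ} (hH : GeneratesGlobalFlow H)
    (z : ExtPhaseSpace n M)
    (U : ∀ t : ℝ, StdSpace n ≃L[ℝ] TangentSpace (cotangentModel n) (evolution hH z.1 t z.2))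
    (t : ℝ) : Submodule ℝ (StdSpace n) :=
  ((verticalSpace z.2).map
    (mfderiv (cotangentModel n) (cotangentModel n) (evolution hH z.1 t) z.2).toLinearMap).comap
      (U t).toLinearEquiv.toLinearMap

/-- The function `μ_t(s, x) = μ(λ^U|[s,s+t], λ₀) - n/2`, for some (equivalently, for any)
symplectic trivialization `U` along the orbit of `(s, x)` preserving the vertical subspaces.
The path is parametrized by the time elapsed since `s`. -/
noncomputable def maslovFun {H : ExtPhaseSpace n M → ℝ} (hH : GeneratesGlobalFlow H)
    (t : ℝ) (z : ExtPhaseSpace n M) : ℝ :=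
  Classical.epsilon fun m : ℝ =>
    ∃ U : ∀ t : ℝ, StdSpace n ≃L[ℝ] TangentSpace (cotangentModel n) (evolution hH z.1 t z.2),
      IsVerticalTrivialization (fun t => evolution hH z.1 t z.2) U ∧
      m = maslovIndex (trivializedPath hH z U) (stdVertical n) 0 t - (n : ℝ) / 2

/-- The asymptotic Maslov index of a point: the limit of `μ_k(s, x) / k` for `k → ∞` in `ℕ`.
It agrees with the limit of `μ_t(s, x) / t` for `t → ∞` in `ℝ` wherever the latter exists. -/
noncomputable def asymptoticMaslov {H : ExtPhaseSpace n M → ℝ} (hH : GeneratesGlobalFlow H)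
    (z : ExtPhaseSpace n M) : ℝ :=
  limUnder atTop (fun k : ℕ => maslovFun hH (k : ℝ) z / (k : ℝ))

variable [MeasurableSpace (ExtPhaseSpace n M)]

/-- The asymptotic Maslov index `∫ μ̂ dν` of a measure on the extended phase space. -/
noncomputable def asymptoticMaslovIndex {H : ExtPhaseSpace n M → ℝ} (hH : GeneratesGlobalFlow H)
    (ν : Measure (ExtPhaseSpace n M)) : ℝ :=
  ∫ z, asymptoticMaslov hH z ∂ν

/-- The asymptotic Maslov index of `ν` is well defined: the functions `μ_t` are integrable, the
limit `μ̂` exists almost everywhere and is integrable, and the number `μ̂(ν) = ∫ μ̂ dν` is the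
limit of `(1/t) ∫ μ_t dν` for `t → ∞` in `ℝ`. -/
def HasAsymptoticMaslovIndex {H : ExtPhaseSpace n M → ℝ} (hH : GeneratesGlobalFlow H)
    (ν : Measure (ExtPhaseSpace n M)) : Prop :=
  (∀ t : ℝ, 0 ≤ t → Integrable (maslovFun hH t) ν) ∧
  (∀ᵐ z ∂ν, Tendsto (fun k : ℕ => maslovFun hH (k : ℝ) z / (k : ℝ)) atTop
    (𝓝 (asymptoticMaslov hH z))) ∧
  Integrable (asymptoticMaslov hH) ν ∧
  Tendsto (fun t : ℝ => 1 / t * ∫ z, maslovFun hH t z ∂ν) atTop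
    (𝓝 (asymptoticMaslovIndex hH ν))

end Hamiltonian

/-- Uniform integrability of one function `f` with respect to a sequence of measures:
`sup_j ∫_{|f| ≥ c} |f| dη_j → 0` as `c → +∞`. -/
def UnifIntegrableWrt {Ω : Type*} [MeasurableSpace Ω] (f : Ω → ℝ) (η : ℕ → Measure Ω) : Prop :=
  Tendsto (fun c : ℝ => ⨆ j, ∫⁻ z in {z | c ≤ |f z|}, ENNReal.ofReal |f z| ∂(η j)) atTop (𝓝 0)

/-!
The functions `μ_t` are neither continuous nor a cocycle for the flow, but they are both up to
errors bounded in terms of `n`, and such errors disappear after division by `t`.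

**Symplectic part.** The Maslov index of a path is compared with the Kashiwara index `τ(A, B, C)`
of three Lagrangian subspaces, which is a cocycle (`kashiwara_cocycle`), is at most `3n` in absolute
value (`abs_kashiwara_le`), and is locally constant on triples of pairwise transverse subspaces.
Hence half of `τ(A, B, l)`, with an auxiliary complement `l` of `A` and `B`, changes by a locally
constant function when `l` is replaced by another one, and "`f` differs locally from `τ(A, B, l) / 2`
by a constant" is a condition on `f` and on the pair `(A, B)` alone (`IsPrimitiveAt`). The index of
the initial pieces of a path is such a primitive (`isPrimitiveAt_maslovIndex`), primitives are unique
up to constants, and they are unchanged when a continuous family of symplectic maps is applied to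
`A` and `B`. Applied to `U(t)⁻¹ Dφ_t T^v` this removes the trivialization `U`: the function
`t ↦ μ_t(s, x) + n / 2` is the primitive, vanishing at `t = 0`, of the pair formed by
`(Dφ_t)⁻¹ T^v` and `T^v` (`isPrimitiveAt_maslovPrim`). Two consequences follow. Changing the
reference subspace costs at most a difference of two Kashiwara indices, whence
`|μ_{s+r} - μ_s - μ_r ∘ φ_s| ≤ 4n` (`abs_maslovFun_add_sub_le`). And primitives on all lines
`ℝ × {z}` which agree at `t = 0` form a primitive jointly in `(t, z)` (`isPrimitiveAt_prod`), whence
`μ_t(z)` is measurable in `(t, z)` and differs by at most `3n` from its value at any sufficiently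
close point.

**Flow part.** The preceding argument needs that `Dφ_t` is symplectic and depends continuously on
all variables, and that trivializations exist. The flow is shown to be of class `C²`
(`contMDiff_evolution`): locally by the implicit function theorem for the integral equation in a
space of continuous functions (`exists_contDiffAt_local_flow`), and globally by continuation in
time. The charts of `T*M` are symplectic because they are cotangent lifts of changes of coordinates
of `M` (`stdForm_chartDeriv`), and `ω(Dφ_t u, Dφ_t v)` has zero derivative in `t`
(`stdForm_flowDeriv`). A trivialization along an orbit is obtained by gluing local ones
(`exists_isVerticalTrivialization`).

**Ergodic part.** For an integrable sequence `a_k` with `|a_{k+m} - a_k - a_m ∘ T^k| ≤ C`, the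
pointwise ergodic theorem (`ae_tendsto_birkhoffAverage`) applied to `a_N` and `T^N` shows that
`a_k / k` is eventually within `(C + 1) / N` of a limit, for every `N`; so it converges almost
everywhere, and `|∫ a_N - N ∫ lim a_k / k| ≤ C + 1` (`quasiCocycle_growth`). Passing from integer to
real times uses that `t ↦ ∫ μ_t` is measurable and additive up to a bounded error, hence bounded on
`[0, 1]` (`tendsto_div_of_quasiAdditive`). For the narrow limit, `μ_t` is replaced by a continuous
function at distance at most `3n`; uniform integrability then bounds
`|∫ μ_t dη_j - ∫ μ_t dη|` by `6n + 1` for large `j`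
(`integrable_and_eventually_abs_integral_sub_le`). With `t = N` large, the asymptotic indices of
`η_j` and `η` differ by at most a constant divided by `N`.
-/

/-! ### Signatures of real quadratic forms -/

/-- The signature of a real quadratic form: the number of positive minus the number of negative
squares. -/
noncomputable def quadSign {W : Type*} [AddCommGroup W] [Module ℝ W] (Q : QuadraticForm ℝ W) : ℤ :=
  (sigPos Q : ℤ) - (sigNeg Q : ℤ)

section Signature

variable {W W' : Type*} [AddCommGroup W] [Module ℝ W] [AddCommGroup W'] [Module ℝ W']

lemma QuadraticForm.equivalent_of_linearEquiv {Q : QuadraticForm ℝ W} {Q' : QuadraticForm ℝ W'}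
    (e : W ≃ₗ[ℝ] W') (h : ∀ x, Q' (e x) = Q x) : QuadraticMap.Equivalent Q Q' :=
  ⟨{ e with map_app' := h }⟩

lemma quadSign_congr {Q : QuadraticForm ℝ W} {Q' : QuadraticForm ℝ W'}
    (e : W ≃ₗ[ℝ] W') (h : ∀ x, Q' (e x) = Q x) : quadSign Q = quadSign Q' := by
  have := QuadraticForm.equivalent_of_linearEquiv e h
  rw [quadSign, quadSign, this.sigPos_eq, this.sigNeg_eq]

lemma quadSign_neg (Q : QuadraticForm ℝ W) : quadSign (-Q) = - quadSign Q := by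
  simp [quadSign]

/-- A form which is turned into its opposite by a linear automorphism has signature zero. -/
lemma quadSign_eq_zero_of_neg {Q : QuadraticForm ℝ W} (e : W ≃ₗ[ℝ] W)
    (h : ∀ x, Q (e x) = - Q x) : quadSign Q = 0 := by
  have := quadSign_congr (Q := -Q) (Q' := Q) e (fun x => by simp [h])
  rw [quadSign_neg] at this
  omega

lemma abs_quadSign_le [FiniteDimensional ℝ W] (Q : QuadraticForm ℝ W) :
    |quadSign Q| ≤ Module.finrank ℝ W := by
  have := QuadraticForm.sigPos_add_sigNeg_add_radical (Q := Q)
  rw [quadSign, abs_le]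
  constructor <;> omega

lemma finrank_le_sigPos_of_injective {U : Type*} [AddCommGroup U] [Module ℝ U]
    [FiniteDimensional ℝ W] {Q : QuadraticForm ℝ W} (f : U →ₗ[ℝ] W) (hf : Function.Injective f)
    (h : ∀ u, u ≠ 0 → 0 < Q (f u)) : Module.finrank ℝ U ≤ sigPos Q := by
  rw [← LinearMap.finrank_range_of_inj hf]
  apply le_sigPos_of_posDef
  rintro ⟨_, u, rfl⟩ hu
  have hu' : u ≠ 0 := by
    rintro rfl
    exact hu (by ext; simp)
  simpa using h u hu'

lemma exists_posDef_pos {Q : QuadraticForm ℝ W} [FiniteDimensional ℝ W] :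
    ∃ V : Submodule ℝ W, Module.finrank ℝ V = sigPos Q ∧ ∀ v ∈ V, v ≠ 0 → 0 < Q v := by
  obtain ⟨V, hV, hQ⟩ := exists_finrank_eq_sigPos_and_posDef Q
  refine ⟨V, hV, fun v hv h0 => ?_⟩
  have := hQ ⟨v, hv⟩ (by simpa using h0)
  simpa using this

lemma sigPos_add_le_prod [FiniteDimensional ℝ W] [FiniteDimensional ℝ W']
    (Q : QuadraticForm ℝ W) (Q' : QuadraticForm ℝ W') :
    sigPos Q + sigPos Q' ≤ sigPos (Q.prod Q') := by
  obtain ⟨V, hV, hQ⟩ := exists_posDef_pos (Q := Q)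
  obtain ⟨V', hV', hQ'⟩ := exists_posDef_pos (Q := Q')
  rw [← hV, ← hV', ← Module.finrank_prod]
  refine finrank_le_sigPos_of_injective (V.subtype.prodMap V'.subtype) ?_ ?_
  · exact Prod.map_injective.2 ⟨V.injective_subtype, V'.injective_subtype⟩
  · rintro ⟨⟨v, hv⟩, ⟨v', hv'⟩⟩ h
    simp only [LinearMap.prodMap_apply, Submodule.subtype_apply, QuadraticMap.prod_apply]
    by_cases h0 : v = 0
    · have h1 : v' ≠ 0 := by
        rintro rfl
        exact h (by simp [h0])
      simpa [h0] using hQ' v' hv' h1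
    · by_cases h1 : v' = 0
      · simpa [h1] using hQ v hv h0
      · exact add_pos (hQ v hv h0) (hQ' v' hv' h1)

/-- The signature is additive on orthogonal sums. -/
lemma quadSign_prod [FiniteDimensional ℝ W] [FiniteDimensional ℝ W']
    (Q : QuadraticForm ℝ W) (Q' : QuadraticForm ℝ W') :
    quadSign (Q.prod Q') = quadSign Q + quadSign Q' := by
  have h1 := sigPos_add_le_prod Q Q'
  have h2 : sigNeg Q + sigNeg Q' ≤ sigNeg (Q.prod Q') := by
    have := sigPos_add_le_prod (-Q) (-Q')
    have e : (-Q).prod (-Q') = -(Q.prod Q') := by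
      ext x
      simp only [QuadraticMap.prod_apply, neg_apply]
      ring
    rwa [e] at this
  have h3 : Module.finrank ℝ Q.radical + Module.finrank ℝ Q'.radical ≤
      Module.finrank ℝ (Q.prod Q').radical := by
    rw [← Module.finrank_prod]
    refine LinearMap.finrank_le_finrank_of_injective
      (f := (Q.radical.subtype.prodMap Q'.radical.subtype).codRestrict _ ?_) ?_
    · rintro ⟨⟨v, hv⟩, ⟨v', hv'⟩⟩
      rw [QuadraticMap.mem_radical_iff'] at hv hv' ⊢
      simp [hv.1, hv'.1, hv.2, hv'.2]
    · rw [LinearMap.injective_codRestrict_iff]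
      exact Prod.map_injective.2 ⟨Submodule.injective_subtype _, Submodule.injective_subtype _⟩
  have e1 := QuadraticForm.sigPos_add_sigNeg_add_radical (Q := Q)
  have e2 := QuadraticForm.sigPos_add_sigNeg_add_radical (Q := Q')
  have e3 := QuadraticForm.sigPos_add_sigNeg_add_radical (Q := Q.prod Q')
  rw [Module.finrank_prod] at e3
  simp only [quadSign]
  omega

end Signature

section Semicontinuity

variable {X : Type*} [TopologicalSpace X]
  {W : Type*} [NormedAddCommGroup W] [NormedSpace ℝ W] [FiniteDimensional ℝ W]

/-- Positivity on a subspace persists under small perturbations of the form, by compactness of its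
unit sphere; hence the number of positive squares is lower semicontinuous. -/
lemma eventually_sigPos_le (Q : X → QuadraticForm ℝ W) {x : X}
    (hQ : ∀ v, ContinuousAt (fun z : X × W => Q z.1 z.2) (x, v)) :
    ∀ᶠ y in 𝓝 x, sigPos (Q x) ≤ sigPos (Q y) := by
  obtain ⟨V, hV, hpos⟩ := exists_posDef_pos (Q := Q x)
  have hK : IsCompact (((↑) : V → W) '' Metric.sphere (0 : V) 1) :=
    (isCompact_sphere _ _).image continuous_subtype_val
  have key : ∀ᶠ y in 𝓝 x, ∀ v ∈ ((↑) : V → W) '' Metric.sphere (0 : V) 1, 0 < Q y v := by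
    refine hK.eventually_forall_of_forall_eventually ?_
    rintro _ ⟨v, hv, rfl⟩
    have h0 : (v : W) ≠ 0 := by
      rintro h
      have : v = 0 := by exact_mod_cast h
      simp [this] at hv
    exact (hQ v).eventually (lt_mem_nhds (hpos v v.2 h0))
  filter_upwards [key] with y hy
  rw [← hV]
  refine finrank_le_sigPos_of_injective V.subtype V.injective_subtype fun u hu => ?_
  have hn : ‖u‖ ≠ 0 := norm_ne_zero_iff.2 hu
  have h1 := hy _ ⟨‖u‖⁻¹ • u, by
    rw [mem_sphere_zero_iff_norm, norm_smul, norm_inv, norm_norm, inv_mul_cancel₀ hn], rfl⟩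
  simp only [Submodule.coe_smul, QuadraticMap.map_smul, smul_eq_mul] at h1
  have : 0 < ‖u‖⁻¹ * ‖u‖⁻¹ := by positivity
  exact (mul_pos_iff_of_pos_left this).1 h1

lemma eventually_sigNeg_le (Q : X → QuadraticForm ℝ W) {x : X}
    (hQ : ∀ v, ContinuousAt (fun z : X × W => Q z.1 z.2) (x, v)) :
    ∀ᶠ y in 𝓝 x, sigNeg (Q x) ≤ sigNeg (Q y) := by
  have := eventually_sigPos_le (fun y => - Q y) (x := x) (fun v => (hQ v).neg)
  simpa using this

end Semicontinuity

/-! ### The Kashiwara index of three Lagrangian subspaces -/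

section Kashiwara

variable {n : ℕ}

@[simp] lemma stdForm_apply (x y : StdSpace n) : stdForm n x y = x.2 y.1 - y.2 x.1 := rfl

lemma stdForm_self (x : StdSpace n) : stdForm n x x = 0 := by simp

lemma stdForm_swap (x y : StdSpace n) : stdForm n x y = - stdForm n y x := by simp

variable {W₁ W₂ W₃ U₁ U₂ U₃ : Type*} [AddCommGroup W₁] [Module ℝ W₁] [AddCommGroup W₂] [Module ℝ W₂]
  [AddCommGroup W₃] [Module ℝ W₃] [AddCommGroup U₁] [Module ℝ U₁] [AddCommGroup U₂] [Module ℝ U₂]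
  [AddCommGroup U₃] [Module ℝ U₃]

/-- The quadratic form `(x, y, z) ↦ ω₀(a x, b y) + ω₀(b y, c z) + ω₀(c z, a x)`, for three subspaces
parametrized by the linear maps `a`, `b`, `c`. -/
noncomputable def kashiwaraForm (a : W₁ →ₗ[ℝ] StdSpace n) (b : W₂ →ₗ[ℝ] StdSpace n)
    (c : W₃ →ₗ[ℝ] StdSpace n) : QuadraticForm ℝ (W₁ × W₂ × W₃) :=
  LinearMap.BilinMap.toQuadraticMap
    ((stdForm n).compl₁₂ (a ∘ₗ LinearMap.fst ℝ _ _)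
        (b ∘ₗ LinearMap.fst ℝ _ _ ∘ₗ LinearMap.snd ℝ _ _) +
      (stdForm n).compl₁₂ (b ∘ₗ LinearMap.fst ℝ _ _ ∘ₗ LinearMap.snd ℝ _ _)
        (c ∘ₗ LinearMap.snd ℝ _ _ ∘ₗ LinearMap.snd ℝ _ _) +
      (stdForm n).compl₁₂ (c ∘ₗ LinearMap.snd ℝ _ _ ∘ₗ LinearMap.snd ℝ _ _)
        (a ∘ₗ LinearMap.fst ℝ _ _))

lemma kashiwaraForm_apply (a : W₁ →ₗ[ℝ] StdSpace n) (b : W₂ →ₗ[ℝ] StdSpace n)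
    (c : W₃ →ₗ[ℝ] StdSpace n) (x : W₁ × W₂ × W₃) :
    kashiwaraForm a b c x = stdForm n (a x.1) (b x.2.1) + stdForm n (b x.2.1) (c x.2.2) +
      stdForm n (c x.2.2) (a x.1) := rfl

/-- The signature of `kashiwaraForm a b c`. -/
noncomputable def kashiwaraSign (a : W₁ →ₗ[ℝ] StdSpace n) (b : W₂ →ₗ[ℝ] StdSpace n)
    (c : W₃ →ₗ[ℝ] StdSpace n) : ℤ :=
  quadSign (W := W₁ × W₂ × W₃) (kashiwaraForm a b c)

/-- The Kashiwara index `τ(A, B, C)` of three subspaces: the signature of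
`(x, y, z) ↦ ω₀(x, y) + ω₀(y, z) + ω₀(z, x)` on `A × B × C`. -/
noncomputable def kashiwara (A B C : Submodule ℝ (StdSpace n)) : ℤ :=
  kashiwaraSign (W₁ := A) (W₂ := B) (W₃ := C) A.subtype B.subtype C.subtype

lemma kashiwaraForm_equivalent {a : W₁ →ₗ[ℝ] StdSpace n} {b : W₂ →ₗ[ℝ] StdSpace n}
    {c : W₃ →ₗ[ℝ] StdSpace n} {a' : U₁ →ₗ[ℝ] StdSpace n} {b' : U₂ →ₗ[ℝ] StdSpace n}
    {c' : U₃ →ₗ[ℝ] StdSpace n} (e₁ : W₁ ≃ₗ[ℝ] U₁) (e₂ : W₂ ≃ₗ[ℝ] U₂) (e₃ : W₃ ≃ₗ[ℝ] U₃)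
    (g : StdSpace n →ₗ[ℝ] StdSpace n) (hg : ∀ v w, stdForm n (g v) (g w) = stdForm n v w)
    (h₁ : ∀ x, a' (e₁ x) = g (a x)) (h₂ : ∀ x, b' (e₂ x) = g (b x))
    (h₃ : ∀ x, c' (e₃ x) = g (c x)) :
    QuadraticMap.Equivalent (M₁ := W₁ × W₂ × W₃) (M₂ := U₁ × U₂ × U₃)
      (kashiwaraForm a b c) (kashiwaraForm a' b' c') := by
  refine QuadraticForm.equivalent_of_linearEquiv (W := W₁ × W₂ × W₃) (W' := U₁ × U₂ × U₃)
    (e₁.prodCongr (e₂.prodCongr e₃)) ?_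
  rintro ⟨x, y, z⟩
  simp only [kashiwaraForm_apply, LinearEquiv.prodCongr_apply, h₁, h₂, h₃, hg]

lemma kashiwaraSign_congr {a : W₁ →ₗ[ℝ] StdSpace n} {b : W₂ →ₗ[ℝ] StdSpace n}
    {c : W₃ →ₗ[ℝ] StdSpace n} {a' : U₁ →ₗ[ℝ] StdSpace n} {b' : U₂ →ₗ[ℝ] StdSpace n}
    {c' : U₃ →ₗ[ℝ] StdSpace n} (e₁ : W₁ ≃ₗ[ℝ] U₁) (e₂ : W₂ ≃ₗ[ℝ] U₂) (e₃ : W₃ ≃ₗ[ℝ] U₃)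
    (g : StdSpace n →ₗ[ℝ] StdSpace n) (hg : ∀ v w, stdForm n (g v) (g w) = stdForm n v w)
    (h₁ : ∀ x, a' (e₁ x) = g (a x)) (h₂ : ∀ x, b' (e₂ x) = g (b x))
    (h₃ : ∀ x, c' (e₃ x) = g (c x)) :
    kashiwaraSign a b c = kashiwaraSign a' b' c' := by
  have := kashiwaraForm_equivalent e₁ e₂ e₃ g hg h₁ h₂ h₃
  simp only [kashiwaraSign, quadSign, this.sigPos_eq, this.sigNeg_eq]

/-- The Kashiwara index computed from injective parametrizations. -/
lemma kashiwara_map_eq {A B C : Submodule ℝ (StdSpace n)}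
    {a b c : StdSpace n →ₗ[ℝ] StdSpace n} (ha : Function.Injective a) (hb : Function.Injective b)
    (hc : Function.Injective c) :
    kashiwara (A.map a) (B.map b) (C.map c) =
      kashiwaraSign (W₁ := A) (W₂ := B) (W₃ := C)
        (a ∘ₗ A.subtype) (b ∘ₗ B.subtype) (c ∘ₗ C.subtype) := by
  symm
  exact kashiwaraSign_congr (Submodule.equivMapOfInjective a ha A)
    (Submodule.equivMapOfInjective b hb B) (Submodule.equivMapOfInjective c hc C) LinearMap.id
    (fun _ _ => rfl) (fun _ => rfl) (fun _ => rfl) (fun _ => rfl)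

/-- The Kashiwara index is invariant under symplectic maps. -/
lemma kashiwara_map_symplectic {A B C : Submodule ℝ (StdSpace n)}
    {g : StdSpace n →ₗ[ℝ] StdSpace n} (hi : Function.Injective g)
    (hg : ∀ v w, stdForm n (g v) (g w) = stdForm n v w) :
    kashiwara (A.map g) (B.map g) (C.map g) = kashiwara A B C := by
  rw [kashiwara_map_eq hi hi hi, kashiwara]
  symm
  exact kashiwaraSign_congr (.refl ℝ _) (.refl ℝ _) (.refl ℝ _) g hg
    (fun _ => rfl) (fun _ => rfl) (fun _ => rfl)

lemma finrank_momentumSpace : Module.finrank ℝ (MomentumSpace n) = n := by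
  rw [← LinearEquiv.finrank_eq (LinearMap.toContinuousLinearMap :
    (EuclideanSpace ℝ (Fin n) →ₗ[ℝ] ℝ) ≃ₗ[ℝ] _), Subspace.dual_finrank_eq]
  simp

lemma finrank_stdSpace : Module.finrank ℝ (StdSpace n) = n + n := by
  rw [Module.finrank_prod, finrank_momentumSpace, finrank_euclideanSpace_fin]

lemma abs_kashiwaraSign_le [FiniteDimensional ℝ W₁] [FiniteDimensional ℝ W₂]
    [FiniteDimensional ℝ W₃] (a : W₁ →ₗ[ℝ] StdSpace n) (b : W₂ →ₗ[ℝ] StdSpace n)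
    (c : W₃ →ₗ[ℝ] StdSpace n) : |kashiwaraSign a b c| ≤
      (Module.finrank ℝ W₁ + (Module.finrank ℝ W₂ + Module.finrank ℝ W₃) : ℕ) := by
  rw [← Module.finrank_prod, ← Module.finrank_prod]
  exact abs_quadSign_le (W := W₁ × W₂ × W₃) _

lemma sigPos_add_sigNeg_kashiwaraForm_le [FiniteDimensional ℝ W₁] [FiniteDimensional ℝ W₂]
    [FiniteDimensional ℝ W₃] (a : W₁ →ₗ[ℝ] StdSpace n) (b : W₂ →ₗ[ℝ] StdSpace n)
    (c : W₃ →ₗ[ℝ] StdSpace n) :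
    sigPos (M := W₁ × W₂ × W₃) (kashiwaraForm a b c) +
      sigNeg (M := W₁ × W₂ × W₃) (kashiwaraForm a b c) ≤
      Module.finrank ℝ W₁ + (Module.finrank ℝ W₂ + Module.finrank ℝ W₃) := by
  rw [← Module.finrank_prod, ← Module.finrank_prod,
    ← QuadraticForm.sigPos_add_sigNeg_add_radical (M := W₁ × W₂ × W₃) (Q := kashiwaraForm a b c)]
  exact Nat.le_add_right _ _

/-- The hypothesis says that the form of `a`, `b`, `c` is nondegenerate. -/
lemma sigPos_add_sigNeg_kashiwaraForm_eq [FiniteDimensional ℝ W₁] [FiniteDimensional ℝ W₂]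
    [FiniteDimensional ℝ W₃] (a : W₁ →ₗ[ℝ] StdSpace n) (b : W₂ →ₗ[ℝ] StdSpace n)
    (c : W₃ →ₗ[ℝ] StdSpace n)
    (h : ∀ x y z, (∀ x', stdForm n (a x') (b y - c z) = 0) →
      (∀ y', stdForm n (b y') (c z - a x) = 0) → (∀ z', stdForm n (c z') (a x - b y) = 0) →
      x = 0 ∧ y = 0 ∧ z = 0) :
    sigPos (M := W₁ × W₂ × W₃) (kashiwaraForm a b c) +
      sigNeg (M := W₁ × W₂ × W₃) (kashiwaraForm a b c) =
      Module.finrank ℝ W₁ + (Module.finrank ℝ W₂ + Module.finrank ℝ W₃) := by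
  have h0 : QuadraticMap.radical (M := W₁ × W₂ × W₃) (kashiwaraForm a b c) = ⊥ := by
    refine (Submodule.eq_bot_iff _).2 ?_
    rintro ⟨x, y, z⟩ hv
    obtain ⟨e0, e⟩ := QuadraticMap.mem_radical_iff'.1 hv
    rw [kashiwaraForm_apply] at e0
    simp only [kashiwaraForm_apply, Prod.forall, Prod.mk_add_mk, map_add, LinearMap.add_apply] at e
    obtain ⟨rfl, rfl, rfl⟩ := h x y z (fun x' => by
        have e1 := e x' 0 0
        simp only [map_zero, LinearMap.zero_apply, add_zero] at e1
        rw [map_sub, stdForm_swap (a x') (c z)]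
        linarith) (fun y' => by
        have e1 := e 0 y' 0
        simp only [map_zero, LinearMap.zero_apply, add_zero] at e1
        rw [map_sub, stdForm_swap (b y') (a x)]
        linarith) (fun z' => by
        have e1 := e 0 0 z'
        simp only [map_zero, LinearMap.zero_apply, add_zero] at e1
        rw [map_sub, stdForm_swap (c z') (b y)]
        linarith)
    rfl
  rw [← Module.finrank_prod, ← Module.finrank_prod,
    ← QuadraticForm.sigPos_add_sigNeg_add_radical (M := W₁ × W₂ × W₃) (Q := kashiwaraForm a b c),
    h0, finrank_bot, add_zero]

lemma abs_kashiwara_le {A B C : Submodule ℝ (StdSpace n)} (hA : IsLagrangian A)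
    (hB : IsLagrangian B) (hC : IsLagrangian C) : |kashiwara A B C| ≤ 3 * n := by
  have := abs_kashiwaraSign_le (W₁ := A) (W₂ := B) (W₃ := C) A.subtype B.subtype C.subtype
  rw [hA.1, hB.1, hC.1] at this
  push_cast at this
  unfold kashiwara
  linarith

lemma IsLagrangian.isCompl_iff {A B : Submodule ℝ (StdSpace n)} (hA : IsLagrangian A)
    (hB : IsLagrangian B) : IsCompl A B ↔ Disjoint A B := by
  apply Submodule.isCompl_iff_disjoint
  rw [finrank_stdSpace, hA.1, hB.1]

/-- The form `w ↦ ω₀(a w, b w)`. -/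
noncomputable def pairForm (a b : W₁ →ₗ[ℝ] StdSpace n) : QuadraticForm ℝ W₁ :=
  LinearMap.BilinMap.toQuadraticMap ((stdForm n).compl₁₂ a b)

lemma pairForm_apply (a b : W₁ →ₗ[ℝ] StdSpace n) (w : W₁) :
    pairForm a b w = stdForm n (a w) (b w) := rfl

lemma quadSign_pairForm_swap (a b : W₁ →ₗ[ℝ] StdSpace n) :
    quadSign (pairForm b a) = - quadSign (pairForm a b) := by
  rw [← quadSign_neg]
  congr 1
  ext w
  simp only [pairForm_apply, neg_apply]
  exact stdForm_swap _ _

/-- If the forms `ω₀(a ·, b ·)`, `ω₀(b ·, c ·)`, `ω₀(c ·, a ·)` are symmetric with zero sum, then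
the substitution `x = y₁ + y₃`, `y = y₁ + y₂`, `z = y₂ + y₃` turns the form of `a`, `b`, `c` into
their orthogonal sum. -/
lemma kashiwaraSign_eq_sum [FiniteDimensional ℝ W₁] (a b c : W₁ →ₗ[ℝ] StdSpace n)
    (hab : ∀ w w', stdForm n (a w) (b w') = stdForm n (a w') (b w))
    (hca : ∀ w w', stdForm n (c w) (a w') = stdForm n (c w') (a w))
    (h : ∀ w w', stdForm n (a w) (b w') + stdForm n (b w) (c w') + stdForm n (c w) (a w') = 0) :
    kashiwaraSign a b c =
      quadSign (pairForm a b) + quadSign (pairForm b c) + quadSign (pairForm c a) := by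
  have hsum : quadSign (W := W₁ × W₁ × W₁)
      ((pairForm a b).prod ((pairForm b c).prod (pairForm c a))) =
      quadSign (pairForm a b) + quadSign (pairForm b c) + quadSign (pairForm c a) := by
    rw [quadSign_prod (pairForm a b), quadSign_prod (pairForm b c), add_assoc]
  rw [← hsum]
  symm
  let e : (W₁ × W₁ × W₁) ≃ₗ[ℝ] (W₁ × W₁ × W₁) :=
    { toFun := fun y => (y.1 + y.2.2, y.1 + y.2.1, y.2.1 + y.2.2)
      map_add' := fun y y' => by
        simp only [Prod.fst_add, Prod.snd_add, Prod.mk_add_mk, Prod.mk.injEq]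
        refine ⟨?_, ?_, ?_⟩ <;> abel
      map_smul' := fun r y => by simp
      invFun := fun x => ((1 / 2 : ℝ) • (x.1 + x.2.1 - x.2.2), (1 / 2 : ℝ) • (x.2.1 + x.2.2 - x.1),
        (1 / 2 : ℝ) • (x.1 + x.2.2 - x.2.1))
      left_inv := fun y => by
        ext <;> simp only <;> module
      right_inv := fun y => by
        ext <;> simp only <;> module }
  refine quadSign_congr e ?_
  rintro ⟨y₁, y₂, y₃⟩
  simp only [e, LinearEquiv.coe_mk, LinearMap.coe_mk, AddHom.coe_mk, kashiwaraForm_apply, map_add,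
    LinearMap.add_apply, QuadraticMap.prod_apply, pairForm_apply]
  linarith [h y₁ y₂, h y₁ y₃, h y₂ y₃, hab y₁ y₂, hab y₁ y₃, hab y₂ y₃,
    hca y₁ y₂, hca y₁ y₃, hca y₂ y₃]

/-- The parametrization of a complement of `l` by the quotient by `l`. -/
noncomputable def complSection {l A : Submodule ℝ (StdSpace n)} (h : IsCompl A l) :
    (StdSpace n ⧸ l) →ₗ[ℝ] StdSpace n :=
  A.subtype ∘ₗ (Submodule.quotientEquivOfIsCompl l A h.symm).toLinearMap

lemma complSection_mem {l A : Submodule ℝ (StdSpace n)} (h : IsCompl A l) (w : StdSpace n ⧸ l) :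
    complSection h w ∈ A :=
  Subtype.prop _

lemma complSection_sub_mem {l A B : Submodule ℝ (StdSpace n)} (hA : IsCompl A l) (hB : IsCompl B l)
    (w : StdSpace n ⧸ l) : complSection hB w - complSection hA w ∈ l := by
  have key : ∀ {A : Submodule ℝ (StdSpace n)} (hA : IsCompl A l),
      l.mkQ (complSection hA w) = w := fun {A} hA => by
    have := (Submodule.quotientEquivOfIsCompl l A hA.symm).symm_apply_apply w
    rwa [Submodule.quotientEquivOfIsCompl_symm_apply] at this
  rw [← Submodule.Quotient.mk_eq_zero, ← Submodule.mkQ_apply, map_sub, key, key, sub_self]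

/-- The signature of the form `w ↦ ω₀(a w, b w)`, where `a w` and `b w` are the representatives in
`A` and in `B` of a class `w` modulo their common complement `l`. -/
noncomputable def complSign {l A B : Submodule ℝ (StdSpace n)} (hA : IsCompl A l)
    (hB : IsCompl B l) : ℤ :=
  quadSign (W := StdSpace n ⧸ l)
    (pairForm (W₁ := StdSpace n ⧸ l) (complSection hA) (complSection hB))

lemma complSign_swap {l A B : Submodule ℝ (StdSpace n)} (hA : IsCompl A l)
    (hB : IsCompl B l) : complSign hB hA = - complSign hA hB :=
  quadSign_pairForm_swap (W₁ := StdSpace n ⧸ l) _ _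

section Triple

variable {l A₁ A₂ A₃ : Submodule ℝ (StdSpace n)} (hl : ∀ x ∈ l, ∀ y ∈ l, stdForm n x y = 0)
  (h₁ : IsLagrangian A₁) (h₂ : IsLagrangian A₂) (h₃ : IsLagrangian A₃)
  (c₁ : IsCompl A₁ l) (c₂ : IsCompl A₂ l) (c₃ : IsCompl A₃ l)

include hl h₁ h₂ in
lemma stdForm_complSection_comm (w w' : StdSpace n ⧸ l) :
    stdForm n (complSection c₁ w) (complSection c₂ w') =
      stdForm n (complSection c₁ w') (complSection c₂ w) := by
  have d := complSection_sub_mem c₁ c₂ w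
  have d' := complSection_sub_mem c₁ c₂ w'
  have e0 := hl _ d _ d'
  have e1 := h₂.2 _ (complSection_mem c₂ w) _ (complSection_mem c₂ w')
  have e2 := h₁.2 _ (complSection_mem c₁ w) _ (complSection_mem c₁ w')
  have e3 := stdForm_swap (complSection c₂ w) (complSection c₁ w')
  simp only [map_sub, LinearMap.sub_apply] at e0
  linarith

include hl h₁ h₂ h₃ in
/-- The three pairings of the representatives satisfy a cocycle condition, as `l` and the `Aᵢ` are
isotropic. -/
lemma stdForm_complSection_cyclic (w w' : StdSpace n ⧸ l) :
    stdForm n (complSection c₁ w) (complSection c₂ w') +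
      stdForm n (complSection c₂ w) (complSection c₃ w') +
      stdForm n (complSection c₃ w) (complSection c₁ w') = 0 := by
  have e := hl _ (complSection_sub_mem c₁ c₂ w) _ (complSection_sub_mem c₁ c₃ w')
  have e1 := h₁.2 _ (complSection_mem c₁ w) _ (complSection_mem c₁ w')
  have e2 := stdForm_complSection_comm hl h₁ h₂ c₁ c₂ w w'
  have e3 := stdForm_complSection_comm hl h₁ h₃ c₁ c₃ w w'
  have e4 := stdForm_swap (complSection c₂ w) (complSection c₁ w')
  have e5 := stdForm_swap (complSection c₃ w) (complSection c₁ w')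
  simp only [map_sub, LinearMap.sub_apply] at e
  linarith

include hl h₁ h₂ h₃ in
/-- If three Lagrangian subspaces have a common Lagrangian complement, then their Kashiwara index
is a sum of three signatures, each depending on two of them only. -/
lemma kashiwara_eq_sum :
    kashiwara A₁ A₂ A₃ = complSign c₁ c₂ + complSign c₂ c₃ + complSign c₃ c₁ := by
  unfold complSign
  rw [← kashiwaraSign_eq_sum (W₁ := StdSpace n ⧸ l) _ _ _
    (stdForm_complSection_comm hl h₁ h₂ c₁ c₂)
    (stdForm_complSection_comm hl h₃ h₁ c₃ c₁)
    (stdForm_complSection_cyclic hl h₁ h₂ h₃ c₁ c₂ c₃)]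
  symm
  exact kashiwaraSign_congr (W₁ := StdSpace n ⧸ l) (W₂ := StdSpace n ⧸ l) (W₃ := StdSpace n ⧸ l)
      (U₁ := A₁) (U₂ := A₂) (U₃ := A₃)
      (Submodule.quotientEquivOfIsCompl l A₁ c₁.symm)
      (Submodule.quotientEquivOfIsCompl l A₂ c₂.symm)
      (Submodule.quotientEquivOfIsCompl l A₃ c₃.symm) LinearMap.id (fun _ _ => rfl)
      (fun _ => rfl) (fun _ => rfl) (fun _ => rfl)

end Triple

end Kashiwara

section Lagrangian

variable {n : ℕ}

/-- The graph `{(t v, ⟨v, ·⟩)}` of `t` times the Riesz isomorphism. -/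
noncomputable def rieszGraph (n : ℕ) (t : ℝ) : Submodule ℝ (StdSpace n) :=
  LinearMap.range (LinearMap.prod (t • LinearMap.id)
    ((InnerProductSpace.toDual ℝ (EuclideanSpace ℝ (Fin n))).toLinearEquiv.toLinearMap :
      EuclideanSpace ℝ (Fin n) →ₗ[ℝ] MomentumSpace n))

lemma isLagrangian_rieszGraph (t : ℝ) : IsLagrangian (rieszGraph n t) := by
  constructor
  · rw [rieszGraph, LinearMap.finrank_range_of_inj, finrank_euclideanSpace_fin]
    intro v w h
    exact (InnerProductSpace.toDual ℝ (EuclideanSpace ℝ (Fin n))).injective (congrArg Prod.snd h)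
  · rintro _ ⟨v, rfl⟩ _ ⟨w, rfl⟩
    simp [real_inner_comm]

/-- A Lagrangian subspace meets only finitely many of the subspaces `rieszGraph n t`: vectors in
the intersections for distinct `t` are orthogonal to one another. -/
lemma IsLagrangian.finite_not_disjoint {A : Submodule ℝ (StdSpace n)} (hA : IsLagrangian A) :
    {t : ℝ | ¬ Disjoint A (rieszGraph n t)}.Finite := by
  have h : ∀ t : {t : ℝ | ¬ Disjoint A (rieszGraph n t)}, ∃ v : EuclideanSpace ℝ (Fin n),
      v ≠ 0 ∧ (((t : ℝ) • v, InnerProductSpace.toDual ℝ _ v) : StdSpace n) ∈ A := by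
    rintro ⟨t, ht⟩
    rw [mem_ofPred_eq, Submodule.disjoint_def] at ht
    push Not at ht
    obtain ⟨_, hx, ⟨v, rfl⟩, h0⟩ := ht
    refine ⟨v, ?_, hx⟩
    rintro rfl
    exact h0 (map_zero _)
  choose v hv0 hv using h
  have hli : LinearIndependent ℝ v := by
    refine linearIndependent_of_ne_zero_of_inner_eq_zero hv0 fun s t hst => ?_
    have := hA.2 _ (hv s) _ (hv t)
    simp only [stdForm_apply, InnerProductSpace.toDual_apply_apply, inner_smul_right,
      real_inner_comm (v s) (v t)] at this
    have h2 : ((t : ℝ) - s) * inner ℝ (v s) (v t) = 0 := by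
      rw [sub_mul]
      exact this
    rcases mul_eq_zero.1 h2 with h3 | h3
    · exact absurd (Subtype.ext (by linarith)) hst
    · exact h3
  exact hli.finite

/-- Finitely many Lagrangian subspaces have a common Lagrangian complement. -/
lemma exists_isLagrangian_isCompl (S : Finset (Submodule ℝ (StdSpace n)))
    (hS : ∀ A ∈ S, IsLagrangian A) :
    ∃ l, IsLagrangian l ∧ ∀ A ∈ S, IsCompl A l := by
  have hfin : (⋃ A ∈ S, {t : ℝ | ¬ Disjoint A (rieszGraph n t)}).Finite :=
    S.finite_toSet.biUnion fun A hA => (hS A hA).finite_not_disjoint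
  obtain ⟨t, ht⟩ := hfin.exists_notMem
  refine ⟨_, isLagrangian_rieszGraph t, fun A hA => ?_⟩
  rw [(hS A hA).isCompl_iff (isLagrangian_rieszGraph t)]
  by_contra h
  exact ht (mem_biUnion hA h)

lemma IsLagrangian.map {A : Submodule ℝ (StdSpace n)} (hA : IsLagrangian A)
    {g : StdSpace n →ₗ[ℝ] StdSpace n} (hi : Function.Injective g)
    (hg : ∀ v w, stdForm n (g v) (g w) = stdForm n v w) : IsLagrangian (A.map g) := by
  constructor
  · exact (Submodule.equivMapOfInjective g hi A).finrank_eq.symm.trans hA.1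
  · rintro _ ⟨v, hv, rfl⟩ _ ⟨w, hw, rfl⟩
    rw [hg]
    exact hA.2 v hv w hw

lemma isLagrangian_stdVertical : IsLagrangian (stdVertical n) := by
  constructor
  · have h := LinearMap.finrank_range_add_finrank_ker
      (LinearMap.fst ℝ (EuclideanSpace ℝ (Fin n)) (MomentumSpace n))
    rw [LinearMap.range_eq_top.2 LinearMap.fst_surjective, finrank_top,
      finrank_stdSpace, finrank_euclideanSpace_fin] at h
    exact Nat.add_left_cancel h
  · rintro ⟨x, p⟩ hx ⟨y, q⟩ hy
    have hx' : x = 0 := hx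
    have hy' : y = 0 := hy
    simp [hx', hy']

section Cocycle

variable {A B C D : Submodule ℝ (StdSpace n)}

lemma kashiwara_swap (hA : IsLagrangian A) (hB : IsLagrangian B) (hC : IsLagrangian C) :
    kashiwara B A C = - kashiwara A B C := by
  classical
  obtain ⟨l, hl, h⟩ := exists_isLagrangian_isCompl {A, B, C} (by simp [hA, hB, hC])
  have a := h A (by simp)
  have b := h B (by simp)
  have c := h C (by simp)
  rw [kashiwara_eq_sum hl.2 hA hB hC a b c, kashiwara_eq_sum hl.2 hB hA hC b a c,
    complSign_swap a b, complSign_swap c a, complSign_swap b c]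
  ring

lemma kashiwara_self (hA : IsLagrangian A) (hB : IsLagrangian B) : kashiwara A A B = 0 := by
  have := kashiwara_swap hA hA hB
  omega

/-- The cocycle property of the Kashiwara index. -/
lemma kashiwara_cocycle (hA : IsLagrangian A) (hB : IsLagrangian B) (hC : IsLagrangian C)
    (hD : IsLagrangian D) :
    kashiwara A B C - kashiwara A B D = kashiwara B C D - kashiwara A C D := by
  classical
  obtain ⟨l, hl, h⟩ := exists_isLagrangian_isCompl {A, B, C, D} (by simp [hA, hB, hC, hD])
  have a := h A (by simp)
  have b := h B (by simp)
  have c := h C (by simp)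
  have d := h D (by simp)
  rw [kashiwara_eq_sum hl.2 hA hB hC a b c, kashiwara_eq_sum hl.2 hA hB hD a b d,
    kashiwara_eq_sum hl.2 hB hC hD b c d, kashiwara_eq_sum hl.2 hA hC hD a c d,
    complSign_swap d b, complSign_swap c a, complSign_swap a d]
  rw [complSign_swap b d, complSign_swap d a]
  ring

end Cocycle

/-- Completing the square: if `b = a + ι ∘ d`, the form of `a`, `b`, `ι` is the orthogonal sum of
`ω₀(a ·, b ·)` and a hyperbolic form. -/
lemma kashiwaraSign_eq_quadSign_pairForm {W L : Type*} [AddCommGroup W] [Module ℝ W]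
    [AddCommGroup L] [Module ℝ L] [FiniteDimensional ℝ W] [FiniteDimensional ℝ L]
    (a b : W →ₗ[ℝ] StdSpace n) (i : L →ₗ[ℝ] StdSpace n) (d : W →ₗ[ℝ] L)
    (hd : ∀ w, b w = a w + i (d w)) (hi : ∀ x y, stdForm n (i x) (i y) = 0)
    (ha : ∀ x y, stdForm n (a x) (a y) = 0)
    (hab : ∀ w w', stdForm n (a w) (b w') = stdForm n (a w') (b w)) :
    kashiwaraSign a b i = quadSign (pairForm a b) := by
  let q : QuadraticForm ℝ (W × L) := LinearMap.BilinMap.toQuadraticMap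
    ((stdForm n).compl₁₂ (a ∘ₗ LinearMap.fst ℝ _ _) (i ∘ₗ LinearMap.snd ℝ _ _))
  have hq : ∀ x, q x = stdForm n (a x.1) (i x.2) := fun _ => rfl
  have hq0 : quadSign q = 0 := by
    refine quadSign_eq_zero_of_neg ((LinearEquiv.refl ℝ W).prodCongr (LinearEquiv.neg ℝ)) ?_
    rintro ⟨u, z⟩
    rw [hq, hq]
    simp only [LinearEquiv.prodCongr_apply, LinearEquiv.refl_apply, LinearEquiv.neg_apply, map_neg]
  have hsum : quadSign (W := W × W × L) ((pairForm a b).prod q) = quadSign (pairForm a b) := by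
    rw [quadSign_prod (pairForm a b) q, hq0, add_zero]
  rw [← hsum]
  symm
  let e : (W × W × L) ≃ₗ[ℝ] (W × W × L) :=
    { toFun := fun y => (y.1, y.1 + y.2.1, y.2.2 - d y.1)
      map_add' := fun y y' => by
        simp only [Prod.fst_add, Prod.snd_add, Prod.mk_add_mk, Prod.mk.injEq, map_add, true_and]
        constructor <;> abel
      map_smul' := fun r y => by simp [smul_sub]
      invFun := fun x => (x.1, x.2.1 - x.1, x.2.2 + d x.1)
      left_inv := fun y => by simp
      right_inv := fun y => by simp }
  refine quadSign_congr e ?_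
  rintro ⟨w, u, z⟩
  have h1 := hab w u
  simp only [hd, map_add, ha, zero_add] at h1
  simp only [e, LinearEquiv.coe_mk, LinearMap.coe_mk, AddHom.coe_mk, kashiwaraForm_apply, map_add,
    LinearMap.add_apply, QuadraticMap.prod_apply, pairForm_apply, hq, hd, ha, hi, map_sub,
    LinearMap.sub_apply, h1, stdForm_swap (i _) (a _)]
  ring

lemma kashiwara_eq_complSign {A B l : Submodule ℝ (StdSpace n)} (hA : IsLagrangian A)
    (hB : IsLagrangian B) (hl : IsLagrangian l) (cA : IsCompl A l) (cB : IsCompl B l) :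
    kashiwara A B l = complSign cA cB := by
  have h1 : kashiwaraSign (W₁ := StdSpace n ⧸ l) (W₂ := StdSpace n ⧸ l) (W₃ := l)
      (complSection cA) (complSection cB) l.subtype = kashiwara A B l :=
    kashiwaraSign_congr (W₁ := StdSpace n ⧸ l) (W₂ := StdSpace n ⧸ l) (W₃ := l)
      (U₁ := A) (U₂ := B) (U₃ := l)
      (Submodule.quotientEquivOfIsCompl l A cA.symm)
      (Submodule.quotientEquivOfIsCompl l B cB.symm) (.refl ℝ l)
      LinearMap.id (fun _ _ => rfl) (fun _ => rfl) (fun _ => rfl) (fun _ => rfl)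
  rw [← h1]
  refine kashiwaraSign_eq_quadSign_pairForm (W := StdSpace n ⧸ l) (L := l) _ _ _
    ((complSection cB - complSection cA).codRestrict l (complSection_sub_mem cA cB)) ?_ ?_ ?_ ?_
  · intro w
    simp
  · exact fun x y => hl.2 _ x.2 _ y.2
  · exact fun x y => hA.2 _ (complSection_mem cA x) _ (complSection_mem cA y)
  · exact stdForm_complSection_comm hl.2 hA hB cA cB

/-- The signature in the definition of the Maslov index is a Kashiwara index. -/
lemma relSign_eq_kashiwara {A B l : Submodule ℝ (StdSpace n)} (hA : IsLagrangian A)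
    (hB : IsLagrangian B) (hl : IsLagrangian l) (cA : IsCompl A l) (cB : IsCompl B l) :
    relSign cA B = kashiwara A B l := by
  rw [kashiwara_eq_complSign hA hB hl cA cB]
  symm
  refine quadSign_congr (W := StdSpace n ⧸ l) (W' := B)
    (Submodule.quotientEquivOfIsCompl l B cB.symm) fun w => ?_
  have hb : complSection cB w = complSection cA w + (complSection cB w - complSection cA w) := by
    abel
  have p1 : A.projection l cA (complSection cB w) = complSection cA w := by
    rw [hb, map_add, Submodule.projection_apply_of_mem_left _ (complSection_mem cA w),
      (Submodule.projection_apply_eq_zero_iff _).2 (complSection_sub_mem cA cB w), add_zero]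
  have p2 : l.projection A cA.symm (complSection cB w) =
      complSection cB w - complSection cA w := by
    rw [Submodule.projection_eq_self_sub_projection cA, p1]
  change stdForm n (A.projection l cA (complSection cB w))
    (l.projection A cA.symm (complSection cB w)) =
      stdForm n (complSection cA w) (complSection cB w)
  rw [p1, p2, map_sub, stdForm_self, sub_zero]

/-! ### Continuous families of Lagrangian subspaces -/

/-- A family of subspaces is continuous at `x` if near `x` it is the image of a fixed subspace
under injective linear maps depending continuously on the parameter. -/
def LagContAt {X : Type*} [TopologicalSpace X] (A : X → Submodule ℝ (StdSpace n)) (x : X) : Prop :=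
  ∃ (R : Submodule ℝ (StdSpace n)) (g : X → StdSpace n →L[ℝ] StdSpace n), ContinuousAt g x ∧
    ∀ᶠ y in 𝓝 x, Function.Injective (g y) ∧ A y = R.map (g y).toLinearMap

section Families

variable {X Y : Type*} [TopologicalSpace X] [TopologicalSpace Y]

lemma LagContAt.const (A : Submodule ℝ (StdSpace n)) (x : X) : LagContAt (fun _ => A) x :=
  ⟨A, fun _ => ContinuousLinearMap.id ℝ (StdSpace n), continuousAt_const, .of_forall fun _ =>
    ⟨Function.injective_id, (Submodule.map_id A).symm⟩⟩

lemma LagContAt.comp {A : X → Submodule ℝ (StdSpace n)} {f : Y → X} {y : Y}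
    (h : LagContAt A (f y)) (hf : ContinuousAt f y) : LagContAt (fun y => A (f y)) y := by
  obtain ⟨R, g, hg, hR⟩ := h
  exact ⟨R, fun y => g (f y), hg.comp hf, hf.eventually hR⟩

lemma LagContAt.map {A : X → Submodule ℝ (StdSpace n)} {x : X} (h : LagContAt A x)
    {k : X → StdSpace n →L[ℝ] StdSpace n} (hk : ContinuousAt k x)
    (hi : ∀ᶠ y in 𝓝 x, Function.Injective (k y)) :
    LagContAt (fun y => (A y).map (k y).toLinearMap) x := by
  obtain ⟨R, g, hg, hR⟩ := h
  refine ⟨R, fun y => (k y).comp (g y), hk.clm_comp hg, ?_⟩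
  filter_upwards [hR, hi] with y h1 h2
  refine ⟨h2.comp h1.1, ?_⟩
  rw [h1.2]
  exact (Submodule.map_comp _ _ _).symm

lemma eventually_forall_eq_imp_eq_zero {W₁ W₂ V : Type*} [NormedAddCommGroup W₁]
    [NormedSpace ℝ W₁] [FiniteDimensional ℝ W₁] [NormedAddCommGroup W₂] [NormedSpace ℝ W₂]
    [FiniteDimensional ℝ W₂] [NormedAddCommGroup V] [NormedSpace ℝ V]
    {g : X → W₁ →L[ℝ] V} {k : X → W₂ →L[ℝ] V} {x : X} (hg : ContinuousAt g x)
    (hk : ContinuousAt k x) (h : ∀ u v, g x u = k x v → u = 0 ∧ v = 0) :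
    ∀ᶠ y in 𝓝 x, ∀ u v, g y u = k y v → u = 0 ∧ v = 0 := by
  -- the condition is the injectivity of the difference of the two maps
  let G : X → W₁ × W₂ →L[ℝ] V := fun y => (g y).comp (.fst ℝ W₁ W₂) - (k y).comp (.snd ℝ W₁ W₂)
  have hG : ContinuousAt G x :=
    (hg.clm_comp continuousAt_const).sub (hk.clm_comp continuousAt_const)
  have hinj : Function.Injective (G x) := by
    rw [injective_iff_map_eq_zero]
    rintro ⟨u, v⟩ huv
    obtain ⟨rfl, rfl⟩ := h u v (sub_eq_zero.1 huv)
    rfl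
  filter_upwards [hG.eventually (ContinuousLinearMap.isOpen_injective.mem_nhds hinj)]
    with y hy u v huv
  have := (injective_iff_map_eq_zero _).1 hy (u, v) (sub_eq_zero.2 huv)
  exact ⟨congrArg Prod.fst this, congrArg Prod.snd this⟩

lemma eventually_forall_mem_eq_imp_eq_zero {V : Type*} [NormedAddCommGroup V] [NormedSpace ℝ V]
    [FiniteDimensional ℝ V] {g k : X → V →L[ℝ] V} {x : X} (hg : ContinuousAt g x)
    (hk : ContinuousAt k x) (R S : Submodule ℝ V)
    (h : ∀ u ∈ R, ∀ v ∈ S, g x u = k x v → u = 0 ∧ v = 0) :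
    ∀ᶠ y in 𝓝 x, ∀ u ∈ R, ∀ v ∈ S, g y u = k y v → u = 0 ∧ v = 0 := by
  have key := eventually_forall_eq_imp_eq_zero (W₁ := R) (W₂ := S)
    (g := fun y => (g y).comp R.subtypeL) (k := fun y => (k y).comp S.subtypeL)
    (ContinuousAt.clm_comp (f := fun _ => R.subtypeL) hg continuousAt_const)
    (ContinuousAt.clm_comp (f := fun _ => S.subtypeL) hk continuousAt_const)
    (fun u v huv => by simpa using h u u.2 v v.2 huv)
  filter_upwards [key] with y hy u hu v hv huv
  simpa using hy ⟨u, hu⟩ ⟨v, hv⟩ huv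

/-- Transversality is an open condition. -/
lemma eventually_isCompl {A B : X → Submodule ℝ (StdSpace n)} {x : X} (hA : LagContAt A x)
    (hB : LagContAt B x) (lA : ∀ y, IsLagrangian (A y)) (lB : ∀ y, IsLagrangian (B y))
    (h : IsCompl (A x) (B x)) : ∀ᶠ y in 𝓝 x, IsCompl (A y) (B y) := by
  obtain ⟨R, g, hg, hR⟩ := hA
  obtain ⟨S, k, hk, hS⟩ := hB
  have key := eventually_forall_mem_eq_imp_eq_zero hg hk R S ?_
  · filter_upwards [hR, hS, key] with y h1 h2 h3
    rw [(lA y).isCompl_iff (lB y), h1.2, h2.2, Submodule.disjoint_def]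
    rintro _ ⟨u, hu, rfl⟩ ⟨v, hv, huv⟩
    have hu0 : u = 0 := (h3 u hu v hv huv.symm).1
    rw [hu0, map_zero]
  · intro u hu v hv huv
    have h1 := hR.self_of_nhds
    have h2 := hS.self_of_nhds
    have hd := h.disjoint
    rw [h1.2, h2.2, Submodule.disjoint_def] at hd
    have h0 : g x u = 0 := hd _ ⟨u, hu, rfl⟩ ⟨v, hv, huv.symm⟩
    exact ⟨h1.1 (h0.trans (map_zero _).symm), h2.1 ((huv.symm.trans h0).trans (map_zero _).symm)⟩

lemma ContinuousAt.stdForm {u v : X → StdSpace n} {x : X} (hu : ContinuousAt u x)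
    (hv : ContinuousAt v x) : ContinuousAt (fun y => stdForm n (u y) (v y)) x :=
  (hu.snd.clm_apply hv.fst).sub (hv.snd.clm_apply hu.fst)

lemma continuousAt_kashiwaraForm {R S T : Submodule ℝ (StdSpace n)}
    {f g h : X → StdSpace n →L[ℝ] StdSpace n} {x : X} (hf : ContinuousAt f x)
    (hg : ContinuousAt g x) (hh : ContinuousAt h x) (v : R × S × T) :
    ContinuousAt (fun z : X × (R × S × T) => kashiwaraForm (W₁ := R) (W₂ := S) (W₃ := T)
      ((f z.1).toLinearMap ∘ₗ R.subtype)
      ((g z.1).toLinearMap ∘ₗ S.subtype) ((h z.1).toLinearMap ∘ₗ T.subtype) z.2) (x, v) := by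
  have a : ContinuousAt (fun z : X × (R × S × T) => f z.1 z.2.1) (x, v) :=
    (ContinuousAt.comp (x := (x, v)) hf continuousAt_fst).clm_apply (by fun_prop)
  have b : ContinuousAt (fun z : X × (R × S × T) => g z.1 z.2.2.1) (x, v) :=
    (ContinuousAt.comp (x := (x, v)) hg continuousAt_fst).clm_apply (by fun_prop)
  have c : ContinuousAt (fun z : X × (R × S × T) => h z.1 z.2.2.2) (x, v) :=
    (ContinuousAt.comp (x := (x, v)) hh continuousAt_fst).clm_apply (by fun_prop)
  exact ((a.stdForm b).add (b.stdForm c)).add (c.stdForm a)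

lemma eq_zero_of_stdForm_eq_zero {u : StdSpace n} (h : ∀ v, stdForm n v u = 0) : u = 0 := by
  have h1 : u.1 = 0 := by
    have := h (0, InnerProductSpace.toDual ℝ _ u.1)
    simpa using this
  have h2 : u.2 = 0 := by
    ext q
    have := h (q, 0)
    simpa using this
  exact Prod.ext h1 h2

lemma IsLagrangian.mem_of_stdForm_eq_zero {A : Submodule ℝ (StdSpace n)} (hA : IsLagrangian A)
    {u : StdSpace n} (h : ∀ a ∈ A, stdForm n a u = 0) : u ∈ A := by
  obtain ⟨B, hB, hc⟩ := exists_isLagrangian_isCompl {A} (by simp [hA])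
  have hc := hc A (by simp)
  obtain ⟨a, ha, b, hb, rfl⟩ := Submodule.mem_sup.1 (hc.sup_eq_top ▸ Submodule.mem_top (x := u))
  have hb0 : b = 0 := by
    refine eq_zero_of_stdForm_eq_zero fun v => ?_
    obtain ⟨a', ha', b', hb', rfl⟩ :=
      Submodule.mem_sup.1 (hc.sup_eq_top ▸ Submodule.mem_top (x := v))
    have h1 := h a' ha'
    rw [map_add, hA.2 a' ha' a ha, zero_add] at h1
    rw [map_add, LinearMap.add_apply, h1, hB.2 b' hb' b hb, add_zero]
  simpa [hb0] using ha

/-- The number of positive squares of the Kashiwara form. -/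
noncomputable def kashiwaraPos (A B C : Submodule ℝ (StdSpace n)) : ℕ :=
  sigPos (M := A × B × C)
    (kashiwaraForm (W₁ := A) (W₂ := B) (W₃ := C) A.subtype B.subtype C.subtype)

/-- The number of negative squares of the Kashiwara form. -/
noncomputable def kashiwaraNeg (A B C : Submodule ℝ (StdSpace n)) : ℕ :=
  sigNeg (M := A × B × C)
    (kashiwaraForm (W₁ := A) (W₂ := B) (W₃ := C) A.subtype B.subtype C.subtype)

lemma kashiwara_eq_sub (A B C : Submodule ℝ (StdSpace n)) :
    kashiwara A B C = kashiwaraPos A B C - kashiwaraNeg A B C := rfl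

lemma kashiwaraPos_add_kashiwaraNeg_le {A B C : Submodule ℝ (StdSpace n)} (hA : IsLagrangian A)
    (hB : IsLagrangian B) (hC : IsLagrangian C) :
    kashiwaraPos A B C + kashiwaraNeg A B C ≤ n + (n + n) := by
  have := sigPos_add_sigNeg_kashiwaraForm_le (W₁ := A) (W₂ := B) (W₃ := C)
    A.subtype B.subtype C.subtype
  rwa [hA.1, hB.1, hC.1] at this

/-- The Kashiwara form of three pairwise transverse Lagrangian subspaces is non-degenerate. -/
lemma kashiwaraPos_add_kashiwaraNeg_eq {A B C : Submodule ℝ (StdSpace n)} (hA : IsLagrangian A)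
    (hB : IsLagrangian B) (hC : IsLagrangian C) (hAB : Disjoint A B) (hBC : Disjoint B C)
    (hCA : Disjoint C A) : kashiwaraPos A B C + kashiwaraNeg A B C = n + (n + n) := by
  have := sigPos_add_sigNeg_kashiwaraForm_eq (W₁ := A) (W₂ := B) (W₃ := C)
    A.subtype B.subtype C.subtype ?_
  · rwa [hA.1, hB.1, hC.1] at this
  rintro ⟨x, hx⟩ ⟨y, hy⟩ ⟨z, hz⟩ h1 h2 h3
  simp only [Submodule.subtype_apply] at h1 h2 h3
  have hyz : y - z ∈ A := hA.mem_of_stdForm_eq_zero fun a ha => h1 ⟨a, ha⟩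
  have hzx : z - x ∈ B := hB.mem_of_stdForm_eq_zero fun b hb => h2 ⟨b, hb⟩
  have hxy : x - y ∈ C := hC.mem_of_stdForm_eq_zero fun c hc => h3 ⟨c, hc⟩
  have e1 : x + (y - z) = 0 := Submodule.disjoint_def.1 hAB _ (A.add_mem hx hyz) (by
    have := B.sub_mem hy hzx
    rwa [show y - (z - x) = x + (y - z) by abel] at this)
  have e2 : y + (z - x) = 0 := Submodule.disjoint_def.1 hBC _ (B.add_mem hy hzx) (by
    have := C.sub_mem hz hxy
    rwa [show z - (x - y) = y + (z - x) by abel] at this)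
  have e3 : z + (x - y) = 0 := Submodule.disjoint_def.1 hCA _ (C.add_mem hz hxy) (by
    have := A.sub_mem hx hyz
    rwa [show x - (y - z) = z + (x - y) by abel] at this)
  have x0 : x = 0 := by
    have : (2 : ℝ) • x = 0 := by
      rw [show (2 : ℝ) • x = (x + (y - z)) + (z + (x - y)) by module, e1, e3, add_zero]
    simpa using this
  have y0 : y = 0 := by
    have : (2 : ℝ) • y = 0 := by
      rw [show (2 : ℝ) • y = (x + (y - z)) + (y + (z - x)) by module, e1, e2, add_zero]
    simpa using this
  have z0 : z = 0 := by
    have : (2 : ℝ) • z = 0 := by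
      rw [show (2 : ℝ) • z = (y + (z - x)) + (z + (x - y)) by module, e2, e3, add_zero]
    simpa using this
  simp [x0, y0, z0]

lemma kashiwaraForm_map_equivalent {R S T A B C : Submodule ℝ (StdSpace n)}
    {f g h : StdSpace n →L[ℝ] StdSpace n}
    (hf : Function.Injective f ∧ A = R.map f.toLinearMap)
    (hg : Function.Injective g ∧ B = S.map g.toLinearMap)
    (hh : Function.Injective h ∧ C = T.map h.toLinearMap) :
    QuadraticMap.Equivalent (M₁ := A × B × C) (M₂ := R × S × T)
      (kashiwaraForm (W₁ := A) (W₂ := B) (W₃ := C) A.subtype B.subtype C.subtype)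
      (kashiwaraForm (W₁ := R) (W₂ := S) (W₃ := T) (f.toLinearMap ∘ₗ R.subtype)
        (g.toLinearMap ∘ₗ S.subtype) (h.toLinearMap ∘ₗ T.subtype)) := by
  obtain ⟨hf, rfl⟩ := hf
  obtain ⟨hg, rfl⟩ := hg
  obtain ⟨hh, rfl⟩ := hh
  symm
  exact kashiwaraForm_equivalent (W₁ := R) (W₂ := S) (W₃ := T) (U₁ := R.map f.toLinearMap)
    (U₂ := S.map g.toLinearMap) (U₃ := T.map h.toLinearMap)
    (Submodule.equivMapOfInjective f.toLinearMap hf R)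
    (Submodule.equivMapOfInjective g.toLinearMap hg S)
    (Submodule.equivMapOfInjective h.toLinearMap hh T) LinearMap.id
    (fun _ _ => rfl) (fun _ => rfl) (fun _ => rfl) (fun _ => rfl)

section

variable {A B C : X → Submodule ℝ (StdSpace n)} {x : X} (hA : LagContAt A x)
  (hB : LagContAt B x) (hC : LagContAt C x)

include hA hB hC in
lemma eventually_kashiwaraPos_le :
    ∀ᶠ y in 𝓝 x, kashiwaraPos (A x) (B x) (C x) ≤ kashiwaraPos (A y) (B y) (C y) := by
  obtain ⟨R, f, hf, hR⟩ := hA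
  obtain ⟨S, g, hg, hS⟩ := hB
  obtain ⟨T, h, hh, hT⟩ := hC
  have key := eventually_sigPos_le (W := R × S × T)
    (fun y => kashiwaraForm (W₁ := R) (W₂ := S) (W₃ := T) ((f y).toLinearMap ∘ₗ R.subtype)
      ((g y).toLinearMap ∘ₗ S.subtype) ((h y).toLinearMap ∘ₗ T.subtype))
      (continuousAt_kashiwaraForm hf hg hh)
  filter_upwards [hR, hS, hT, key] with y h1 h2 h3 h4
  simp only [kashiwaraPos]
  have e1 := QuadraticMap.Equivalent.sigPos_eq (M := A y × B y × C y) (M' := R × S × T)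
    (kashiwaraForm_map_equivalent h1 h2 h3)
  have e2 := QuadraticMap.Equivalent.sigPos_eq (M := A x × B x × C x) (M' := R × S × T)
    (kashiwaraForm_map_equivalent hR.self_of_nhds hS.self_of_nhds hT.self_of_nhds)
  exact (e2.trans_le h4).trans_eq e1.symm

include hA hB hC in
lemma eventually_kashiwaraNeg_le :
    ∀ᶠ y in 𝓝 x, kashiwaraNeg (A x) (B x) (C x) ≤ kashiwaraNeg (A y) (B y) (C y) := by
  obtain ⟨R, f, hf, hR⟩ := hA
  obtain ⟨S, g, hg, hS⟩ := hB
  obtain ⟨T, h, hh, hT⟩ := hC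
  have key := eventually_sigNeg_le (W := R × S × T)
    (fun y => kashiwaraForm (W₁ := R) (W₂ := S) (W₃ := T) ((f y).toLinearMap ∘ₗ R.subtype)
      ((g y).toLinearMap ∘ₗ S.subtype) ((h y).toLinearMap ∘ₗ T.subtype))
      (continuousAt_kashiwaraForm hf hg hh)
  filter_upwards [hR, hS, hT, key] with y h1 h2 h3 h4
  simp only [kashiwaraNeg]
  have e1 := QuadraticMap.Equivalent.sigNeg_eq (M := A y × B y × C y) (M' := R × S × T)
    (kashiwaraForm_map_equivalent h1 h2 h3)
  have e2 := QuadraticMap.Equivalent.sigNeg_eq (M := A x × B x × C x) (M' := R × S × T)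
    (kashiwaraForm_map_equivalent hR.self_of_nhds hS.self_of_nhds hT.self_of_nhds)
  exact (e2.trans_le h4).trans_eq e1.symm

include hA hB hC in
/-- The Kashiwara index is locally constant on triples of pairwise transverse subspaces. -/
lemma eventually_kashiwara_eq (lA : ∀ y, IsLagrangian (A y)) (lB : ∀ y, IsLagrangian (B y))
    (lC : ∀ y, IsLagrangian (C y)) (hAB : IsCompl (A x) (B x)) (hBC : IsCompl (B x) (C x))
    (hAC : IsCompl (A x) (C x)) :
    ∀ᶠ y in 𝓝 x, kashiwara (A y) (B y) (C y) = kashiwara (A x) (B x) (C x) := by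
  filter_upwards [eventually_kashiwaraPos_le hA hB hC, eventually_kashiwaraNeg_le hA hB hC]
    with y h1 h2
  have e1 := kashiwaraPos_add_kashiwaraNeg_le (lA y) (lB y) (lC y)
  have e2 := kashiwaraPos_add_kashiwaraNeg_eq (lA x) (lB x) (lC x) hAB.disjoint hBC.disjoint
    hAC.disjoint.symm
  rw [kashiwara_eq_sub, kashiwara_eq_sub]
  omega

end

/-- The Kashiwara index of continuous families is Borel measurable, being the difference of two
lower semicontinuous functions. -/
lemma measurable_kashiwara [MeasurableSpace X] [OpensMeasurableSpace X]
    {A B C : X → Submodule ℝ (StdSpace n)} (hA : ∀ x, LagContAt A x) (hB : ∀ x, LagContAt B x)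
    (hC : ∀ x, LagContAt C x) : Measurable fun x => kashiwara (A x) (B x) (C x) := by
  have key : ∀ p : X → ℕ, (∀ x, ∀ᶠ y in 𝓝 x, p x ≤ p y) → Measurable fun x => (p x : ℤ) := by
    intro p hp
    have : Measurable p := by
      refine measurable_of_Ici fun k =>
          IsOpen.measurableSet (isOpen_iff_eventually.2 fun x hx => ?_)
      filter_upwards [hp x] with y hy
      exact le_trans (mem_Ici.1 hx) hy
    exact (measurable_of_countable _).comp this
  simp only [kashiwara_eq_sub]
  have h1 := key (fun x => kashiwaraPos (A x) (B x) (C x))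
    fun x => eventually_kashiwaraPos_le (hA x) (hB x) (hC x)
  have h2 := key (fun x => kashiwaraNeg (A x) (B x) (C x))
    fun x => eventually_kashiwaraNeg_le (hA x) (hB x) (hC x)
  exact h1.sub h2

end Families

end Lagrangian

/-! ### Primitives of the Maslov index -/

section Primitive

variable {n : ℕ} {X Y : Type*} [TopologicalSpace X] [TopologicalSpace Y]

/-- `f` is at `x` a local primitive of the relative Maslov index of the pair `(A, B)`: for a
Lagrangian complement `l` of `A x` and `B x`, the function `f` differs from half of the signature
`τ(A, B, l)` by a constant near `x`. -/
def IsPrimitiveAt (A B : X → Submodule ℝ (StdSpace n)) (f : X → ℝ) (x : X) : Prop :=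
  ∀ l, IsLagrangian l → IsCompl (A x) l → IsCompl (B x) l →
    ∀ᶠ y in 𝓝 x, f y - kashiwara (A y) (B y) l / 2 = f x - kashiwara (A x) (B x) l / 2

/-- A continuous family of Lagrangian subspaces. -/
structure IsLagFamily (A : X → Submodule ℝ (StdSpace n)) : Prop where
  lagrangian : ∀ x, IsLagrangian (A x)
  contAt : ∀ x, LagContAt A x

lemma IsLagFamily.const {A : Submodule ℝ (StdSpace n)} (hA : IsLagrangian A) :
    IsLagFamily (fun _ : X => A) :=
  ⟨fun _ => hA, fun _ => .const _ _⟩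

lemma IsLagFamily.comp {A : X → Submodule ℝ (StdSpace n)} (hA : IsLagFamily A) {f : Y → X}
    (hf : Continuous f) : IsLagFamily (fun y => A (f y)) :=
  ⟨fun y => hA.1 (f y), fun y => (hA.2 (f y)).comp hf.continuousAt⟩

lemma injective_of_stdForm_eq {g : StdSpace n →ₗ[ℝ] StdSpace n}
    (hg : ∀ v w, stdForm n (g v) (g w) = stdForm n v w) : Function.Injective g := by
  rw [injective_iff_map_eq_zero]
  intro u hu
  refine eq_zero_of_stdForm_eq_zero fun v => ?_
  rw [← hg, hu, map_zero]

lemma IsLagFamily.map {A : X → Submodule ℝ (StdSpace n)} (hA : IsLagFamily A)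
    {k : X → StdSpace n →L[ℝ] StdSpace n} (hk : Continuous k)
    (hs : ∀ x v w, stdForm n (k x v) (k x w) = stdForm n v w) :
    IsLagFamily (fun x => (A x).map (k x).toLinearMap) :=
  ⟨fun x => (hA.1 x).map (injective_of_stdForm_eq (hs x)) (hs x),
    fun x => (hA.2 x).map hk.continuousAt (.of_forall fun y => injective_of_stdForm_eq (hs y))⟩

variable {A B C D : X → Submodule ℝ (StdSpace n)}

/-- For two families `C`, `D` of complements, the difference of `τ(A, B, C)` and `τ(A, B, D)` is
locally constant: by the cocycle property it is a combination of indices of triples of pairwise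
transverse subspaces. -/
lemma eventually_kashiwara_sub_eq (hA : IsLagFamily A) (hB : IsLagFamily B) (hC : IsLagFamily C)
    (hD : IsLagFamily D) {x : X} (hAC : IsCompl (A x) (C x)) (hBC : IsCompl (B x) (C x))
    (hAD : IsCompl (A x) (D x)) (hBD : IsCompl (B x) (D x)) :
    ∀ᶠ y in 𝓝 x, kashiwara (A y) (B y) (C y) - kashiwara (A y) (B y) (D y) =
      kashiwara (A x) (B x) (C x) - kashiwara (A x) (B x) (D x) := by
  classical
  obtain ⟨m, hm, h⟩ := exists_isLagrangian_isCompl {A x, B x, C x, D x}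
    (by simp [hA.1 x, hB.1 x, hC.1 x, hD.1 x])
  have hM : IsLagFamily (fun _ : X => m) := .const hm
  have key : ∀ {E : X → Submodule ℝ (StdSpace n)}, IsLagFamily E → IsCompl (A x) (E x) →
      IsCompl (B x) (E x) → IsCompl (E x) m →
      ∀ᶠ y in 𝓝 x, kashiwara (A y) (B y) (E y) - kashiwara (A y) (B y) m =
        kashiwara (A x) (B x) (E x) - kashiwara (A x) (B x) m := by
    intro E hE h1 h2 h3
    filter_upwards [eventually_kashiwara_eq (hB.2 x) (hE.2 x) (hM.2 x) hB.1 hE.1 hM.1 h2 h3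
        (h _ (by simp)),
      eventually_kashiwara_eq (hA.2 x) (hE.2 x) (hM.2 x) hA.1 hE.1 hM.1 h1 h3
        (h _ (by simp))] with y e1 e2
    rw [kashiwara_cocycle (hA.1 y) (hB.1 y) (hE.1 y) hm,
      kashiwara_cocycle (hA.1 x) (hB.1 x) (hE.1 x) hm, e1, e2]
  filter_upwards [key hC hAC hBC (h _ (by simp)), key hD hAD hBD (h _ (by simp))] with y e1 e2
  omega

lemma IsPrimitiveAt.congr {A' B' : X → Submodule ℝ (StdSpace n)} {f g : X → ℝ} {x : X}
    (hf : IsPrimitiveAt A B f x) (hA : A' =ᶠ[𝓝 x] A) (hB : B' =ᶠ[𝓝 x] B) (c : ℝ)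
    (hfg : ∀ᶠ y in 𝓝 x, g y = f y + c) : IsPrimitiveAt A' B' g x := by
  intro l hl h1 h2
  rw [hA.self_of_nhds] at h1
  rw [hB.self_of_nhds] at h2
  filter_upwards [hf l hl h1 h2, hA, hB, hfg] with y e1 e2 e3 e4
  rw [e2, e3, e4, hA.self_of_nhds, hB.self_of_nhds, hfg.self_of_nhds]
  linarith

/-- It suffices to test the condition on one complement, possibly depending on the point. -/
lemma isPrimitiveAt_of_family (hA : IsLagFamily A) (hB : IsLagFamily B) {f : X → ℝ} {x : X}
    (hC : IsLagFamily C) (hAC : IsCompl (A x) (C x)) (hBC : IsCompl (B x) (C x))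
    (h : ∀ᶠ y in 𝓝 x, f y - kashiwara (A y) (B y) (C y) / 2 =
      f x - kashiwara (A x) (B x) (C x) / 2) : IsPrimitiveAt A B f x := by
  intro l hl h1 h2
  filter_upwards [h, eventually_kashiwara_sub_eq hA hB hC (.const hl) hAC hBC h1 h2] with y e1 e2
  have e3 : (kashiwara (A y) (B y) (C y) : ℝ) - kashiwara (A y) (B y) l =
    kashiwara (A x) (B x) (C x) - kashiwara (A x) (B x) l := by exact_mod_cast e2
  linarith

/-- The basic example of a primitive. -/
lemma isPrimitiveAt_kashiwara (hA : IsLagFamily A) (hB : IsLagFamily B) {x : X}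
    {l : Submodule ℝ (StdSpace n)} (hl : IsLagrangian l) (h1 : IsCompl (A x) l)
    (h2 : IsCompl (B x) l) :
    IsPrimitiveAt A B (fun y => (kashiwara (A y) (B y) l : ℝ) / 2) x :=
  isPrimitiveAt_of_family hA hB (.const hl) h1 h2 (.of_forall fun y => by simp)

lemma exists_isLagrangian_isCompl_pair {A B : Submodule ℝ (StdSpace n)} (hA : IsLagrangian A)
    (hB : IsLagrangian B) : ∃ l, IsLagrangian l ∧ IsCompl A l ∧ IsCompl B l := by
  classical
  obtain ⟨l, hl, h⟩ := exists_isLagrangian_isCompl {A, B} (by simp [hA, hB])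
  exact ⟨l, hl, h _ (by simp), h _ (by simp)⟩

lemma IsPrimitiveAt.comp {f : X → ℝ} {φ : Y → X} {y : Y} (h : IsPrimitiveAt A B f (φ y))
    (hφ : ContinuousAt φ y) :
    IsPrimitiveAt (fun y => A (φ y)) (fun y => B (φ y)) (fun y => f (φ y)) y :=
  fun l hl h1 h2 => hφ.eventually (h l hl h1 h2)

/-- Two primitives differ by a locally constant function. -/
lemma isLocallyConstant_sub_of_isPrimitiveAt (hA : ∀ x, IsLagrangian (A x))
    (hB : ∀ x, IsLagrangian (B x)) {f g : X → ℝ} (hf : ∀ x, IsPrimitiveAt A B f x)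
    (hg : ∀ x, IsPrimitiveAt A B g x) : IsLocallyConstant (fun x => f x - g x) := by
  rw [IsLocallyConstant.iff_eventually_eq]
  intro x
  obtain ⟨l, hl, h1, h2⟩ := exists_isLagrangian_isCompl_pair (hA x) (hB x)
  filter_upwards [hf x l hl h1 h2, hg x l hl h1 h2] with y e1 e2
  linarith

/-- The Maslov index is invariant under a continuous family of symplectic maps. -/
lemma IsPrimitiveAt.map (hA : IsLagFamily A) (hB : IsLagFamily B) {f : X → ℝ} {x : X}
    (h : IsPrimitiveAt A B f x) {k : X → StdSpace n →L[ℝ] StdSpace n} (hk : Continuous k)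
    (hs : ∀ x v w, stdForm n (k x v) (k x w) = stdForm n v w) :
    IsPrimitiveAt (fun x => (A x).map (k x).toLinearMap) (fun x => (B x).map (k x).toLinearMap)
      f x := by
  obtain ⟨l, hl, h1, h2⟩ := exists_isLagrangian_isCompl_pair (hA.1 x) (hB.1 x)
  have hi : ∀ x, Function.Injective (k x).toLinearMap := fun x => injective_of_stdForm_eq (hs x)
  have hc : ∀ {E l : Submodule ℝ (StdSpace n)}, IsLagrangian E → IsLagrangian l → IsCompl E l →
      IsCompl (E.map (k x).toLinearMap) (l.map (k x).toLinearMap) := by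
    intro E l hE hl hEl
    rw [(hE.map (hi x) (hs x)).isCompl_iff (hl.map (hi x) (hs x))]
    exact Submodule.disjoint_map (hi x) hEl.disjoint
  refine isPrimitiveAt_of_family (hA.map hk hs) (hB.map hk hs) ((IsLagFamily.const hl).map hk hs)
    (hc (hA.1 x) hl h1) (hc (hB.1 x) hl h2) ?_
  filter_upwards [h l hl h1 h2] with y hy
  rw [kashiwara_map_symplectic (hi y) (hs y), kashiwara_map_symplectic (hi x) (hs x)]
  exact hy

/-- A primitive oscillates locally by a bounded amount only. -/
lemma IsPrimitiveAt.eventually_abs_sub_le (hA : ∀ x, IsLagrangian (A x))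
    (hB : ∀ x, IsLagrangian (B x)) {f : X → ℝ} {x : X} (h : IsPrimitiveAt A B f x) :
    ∀ᶠ y in 𝓝 x, |f y - f x| ≤ 3 * n := by
  obtain ⟨l, hl, h1, h2⟩ := exists_isLagrangian_isCompl_pair (hA x) (hB x)
  filter_upwards [h l hl h1 h2] with y hy
  have e1 : |(kashiwara (A y) (B y) l : ℝ)| ≤ 3 * n := by
    exact_mod_cast abs_kashiwara_le (hA y) (hB y) hl
  have e2 : |(kashiwara (A x) (B x) l : ℝ)| ≤ 3 * n := by
    exact_mod_cast abs_kashiwara_le (hA x) (hB x) hl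
  rw [abs_le] at *
  constructor <;> linarith

/-- Near each point, a primitive is half of a Kashiwara index up to a constant, hence measurable. -/
lemma measurable_of_isPrimitiveAt [SecondCountableTopology X] [MeasurableSpace X]
    [OpensMeasurableSpace X] (hA : IsLagFamily A) (hB : IsLagFamily B) {f : X → ℝ}
    (h : ∀ x, IsPrimitiveAt A B f x) : Measurable f := by
  have key : ∀ x, ∃ G : X → ℝ, Measurable G ∧ ∀ᶠ y in 𝓝 x, f y = G y := by
    intro x
    obtain ⟨l, hl, h1, h2⟩ := exists_isLagrangian_isCompl_pair (hA.1 x) (hB.1 x)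
    refine ⟨fun y => (kashiwara (A y) (B y) l : ℝ) / 2 +
      (f x - kashiwara (A x) (B x) l / 2), ?_, ?_⟩
    · have := measurable_kashiwara hA.2 hB.2 (fun x => LagContAt.const l x)
      exact (((measurable_of_countable _).comp this).div_const 2).add_const _
    · filter_upwards [h x l hl h1 h2] with y hy
      linarith
  choose G hG hfG using key
  choose U hU hUo hxU using fun x => mem_nhds_iff.1 (hfG x)
  obtain ⟨s, hs, hsU⟩ := TopologicalSpace.countable_cover_nhds
    (fun x => (hUo x).mem_nhds (hxU x))
  intro t ht
  have : f ⁻¹' t = ⋃ x ∈ s, U x ∩ G x ⁻¹' t := by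
    ext y
    simp only [mem_preimage, mem_iUnion, mem_inter_iff, exists_prop]
    constructor
    · intro hy
      have : y ∈ ⋃ x ∈ s, U x := hsU ▸ mem_univ y
      obtain ⟨x, hx, hyx⟩ := mem_iUnion₂.1 this
      have e : f y = G x y := hU x hyx
      exact ⟨x, hx, hyx, e ▸ hy⟩
    · rintro ⟨x, hx, hyx, hy⟩
      have e : f y = G x y := hU x hyx
      exact e ▸ hy
  rw [this]
  exact .biUnion hs fun x _ => (hUo x).measurableSet.inter (hG x ht)

end Primitive

/-! ### Paths: existence, uniqueness and additivity of the Maslov index -/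

section Path

variable {n : ℕ} {A B : ℝ → Submodule ℝ (StdSpace n)}

/-- Concatenation of primitives. -/
lemma isPrimitiveAt_add_of_min_max (hA : ∀ t, IsLagrangian (A t)) (hB : ∀ t, IsLagrangian (B t))
    {b : ℝ} {f g : ℝ → ℝ}
    (hf : ∀ t, IsPrimitiveAt (fun t => A (min t b)) (fun t => B (min t b)) f t)
    (hg : ∀ t, IsPrimitiveAt (fun t => A (max t b)) (fun t => B (max t b)) g t) (t : ℝ) :
    IsPrimitiveAt A B (fun t => f t + g t) t := by
  obtain ⟨m, hm, m1, m2⟩ := exists_isLagrangian_isCompl_pair (hA b) (hB b)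
  intro l hl h1 h2
  rcases lt_trichotomy t b with htb | rfl | htb
  · filter_upwards [hf t l hl (by simpa [htb.le] using h1) (by simpa [htb.le] using h2),
      hg t m hm (by simpa [htb.le] using m1) (by simpa [htb.le] using m2), gt_mem_nhds htb]
      with y e1 e2 e3
    simp only [min_eq_left htb.le, max_eq_right htb.le, min_eq_left (le_of_lt e3),
      max_eq_right (le_of_lt e3)] at e1 e2
    linarith
  · filter_upwards [hf t l hl (by simpa using h1) (by simpa using h2),
      hg t l hl (by simpa using h1) (by simpa using h2)] with y e1 e2
    rcases le_total y t with e3 | e3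
    · simp only [min_self, max_self, min_eq_left e3, max_eq_right e3] at e1 e2
      linarith
    · simp only [min_self, max_self, min_eq_right e3, max_eq_left e3] at e1 e2
      linarith
  · filter_upwards [hf t m hm (by simpa [htb.le] using m1) (by simpa [htb.le] using m2),
      hg t l hl (by simpa [htb.le] using h1) (by simpa [htb.le] using h2), lt_mem_nhds htb]
      with y e1 e2 e3
    simp only [min_eq_right htb.le, max_eq_left htb.le, min_eq_right (le_of_lt e3),
      max_eq_left (le_of_lt e3)] at e1 e2
    linarith

/-- A path of Lagrangian subspaces has a subdivision such that on each piece the path is transverse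
to a fixed Lagrangian complement of the reference subspace. -/
lemma exists_subdivision {lam0 : Submodule ℝ (StdSpace n)} (h0 : IsLagrangian lam0)
    (hA : IsLagFamily A) {a b : ℝ} (hab : a ≤ b) :
    ∃ (N : ℕ) (τ : ℕ → ℝ) (l : ℕ → Submodule ℝ (StdSpace n)), Monotone τ ∧ τ 0 = a ∧ τ N = b ∧
      (∀ k, IsLagrangian (l k)) ∧ (∀ k, IsCompl lam0 (l k)) ∧
      ∀ k, ∀ t ∈ Icc (τ k) (τ (k + 1)), IsCompl (A t) (l k) := by
  let c : {l : Submodule ℝ (StdSpace n) // IsLagrangian l ∧ IsCompl lam0 l} → Set (Icc a b) :=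
    fun l => {t | IsCompl (A t) l.1}
  have hc : ∀ l, IsOpen (c l) := fun l => isOpen_iff_eventually.2 fun t ht =>
    eventually_isCompl ((hA.comp continuous_subtype_val).2 t) (.const l.1 t)
      (hA.comp continuous_subtype_val).1 (fun _ => l.2.1) ht
  obtain ⟨τ, h1, h2, ⟨N, h3⟩, h4⟩ := exists_monotone_Icc_subset_open_cover_Icc hab hc (by
    intro t _
    obtain ⟨l, hl, l1, l2⟩ := exists_isLagrangian_isCompl_pair h0 (hA.1 t)
    exact mem_iUnion.2 ⟨⟨l, hl, l1⟩, l2⟩)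
  choose l hl using h4
  refine ⟨N, fun k => τ k, fun k => (l k).1, fun i j hij => h2 hij, h1, h3 N le_rfl,
    fun k => (l k).2.1, fun k => (l k).2.2, fun k t ht => ?_⟩
  have htI : t ∈ Icc a b := ⟨(τ k).2.1.trans ht.1, ht.2.trans (τ (k + 1)).2.2⟩
  exact hl k (show (⟨t, htI⟩ : Icc a b) ∈ Icc (τ k) (τ (k + 1)) from ht)

lemma exists_isMaslovIndex {lam0 : Submodule ℝ (StdSpace n)} (h0 : IsLagrangian lam0)
    (hA : IsLagFamily A) {a b : ℝ} (hab : a ≤ b) : ∃ m, IsMaslovIndex A lam0 a b m := by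
  obtain ⟨N, τ, l, h1, h2, h3, h4, h5, h6⟩ := exists_subdivision h0 hA hab
  exact ⟨_, N, τ, l, h5, h1, h2, h3, h4, fun k _ => h6 k, rfl⟩

/-- A continuous path of Lagrangian subspaces has a primitive with respect to a fixed one. -/
lemma exists_isPrimitiveAt_clamp {lam0 : Submodule ℝ (StdSpace n)} (h0 : IsLagrangian lam0)
    (hA : IsLagFamily A) {a b : ℝ} (hab : a ≤ b) :
    ∃ f : ℝ → ℝ, ∀ t, IsPrimitiveAt (fun _ => lam0) (fun t => A (max a (min t b))) f t := by
  obtain ⟨N, τ, l, h1, h2, h3, h4, h5, h6⟩ := exists_subdivision h0 hA hab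
  have key : ∀ k, ∃ f : ℝ → ℝ,
      ∀ t, IsPrimitiveAt (fun _ => lam0) (fun t => A (max a (min t (τ k)))) f t := by
    intro k
    induction k with
    | zero =>
      refine ⟨fun _ => 0, fun t l hl _ _ => .of_forall fun y => ?_⟩
      simp [h2]
    | succ k ih =>
      obtain ⟨f, hf⟩ := ih
      have hk := h1 (Nat.le_succ k)
      have hak : a ≤ τ k := h2 ▸ h1 (Nat.zero_le k)
      have hcl : IsLagFamily (fun t => A (max (τ k) (min t (τ (k + 1))))) :=
        hA.comp (f := fun t => max (τ k) (min t (τ (k + 1)))) (by fun_prop)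
      refine ⟨_, isPrimitiveAt_add_of_min_max (b := τ k) (f := f)
        (g := fun t => (kashiwara lam0 (A (max (τ k) (min t (τ (k + 1))))) (l k) : ℝ) / 2)
        (fun _ => h0) (fun t => hA.1 _) (fun t => ?_) fun t => ?_⟩
      · have e : ∀ t, max a (min (min t (τ k)) (τ (k + 1))) = max a (min t (τ k)) := fun t => by
          rw [min_assoc, min_eq_left hk]
        simpa only [e] using hf t
      · have e : ∀ t, max a (min (max t (τ k)) (τ (k + 1))) = max (τ k) (min t (τ (k + 1))) :=
          fun t => by
            rw [max_eq_right (hak.trans (le_min (le_max_right _ _) hk)), max_min_distrib_left,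
              max_eq_right hk, max_comm]
        simp only [e]
        exact isPrimitiveAt_kashiwara (.const h0) hcl (h4 k) (h5 k)
          (h6 k _ ⟨le_max_left _ _, max_le hk (min_le_right _ _)⟩)
  simpa only [h3] using key N

/-- The Maslov index of a path is the increment of any primitive. -/
lemma IsMaslovIndex.eq_sub {lam0 : Submodule ℝ (StdSpace n)} (h0 : IsLagrangian lam0)
    (hA : IsLagFamily A) {a b m : ℝ} (hab : a ≤ b) (hm : IsMaslovIndex A lam0 a b m) {f : ℝ → ℝ}
    (hf : ∀ t, IsPrimitiveAt (fun _ => lam0) (fun t => A (max a (min t b))) f t) :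
    m = f b - f a := by
  obtain ⟨N, τ, l, hl, h1, rfl, rfl, h4, h5, rfl⟩ := hm
  rw [← Finset.sum_range_sub (fun k => f (τ k))]
  refine Finset.sum_congr rfl fun k hk => ?_
  have hkN : k + 1 ≤ N := Finset.mem_range.1 hk
  have hk1 := h1 (Nat.le_succ k)
  have hmem : ∀ t ∈ Icc (τ k) (τ (k + 1)), max (τ 0) (min t (τ N)) = t := fun t ht => by
    rw [min_eq_left (ht.2.trans (h1 hkN)), max_eq_right ((h1 (Nat.zero_le k)).trans ht.1)]
  let F : Icc (τ k) (τ (k + 1)) → ℝ := fun t => f t - kashiwara lam0 (A t) (l k) / 2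
  have hF : IsLocallyConstant F := by
    rw [IsLocallyConstant.iff_eventually_eq]
    intro t
    have := hf t (l k) (h4 k) (hl k) (by
      simpa only [hmem t t.2] using h5 k hkN t t.2)
    filter_upwards [continuous_subtype_val.continuousAt.eventually this] with y hy
    rw [hmem t t.2, hmem y y.2] at hy
    exact hy
  have : PreconnectedSpace (Icc (τ k) (τ (k + 1))) :=
    Subtype.preconnectedSpace isPreconnected_Icc
  have e := hF.apply_eq_of_preconnectedSpace ⟨τ k, left_mem_Icc.2 hk1⟩
    ⟨τ (k + 1), right_mem_Icc.2 hk1⟩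
  simp only [F] at e
  rw [relSign_eq_kashiwara h0 (hA.1 _) (h4 k) _ (h5 k hkN _ (right_mem_Icc.2 hk1)),
    relSign_eq_kashiwara h0 (hA.1 _) (h4 k) _ (h5 k hkN _ (left_mem_Icc.2 hk1))]
  linarith

/-- The Maslov index is well defined and is the increment of any primitive. -/
lemma maslovIndex_eq_sub {lam0 : Submodule ℝ (StdSpace n)} (h0 : IsLagrangian lam0)
    (hA : IsLagFamily A) {a b : ℝ} (hab : a ≤ b) {f : ℝ → ℝ}
    (hf : ∀ t, IsPrimitiveAt (fun _ => lam0) (fun t => A (max a (min t b))) f t) :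
    maslovIndex A lam0 a b = f b - f a :=
  (Classical.epsilon_spec (exists_isMaslovIndex h0 hA hab)).eq_sub h0 hA hab hf

/-- The Maslov index of the initial pieces of a path, as a function of the end-point, is a
primitive. -/
lemma isPrimitiveAt_maslovIndex {lam0 : Submodule ℝ (StdSpace n)} (h0 : IsLagrangian lam0)
    (hA : IsLagFamily A) (t : ℝ) :
    IsPrimitiveAt (fun _ => lam0) (fun t => A (max t 0))
      (fun t => maslovIndex A lam0 0 (max t 0)) t := by
  obtain ⟨f, hf⟩ := exists_isPrimitiveAt_clamp h0 hA (a := 0) (b := max t 0 + 1) (by positivity)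
  have key : ∀ y, y < max t 0 + 1 → maslovIndex A lam0 0 (max y 0) = f (max y 0) - f 0 := by
    intro y hy
    have hy' : max y 0 ≤ max t 0 + 1 := max_le hy.le (by positivity)
    have := maslovIndex_eq_sub h0 hA (le_max_right y 0) (f := fun s => f (min s (max y 0)))
      (fun s => by
        have := (hf (min s (max y 0))).comp (φ := fun s => min s (max y 0)) (y := s)
          (by fun_prop)
        simpa only [min_assoc, min_eq_left hy'] using this)
    simpa using this
  have ht : t < max t 0 + 1 := (le_max_left t 0).trans_lt (lt_add_one _)
  refine ((hf (max t 0)).comp (φ := fun s => max s 0) (y := t) (by fun_prop)).congr .rfl ?_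
    (- f 0) ?_
  · filter_upwards [gt_mem_nhds ht] with y hy
    rw [min_eq_left (max_le hy.le (by positivity)), max_eq_right (le_max_right _ _)]
  · filter_upwards [gt_mem_nhds ht] with y hy
    rw [key y hy]
    ring

/-- If on each line `ℝ × {z}` the function `F` is a primitive, normalized on `{0} × Z`, where the
two families agree, then `F` is a primitive on `ℝ × Z`. -/
lemma isPrimitiveAt_prod {Z : Type*} [TopologicalSpace Z] {A B : ℝ × Z → Submodule ℝ (StdSpace n)}
    (hA : IsLagFamily A) (hB : IsLagFamily B) {F : ℝ × Z → ℝ}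
    (hF : ∀ z t, IsPrimitiveAt (fun t => A (t, z)) (fun t => B (t, z)) (fun t => F (t, z)) t)
    (hF0 : ∀ z, F (0, z) = 0) (hAB : ∀ z, A (0, z) = B (0, z)) (x : ℝ × Z) :
    IsPrimitiveAt A B F x := by
  obtain ⟨t₀, z₀⟩ := x
  -- on a box of transversality, the difference between `F` and half of the index depends on `z`
  -- only
  have box : ∀ t : ℝ, ∃ l, IsLagrangian l ∧ ∃ I : Set ℝ, IsOpen I ∧ t ∈ I ∧
      (∀ s ∈ I, IsCompl (A (s, z₀)) l ∧ IsCompl (B (s, z₀)) l) ∧ ∀ᶠ z in 𝓝 z₀, ∀ s ∈ I, ∀ s' ∈ I,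
        F (s, z) - kashiwara (A (s, z)) (B (s, z)) l / 2 =
          F (s', z) - kashiwara (A (s', z)) (B (s', z)) l / 2 := by
    intro t
    obtain ⟨l, hl, h1, h2⟩ := exists_isLagrangian_isCompl_pair (hA.1 (t, z₀)) (hB.1 (t, z₀))
    have hev := (eventually_isCompl (hA.2 _) (.const l _) hA.1 (fun _ => hl) h1).and
      (eventually_isCompl (hB.2 _) (.const l _) hB.1 (fun _ => hl) h2)
    rw [nhds_prod_eq, eventually_prod_iff] at hev
    obtain ⟨pa, ha, pb, hb, hab⟩ := hev
    obtain ⟨ε, hε, hI⟩ := Metric.eventually_nhds_iff_ball.1 ha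
    refine ⟨l, hl, Metric.ball t ε, Metric.isOpen_ball, Metric.mem_ball_self hε,
      fun s hs => hab (hI s hs) hb.self_of_nhds, ?_⟩
    filter_upwards [hb] with z hz s hs s' hs'
    let G : Metric.ball t ε → ℝ := fun r =>
      F (r, z) - kashiwara (A (r, z)) (B (r, z)) l / 2
    have hG : IsLocallyConstant G := by
      rw [IsLocallyConstant.iff_eventually_eq]
      intro r
      exact continuous_subtype_val.continuousAt.eventually
        (hF z r l hl (hab (hI r r.2) hz).1 (hab (hI r r.2) hz).2)
    have : PreconnectedSpace (Metric.ball t ε) :=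
      Subtype.preconnectedSpace (convex_ball t ε).isPreconnected
    exact hG.apply_eq_of_preconnectedSpace ⟨s, hs⟩ ⟨s', hs'⟩
  choose l hl I hIo hI hc hbox using box
  -- on such a box, the primitive property passes from one time to every other one
  have spread : ∀ t, ∀ s ∈ I t, ∀ s' ∈ I t,
      (∀ᶠ z in 𝓝 z₀, F (s, z) - kashiwara (A (s, z)) (B (s, z)) (l t) / 2 =
        F (s, z₀) - kashiwara (A (s, z₀)) (B (s, z₀)) (l t) / 2) →
      IsPrimitiveAt A B F (s', z₀) := by
    intro t s hs s' hs' h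
    refine isPrimitiveAt_of_family hA hB (.const (hl t)) (hc t s' hs').1 (hc t s' hs').2 ?_
    rw [nhds_prod_eq]
    have hr : ∀ᶠ r in 𝓝 s', r ∈ I t := (hIo t).mem_nhds hs'
    filter_upwards [hr.prod_mk (h.and (hbox t))] with ⟨r, z⟩ ⟨hr, hz, hz'⟩
    rw [hz' r hr s hs, hz, (hbox t).self_of_nhds s hs s' hs']
  have step : ∀ t, ∀ s ∈ I t, ∀ s' ∈ I t, IsPrimitiveAt A B F (s, z₀) →
      IsPrimitiveAt A B F (s', z₀) := fun t s hs s' hs' h =>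
    spread t s hs s' hs' ((Continuous.prodMk_right s).continuousAt.eventually
      (h (l t) (hl t) (hc t s hs).1 (hc t s hs).2))
  have hclopen : IsClopen {t | IsPrimitiveAt A B F (t, z₀)} := by
    constructor
    · rw [← isOpen_compl_iff, isOpen_iff_mem_nhds]
      intro t ht
      filter_upwards [(hIo t).mem_nhds (hI t)] with s hs hs'
      exact ht (step t s hs t (hI t) hs')
    · rw [isOpen_iff_mem_nhds]
      intro t ht
      filter_upwards [(hIo t).mem_nhds (hI t)] with s hs
      exact step t t (hI t) s hs ht
  have h0 : (0 : ℝ) ∈ {t | IsPrimitiveAt A B F (t, z₀)} := by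
    refine spread 0 0 (hI 0) 0 (hI 0) (.of_forall fun z => ?_)
    rw [hF0, hF0, hAB, hAB, kashiwara_self (hB.1 _) (hl 0), kashiwara_self (hB.1 _) (hl 0)]
  have huniv := hclopen.eq_univ ⟨0, h0⟩
  have : t₀ ∈ {t | IsPrimitiveAt A B F (t, z₀)} := huniv ▸ mem_univ t₀
  exact this

end Path

/-! ### Smooth dependence on initial conditions: the local flow in a vector space -/

section Nemytskii

universe u

/-- The bilinear pairing `(A, h) ↦ (s ↦ A s (h s))` of continuous functions. -/
noncomputable def contPairing (K : Type*) [TopologicalSpace K] [CompactSpace K] (E F : Type*)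
    [NormedAddCommGroup E] [NormedSpace ℝ E] [NormedAddCommGroup F] [NormedSpace ℝ F] :
    C(K, E →L[ℝ] F) →L[ℝ] C(K, E) →L[ℝ] C(K, F) :=
  LinearMap.mkContinuous₂
    (LinearMap.mk₂ ℝ (fun (A : C(K, E →L[ℝ] F)) (h : C(K, E)) =>
        (⟨fun s => A s (h s), A.continuous.clm_apply h.continuous⟩ : C(K, F)))
      (fun _ _ _ => by ext; simp) (fun _ _ _ => by ext; simp) (fun _ _ _ => by ext; simp)
      (fun _ _ _ => by ext; simp)) 1 (fun A h => by
        rw [one_mul, ContinuousMap.norm_le _ (by positivity)]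
        intro s
        exact ((A s).le_opNorm (h s)).trans
          (by gcongr; exacts [A.norm_coe_le_norm s, h.norm_coe_le_norm s]))

variable {K : Type*} [TopologicalSpace K]

/-- The composition operator `u ↦ f ∘ u` on continuous functions. -/
def nemytskii {E F : Type*} [TopologicalSpace E] [TopologicalSpace F] {f : E → F}
    (hf : Continuous f) (u : C(K, E)) : C(K, F) :=
  (ContinuousMap.mk f hf).comp u

@[simp] lemma nemytskii_apply {E F : Type*} [TopologicalSpace E] [TopologicalSpace F] {f : E → F}
    (hf : Continuous f) (u : C(K, E)) (s : K) : nemytskii hf u s = f (u s) := rfl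

lemma continuous_nemytskii {E F : Type*} [TopologicalSpace E] [TopologicalSpace F] {f : E → F}
    (hf : Continuous f) : Continuous (nemytskii hf : C(K, E) → C(K, F)) :=
  ContinuousMap.continuous_postcomp _

variable [CompactSpace K] {E F : Type u} [NormedAddCommGroup E] [NormedSpace ℝ E]
  [NormedAddCommGroup F] [NormedSpace ℝ F]

lemma hasFDerivAt_nemytskii {f : E → F} (hf : ContDiff ℝ 1 f) (u : C(K, E)) :
    HasFDerivAt (nemytskii hf.continuous : C(K, E) → C(K, F))
      (contPairing K E F (nemytskii (hf.continuous_fderiv one_ne_zero) u)) u := by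
  rw [hasFDerivAt_iff_isLittleO_nhds_zero, Asymptotics.isLittleO_iff]
  intro ε hε
  have hc : ContinuousAt (fun v : C(K, E) => nemytskii (hf.continuous_fderiv one_ne_zero) v) u :=
    (continuous_nemytskii _).continuousAt
  obtain ⟨δ, hδ, hδ'⟩ := (Metric.continuousAt_iff (α := C(K, E))
    (β := C(K, E →L[ℝ] F))).1 hc ε hε
  filter_upwards [Metric.ball_mem_nhds (0 : C(K, E)) hδ] with h hh
  rw [ContinuousMap.norm_le _ (by positivity)]
  intro s
  have hball : ∀ y ∈ Metric.ball (u s) δ, ‖fderiv ℝ f y - fderiv ℝ f (u s)‖ ≤ ε := by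
    intro y hy
    -- translate `u` by a constant so that it passes through `y`
    have hd : dist (u + ContinuousMap.const K (y - u s)) u < δ := by
      rw [dist_eq_norm, add_sub_cancel_left]
      refine lt_of_le_of_lt ?_ (mem_ball_iff_norm.1 hy)
      rw [ContinuousMap.norm_le _ (norm_nonneg _)]
      simp
    have := (ContinuousMap.dist_lt_iff hε).1 (hδ' hd) s
    rw [dist_eq_norm] at this
    simpa using this.le
  have hs : ‖h s‖ < δ := (h.norm_coe_le_norm s).trans_lt (by simpa using hh)
  have := Convex.norm_image_sub_le_of_norm_hasFDerivWithin_le' (f := f) (𝕜 := ℝ)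
    (x := u s) (y := u s + h s)
    (fun y _ => (hf.differentiable one_ne_zero y).hasFDerivAt.hasFDerivWithinAt) hball
    (convex_ball _ _) (Metric.mem_ball_self hδ) (by simpa using hs)
  simp only [add_sub_cancel_left] at this
  refine this.trans ?_
  gcongr
  exact h.norm_coe_le_norm s

/-- The class of differentiability is raised by induction, as the derivative of the composition
operator with `f` is the composition operator with `fderiv ℝ f`. -/
lemma contDiff_nemytskii (k : ℕ) : ∀ {F : Type u} [NormedAddCommGroup F] [NormedSpace ℝ F]
    {f : E → F} (hf : ContDiff ℝ k f),
    ContDiff ℝ k (nemytskii hf.continuous : C(K, E) → C(K, F)) := by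
  induction k with
  | zero =>
    intro F _ _ f hf
    exact contDiff_zero.2 (continuous_nemytskii _)
  | succ k ih =>
    intro F _ _ f hf
    have h1 : ContDiff ℝ 1 f := hf.of_le (by exact_mod_cast Nat.le_add_left 1 k)
    have h2 : ContDiff ℝ ((k : WithTop ℕ∞) + 1) f := by exact_mod_cast hf
    rw [contDiff_succ_iff_fderiv] at h2
    have : ContDiff ℝ ((k : WithTop ℕ∞) + 1) (nemytskii hf.continuous : C(K, E) → C(K, F)) := by
      rw [contDiff_succ_iff_fderiv]
      refine ⟨fun u => (hasFDerivAt_nemytskii h1 u).differentiableAt, fun h => by simp at h, ?_⟩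
      have e : fderiv ℝ (nemytskii hf.continuous : C(K, E) → C(K, F)) =
          fun u => contPairing K E F (nemytskii h2.2.2.continuous u) :=
        funext fun u => (hasFDerivAt_nemytskii h1 u).fderiv
      rw [e]
      exact (contPairing K E F).contDiff.comp (ih h2.2.2)
    exact_mod_cast this

end Nemytskii

section LocalFlow

variable {F : Type*} [NormedAddCommGroup F]

/-- The interval on which the rescaled integral curves are considered; it is a neighbourhood of
`[0, 1]`. -/
abbrev FlowInterval : Type := Icc (-2 : ℝ) 2

/-- The extension of a function on `[-2, 2]` to the real line which is constant on both sides. -/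
noncomputable def extendFlow (u : C(FlowInterval, F)) (s : ℝ) : F :=
  u (projIcc (-2) 2 (by norm_num) s)

lemma continuous_extendFlow (u : C(FlowInterval, F)) : Continuous (extendFlow u) :=
  u.continuous.comp continuous_projIcc

variable [NormedSpace ℝ F]

/-- The integration operator `u ↦ (s ↦ ∫₀ˢ u)`. -/
noncomputable def integrationCLM (F : Type*) [NormedAddCommGroup F] [NormedSpace ℝ F] :
    C(FlowInterval, F) →L[ℝ] C(FlowInterval, F) :=
  LinearMap.mkContinuous
    { toFun := fun u => ⟨fun s => ∫ r in (0 : ℝ)..s, extendFlow u r,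
        (intervalIntegral.continuous_primitive
          (fun _ _ => (continuous_extendFlow u).intervalIntegrable _ _) 0).comp
          continuous_subtype_val⟩
      map_add' := fun u v => by
        ext s
        exact intervalIntegral.integral_add ((continuous_extendFlow u).intervalIntegrable _ _)
          ((continuous_extendFlow v).intervalIntegrable _ _)
      map_smul' := fun c u => by
        ext s
        exact intervalIntegral.integral_smul c _ } 2 (fun u => by
    rw [ContinuousMap.norm_le _ (by positivity)]
    intro s
    refine (intervalIntegral.norm_integral_le_of_norm_le_const (C := ‖u‖)
      fun r _ => u.norm_coe_le_norm _).trans ?_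
    rw [mul_comm]
    gcongr
    rw [sub_zero]
    exact abs_le.2 s.2)

/-- The local flow of a `C^k` vector field `g` is of class `C^k`.  The solutions on the time
interval `[-2, 2]` of `y' = t g(y)`, `y(0) = a`, are found by the implicit function theorem in the
Banach space of continuous functions, near the constant solution for `t = 0`. -/
theorem exists_contDiffAt_local_flow [CompleteSpace F] {k : ℕ} (hk : k ≠ 0) {g : F → F}
    (hg : ContDiff ℝ k g) (a₀ : F) {W : Set F} (hW : W ∈ 𝓝 a₀) :
    ∃ y : ℝ × F → ℝ → F, ContDiffAt ℝ k (fun p => y p 1) (0, a₀) ∧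
      ∀ᶠ p in 𝓝 ((0 : ℝ), a₀), y p 0 = p.2 ∧
        (∀ s ∈ Ioo (-2 : ℝ) 2, HasDerivAt (y p) (p.1 • g (y p s)) s) ∧ ∀ s, y p s ∈ W := by
  let cst : F →L[ℝ] C(FlowInterval, F) := ContinuousLinearMap.const ℝ FlowInterval
  let N : C(FlowInterval, F) → C(FlowInterval, F) := nemytskii hg.continuous
  have hN : ContDiff ℝ k N := contDiff_nemytskii k hg
  let J := integrationCLM F
  let Ψ : (ℝ × F) × C(FlowInterval, F) → (ℝ × F) × C(FlowInterval, F) := fun q =>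
    (q.1, q.2 - cst q.1.2 - q.1.1 • J (N q.2))
  let q₀ : (ℝ × F) × C(FlowInterval, F) := ((0, a₀), cst a₀)
  have hΨ : ContDiff ℝ k Ψ := by
    refine contDiff_fst.prodMk ((contDiff_snd.sub (cst.contDiff.comp
      (contDiff_snd.comp contDiff_fst))).sub ?_)
    exact (contDiff_fst.comp contDiff_fst).smul (J.contDiff.comp (hN.comp contDiff_snd))
  let B : ℝ × F →L[ℝ] C(FlowInterval, F) :=
    cst.comp (ContinuousLinearMap.snd ℝ ℝ F) +
      (ContinuousLinearMap.fst ℝ ℝ F).smulRight (J (N (cst a₀)))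
  let e : ((ℝ × F) × C(FlowInterval, F)) ≃L[ℝ] ((ℝ × F) × C(FlowInterval, F)) :=
    ContinuousLinearEquiv.skewProd (.refl ℝ (ℝ × F)) (.refl ℝ C(FlowInterval, F)) (-B)
  have hΨ' : HasFDerivAt Ψ (e : _ →L[ℝ] _) q₀ := by
    have hs : HasFDerivAt (fun q : (ℝ × F) × C(FlowInterval, F) => q.1.1)
        ((ContinuousLinearMap.fst ℝ ℝ F).comp
          (ContinuousLinearMap.fst ℝ (ℝ × F) C(FlowInterval, F))) q₀ :=
      ((ContinuousLinearMap.fst ℝ ℝ F).comp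
          (ContinuousLinearMap.fst ℝ (ℝ × F) C(FlowInterval, F))).hasFDerivAt
    have ha : HasFDerivAt (fun q : (ℝ × F) × C(FlowInterval, F) => cst q.1.2)
        (cst.comp ((ContinuousLinearMap.snd ℝ ℝ F).comp
          (ContinuousLinearMap.fst ℝ (ℝ × F) C(FlowInterval, F)))) q₀ :=
      (cst.comp ((ContinuousLinearMap.snd ℝ ℝ F).comp
          (ContinuousLinearMap.fst ℝ (ℝ × F) C(FlowInterval, F)))).hasFDerivAt
    have hJ : DifferentiableAt ℝ (fun q : (ℝ × F) × C(FlowInterval, F) => J (N q.2)) q₀ :=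
      (J.contDiff.comp (hN.comp contDiff_snd)).differentiable (by exact_mod_cast hk) q₀
    refine (hasFDerivAt_fst.prodMk ((hasFDerivAt_snd.sub ha).sub
      (hs.smul hJ.hasFDerivAt))).congr_fderiv ?_
    ext1
    · refine ContinuousLinearMap.ext fun v => Prod.ext ?_ ?_
      · simp [e]
      · simp [e, B, q₀, sub_eq_add_neg, add_comm]
    · refine ContinuousLinearMap.ext fun v => Prod.ext ?_ ?_
      · simp [e]
      · simp [e, B, q₀]
  have hk' : (k : WithTop ℕ∞) ≠ 0 := by exact_mod_cast hk
  have hst := hΨ.contDiffAt.hasStrictFDerivAt' hΨ' hk'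
  let inv := hst.localInverse Ψ e q₀
  have hinv : ContDiffAt ℝ k inv (Ψ q₀) := hΨ.contDiffAt.to_localInverse hΨ' hk'
  have hq₀ : Ψ q₀ = ((0, a₀), 0) := by simp [Ψ, q₀]
  rw [hq₀] at hinv
  have hinv₀ : inv ((0, a₀), 0) = q₀ := by
    rw [← hq₀]; exact hst.localInverse_apply_image
  have hright : ∀ᶠ q in 𝓝 (((0 : ℝ), a₀), (0 : C(FlowInterval, F))), Ψ (inv q) = q := by
    rw [← hq₀]; exact hst.eventually_right_inverse
  have hemb : ContDiff ℝ k fun p : ℝ × F => (p, (0 : C(FlowInterval, F))) :=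
    contDiff_id.prodMk contDiff_const
  refine ⟨fun p => extendFlow (inv (p, 0)).2, ?_, ?_⟩
  · have h1 : (1 : ℝ) ∈ Icc (-2 : ℝ) 2 := by constructor <;> norm_num
    have : (fun p => extendFlow (inv (p, 0)).2 1) =
        fun p => (ContinuousMap.evalCLM ℝ (⟨1, h1⟩ : FlowInterval) : C(FlowInterval, F) →L[ℝ] F)
          (inv (p, 0)).2 := by
      funext p
      simp only [extendFlow, projIcc_of_mem _ h1]
      rfl
    rw [this]
    exact (ContinuousLinearMap.contDiff _).contDiffAt.comp _
      ((contDiff_snd.contDiffAt).comp _ (hinv.comp (0, a₀) hemb.contDiffAt))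
  · obtain ⟨ε, hε, hεW⟩ := Metric.mem_nhds_iff.1 hW
    have hcont : ContinuousAt (fun p : ℝ × F => (inv (p, 0)).2) (0, a₀) :=
      (hinv.comp (0, a₀) hemb.contDiffAt).continuousAt.snd
    have hnear : ∀ᶠ p in 𝓝 ((0 : ℝ), a₀), dist (inv (p, 0)).2 (cst a₀) < ε := by
      have := hcont.eventually (Metric.ball_mem_nhds _ hε)
      simpa only [hinv₀] using this
    filter_upwards [hnear, hemb.continuous.continuousAt.eventually hright] with p hp hp'
    set u := (inv (p, 0)).2 with hu
    have hfst : (inv (p, 0)).1 = p := congrArg Prod.fst hp'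
    have hsnd : u - cst p.2 - p.1 • J (N u) = 0 := by
      have := congrArg Prod.snd hp'
      simpa only [Ψ, hfst] using this
    have hint : ∀ s (hs : s ∈ Icc (-2 : ℝ) 2),
        extendFlow u s = p.2 + p.1 • ∫ r in (0 : ℝ)..s, g (extendFlow u r) := by
      intro s hs
      have h2 : u - cst p.2 = p.1 • J (N u) := sub_eq_zero.1 hsnd
      have h3 := congrArg (fun v : C(FlowInterval, F) => v ⟨s, hs⟩) h2
      simp only [extendFlow, projIcc_of_mem _ hs]
      exact sub_eq_iff_eq_add'.1 h3
    have hg' : Continuous fun r => g (extendFlow u r) :=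
      hg.continuous.comp (continuous_extendFlow u)
    refine ⟨?_, fun s hs => ?_, fun s => hεW ?_⟩
    · rw [hint 0 (by constructor <;> norm_num)]; simp
    · have h := (intervalIntegral.integral_hasDerivAt_right (hg'.intervalIntegrable 0 s)
        hg'.stronglyMeasurable.stronglyMeasurableAtFilter hg'.continuousAt).const_smul p.1
      refine (h.const_add p.2).congr_of_eventuallyEq ?_
      filter_upwards [isOpen_Ioo.mem_nhds hs] with r hr
      exact hint r (Ioo_subset_Icc_self hr)
    · exact (ContinuousMap.dist_lt_iff hε).1 hp _

end LocalFlow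

/-! ### Smoothness of the flow of a time-dependent vector field on a manifold -/

section ManifoldFlow

variable {F : Type*} [NormedAddCommGroup F] [NormedSpace ℝ F]

/-- Local uniqueness for an ordinary differential equation with `C¹` right-hand side. -/
lemma eventuallyEq_of_hasDerivAt {v : ℝ × F → F} {γ γ' : ℝ → F} {t : ℝ}
    (hv : ContDiffAt ℝ 1 v (t, γ t)) (heq : γ t = γ' t)
    (hγ : ∀ᶠ r in 𝓝 t, HasDerivAt γ (v (r, γ r)) r)
    (hγ' : ∀ᶠ r in 𝓝 t, HasDerivAt γ' (v (r, γ' r)) r) : γ =ᶠ[𝓝 t] γ' := by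
  obtain ⟨K, W, hW, hL⟩ := hv.exists_lipschitzOnWith
  have key : ∀ {c : ℝ → F}, c t = γ t → (∀ᶠ r in 𝓝 t, HasDerivAt c (v (r, c r)) r) →
      ∀ᶠ r in 𝓝 t, HasDerivAt c (v (r, c r)) r ∧ c r ∈ {z | (r, z) ∈ W} := by
    intro c hc hd
    have hcont : ContinuousAt (fun r => (r, c r)) t :=
      continuousAt_id.prodMk hd.self_of_nhds.continuousAt
    refine hd.and (hcont.eventually (?_ : ∀ᶠ q in 𝓝 (t, c t), q ∈ W))
    rw [hc]
    exact hW
  refine ODE_solution_unique_of_eventually (v := fun r z => v (r, z)) (K := K)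
    (s := fun r => {z | (r, z) ∈ W}) (.of_forall fun r => ?_) (key rfl hγ)
    (key heq.symm hγ') heq
  intro z hz z' hz'
  have := hL hz hz'
  simpa [Prod.edist_eq] using this

variable {H : Type*} [TopologicalSpace H] {I : ModelWithCorners ℝ F H}
  {P : Type*} [TopologicalSpace P] [ChartedSpace H P]

/-- Two curves in a Hausdorff manifold agree on an interval if they agree at one point and if, near
each point where they meet, they solve in some chart the same ordinary differential equation. -/
lemma eqOn_of_hasDerivAt_extChartAt [T2Space P] {γ γ' : ℝ → P} {S : Set ℝ} (hS : IsPreconnected S)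
    (hSo : IsOpen S) (hγ : ContinuousOn γ S) (hγ' : ContinuousOn γ' S)
    (h : ∀ t ∈ S, γ t = γ' t → ∃ x₀ : P, γ t ∈ (extChartAt I x₀).source ∧ ∃ v : ℝ × F → F,
      ContDiffAt ℝ 1 v (t, extChartAt I x₀ (γ t)) ∧
      (∀ᶠ r in 𝓝 t, HasDerivAt (fun r => extChartAt I x₀ (γ r)) (v (r, extChartAt I x₀ (γ r))) r) ∧
      (∀ᶠ r in 𝓝 t,
        HasDerivAt (fun r => extChartAt I x₀ (γ' r)) (v (r, extChartAt I x₀ (γ' r))) r))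
    {t₀ : ℝ} (ht₀ : t₀ ∈ S) (h₀ : γ t₀ = γ' t₀) : EqOn γ γ' S := by
  have hloc : ∀ t ∈ S, γ t = γ' t → γ =ᶠ[𝓝 t] γ' := by
    intro t ht he
    obtain ⟨x₀, hx, v, hv, h1, h2⟩ := h t ht he
    have hc := hγ.continuousAt (hSo.mem_nhds ht)
    have hc' := hγ'.continuousAt (hSo.mem_nhds ht)
    have hsrc : (extChartAt I x₀).source ∈ 𝓝 (γ t) := (isOpen_extChartAt_source x₀).mem_nhds hx
    have key := eventuallyEq_of_hasDerivAt hv (by simp only [he]) h1 h2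
    filter_upwards [key, hc hsrc, hc' (he ▸ hsrc)] with r hr hr1 hr2
    exact (extChartAt I x₀).injOn hr1 hr2 hr
  have hsub : S ⊆ {t | γ =ᶠ[𝓝 t] γ'} := by
    refine hS.subset_of_closure_inter_subset (isOpen_iff_mem_nhds.2 fun t ht => ?_)
      ⟨t₀, ht₀, hloc t₀ ht₀ h₀⟩ ?_
    · exact eventually_eventually_nhds.2 ht
    · rintro t ⟨htc, ht⟩
      refine hloc t ht ?_
      by_contra hne
      have hc := hγ.continuousAt (hSo.mem_nhds ht)
      have hc' := hγ'.continuousAt (hSo.mem_nhds ht)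
      have := (hc.prodMk hc').eventually (isClosed_diagonal.isOpen_compl.mem_nhds hne)
      obtain ⟨r, hr1, hr2⟩ := mem_closure_iff_nhds.1 htc _ this
      exact hr1 (show γ r = γ' r from EventuallyEq.eq_of_nhds (f := γ) (g := γ') hr2)
  exact fun t ht => (hsub ht).eq_of_nhds

/-- A vector field defined on an open set agrees near a given point with one which is defined
everywhere. -/
lemma exists_contDiff_eventuallyEq {G G' : Type*} [NormedAddCommGroup G] [NormedSpace ℝ G]
    [FiniteDimensional ℝ G] [NormedAddCommGroup G'] [NormedSpace ℝ G'] {k : ℕ∞} {f : G → G'}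
    {U : Set G} (hU : IsOpen U) (hf : ContDiffOn ℝ k f U) {a : G} (ha : a ∈ U) :
    ∃ g : G → G', ContDiff ℝ k g ∧ g =ᶠ[𝓝 a] f := by
  obtain ⟨ε, hε, hεU⟩ := Metric.isOpen_iff.1 hU a ha
  let b : ContDiffBump a := ⟨ε / 4, ε / 2, by positivity, by linarith⟩
  refine ⟨fun x => b x • f x, ?_, ?_⟩
  · rw [← contMDiff_iff_contDiff]
    refine contMDiff_of_tsupport fun x hx => ?_
    have hxU : x ∈ U := by
      have := tsupport_smul_subset_left _ _ hx
      rw [b.tsupport_eq] at this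
      exact hεU (Metric.closedBall_subset_ball (by change ε / 2 < ε; linarith) this)
    exact (b.contDiffAt.smul (hf.contDiffAt (hU.mem_nhds hxU))).contMDiffAt
  · filter_upwards [b.eventuallyEq_one] with x hx
    simp [hx]

/-- The data of a global flow on a manifold, in the form in which the smoothness of the flow is
proved: `ψ s t x` is the position after the time `t` of the solution which starts from `x` at the
time `s`, and `f x₀` is the time-dependent vector field read in the chart at `x₀`. -/
structure IsChartFlow (I : ModelWithCorners ℝ F H) (f : P → ℝ × F → F) (ψ : ℝ → ℝ → P → P) :
    Prop where
  contDiffOn : ∀ x₀, ContDiffOn ℝ 2 (f x₀) (univ ×ˢ (extChartAt I x₀).target)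
  zero : ∀ s x, ψ s 0 x = x
  add : ∀ s t r x, ψ s (t + r) x = ψ (s + t) r (ψ s t x)
  continuous : ∀ s x, Continuous fun t => ψ s t x
  hasDerivAt : ∀ s x x₀ t, ψ s t x ∈ (extChartAt I x₀).source →
    HasDerivAt (fun r => extChartAt I x₀ (ψ s r x)) (f x₀ (s + t, extChartAt I x₀ (ψ s t x))) t

variable [I.Boundaryless] [FiniteDimensional ℝ F] [T2Space P] [IsManifold I 2 P]
  {f : P → ℝ × F → F} {ψ : ℝ → ℝ → P → P}

/-- For short times the flow is given by the smooth local flow of the extended field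
`(s, x) ↦ (1, f (s, x))` in a chart. -/
lemma IsChartFlow.contMDiffAt_zero (h : IsChartFlow I f ψ) (s₀ : ℝ) (x₀ : P) :
    ContMDiffAt (𝓘(ℝ, ℝ).prod (𝓘(ℝ, ℝ).prod I)) I 2
      (fun p : ℝ × (ℝ × P) => ψ p.2.1 p.1 p.2.2) (0, (s₀, x₀)) := by
  set κ := extChartAt I x₀ with hκ
  have hmem : x₀ ∈ κ.source := mem_extChartAt_source x₀
  have hto : IsOpen κ.target := isOpen_extChartAt_target x₀
  have hU : IsOpen ((univ : Set ℝ) ×ˢ κ.target) := isOpen_univ.prod hto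
  obtain ⟨g, hg, hgf⟩ := exists_contDiff_eventuallyEq (k := 2) (f := fun q => ((1 : ℝ), f x₀ q)) hU
    (contDiffOn_const.prodMk (h.contDiffOn x₀)) (a := (s₀, κ x₀)) ⟨mem_univ _, κ.map_source hmem⟩
  obtain ⟨y, hy, hy'⟩ := exists_contDiffAt_local_flow (k := 2) two_ne_zero
    (by exact_mod_cast hg) (s₀, κ x₀)
    (inter_mem hgf.eventually_nhds (hU.mem_nhds ⟨mem_univ _, κ.map_source hmem⟩))
  -- the local flow in the chart is carried back to the manifold
  have hin : ContMDiffAt (𝓘(ℝ, ℝ).prod (𝓘(ℝ, ℝ).prod I)) 𝓘(ℝ, ℝ × (ℝ × F)) 2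
      (fun p : ℝ × (ℝ × P) => (p.1, (p.2.1, κ p.2.2))) (0, (s₀, x₀)) :=
    contMDiffAt_fst.prodMk_space ((contMDiffAt_fst.comp _ contMDiffAt_snd).prodMk_space
      ((contMDiffAt_extChartAt (I := I) (n := 2) (x := x₀)).comp (0, (s₀, x₀))
        (contMDiffAt_snd.comp _ contMDiffAt_snd)))
  have hyM : ContMDiffAt 𝓘(ℝ, ℝ × (ℝ × F)) 𝓘(ℝ, ℝ × F) 2 (fun p => y p 1) (0, (s₀, κ x₀)) :=
    (show ContDiffAt ℝ 2 _ _ by exact_mod_cast hy).contMDiffAt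
  have hyin := ContMDiffAt.comp ((0 : ℝ), (s₀, x₀))
    (f := fun p : ℝ × (ℝ × P) => (p.1, (p.2.1, κ p.2.2))) hyM hin
  have hmemT : (y (0, (s₀, κ x₀)) 1).2 ∈ κ.target := ((hy'.self_of_nhds).2.2 1).2.2
  have hback : ContMDiffAt 𝓘(ℝ, F) I 2 κ.symm (y (0, (s₀, κ x₀)) 1).2 :=
    (contMDiffOn_extChartAt_symm x₀).contMDiffAt (hto.mem_nhds hmemT)
  have hsnd : ContMDiffAt 𝓘(ℝ, ℝ × F) 𝓘(ℝ, F) 2 (Prod.snd : ℝ × F → F)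
      (y (0, (s₀, κ x₀)) 1) := contDiff_snd.contDiffAt.contMDiffAt
  have hfin := hback.comp_of_eq (f := fun p : ℝ × (ℝ × P) => (y (p.1, (p.2.1, κ p.2.2)) 1).2)
    (x := ((0 : ℝ), (s₀, x₀))) (hsnd.comp ((0 : ℝ), (s₀, x₀)) hyin) rfl
  refine hfin.congr_of_eventuallyEq ?_
  have hsrc : ∀ᶠ p : ℝ × (ℝ × P) in 𝓝 (0, (s₀, x₀)), p.2.2 ∈ κ.source :=
    (continuous_snd.comp continuous_snd).continuousAt.eventually
      ((isOpen_extChartAt_source x₀).mem_nhds hmem)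
  filter_upwards [hin.continuousAt.eventually hy', hsrc] with p ⟨hp0, hpd, hpW⟩ hps
  obtain ⟨t, s, x⟩ := p
  simp only at hp0 hpd hpW hps ⊢
  set c := y (t, (s, κ x)) with hc
  have hS : IsPreconnected (Ioo (-2 : ℝ) 2) := isPreconnected_Ioo
  have hd : ∀ r ∈ Ioo (-2 : ℝ) 2, HasDerivAt c (t • ((1 : ℝ), f x₀ (c r))) r := by
    intro r hr
    have := hpd r hr
    rwa [((hpW r).1 : ∀ᶠ _ in _, _).self_of_nhds] at this
  have hd1 : ∀ r ∈ Ioo (-2 : ℝ) 2, HasDerivAt (fun r => (c r).1) t r := fun r hr =>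
    (hasFDerivAt_fst.comp_hasDerivAt r (hd r hr)).congr_deriv (by simp)
  have hd2 : ∀ r ∈ Ioo (-2 : ℝ) 2, HasDerivAt (fun r => (c r).2) (t • f x₀ (c r)) r :=
    fun r hr =>
      (hasFDerivAt_snd.comp_hasDerivAt r (hd r hr)).congr_deriv (by simp)
  have h0 : (0 : ℝ) ∈ Ioo (-2 : ℝ) 2 := by constructor <;> norm_num
  have hc1 : ∀ r ∈ Ioo (-2 : ℝ) 2, (c r).1 = s + t * r := by
    intro r hr
    have hlin : ∀ r : ℝ, HasDerivAt (fun r => s + t * r) t r := fun r => by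
      simpa using ((hasDerivAt_id r).const_mul t).const_add s
    refine isOpen_Ioo.eqOn_of_deriv_eq hS (f := fun r => (c r).1) (g := fun r => s + t * r) ?_ ?_ ?_
      h0 ?_ hr
    · exact fun r hr => (hd1 r hr).differentiableAt.differentiableWithinAt
    · exact fun r hr => (hlin r).differentiableAt.differentiableWithinAt
    · intro r hr
      rw [(hd1 r hr).deriv, (hlin r).deriv]
    · simp [hp0]
  have hpT : ∀ r, (c r).2 ∈ κ.target := fun r => (hpW r).2.2
  have key : EqOn (fun r => ψ s (t * r) x) (fun r => κ.symm (c r).2) (Ioo (-2) 2) := by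
    refine eqOn_of_hasDerivAt_extChartAt (I := I) hS isOpen_Ioo ?_ ?_ ?_ h0 ?_
    · exact ((h.continuous s x).comp (continuous_const.mul continuous_id)).continuousOn
    · exact (continuousOn_extChartAt_symm x₀).comp
        (fun r hr => (hd2 r hr).continuousAt.continuousWithinAt) fun r _ => hpT r
    · intro r hr he
      have hsr : ψ s (t * r) x ∈ κ.source := by
        have he' : ψ s (t * r) x = κ.symm (c r).2 := he
        rw [he']; exact κ.map_target (hpT r)
      have hcont : ContinuousAt (fun r => ψ s (t * r) x) r :=
        ((h.continuous s x).comp (continuous_const.mul continuous_id)).continuousAt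
      refine ⟨x₀, hsr, fun q => t • f x₀ (s + t * q.1, q.2), ?_, ?_, ?_⟩
      · have hfat : ContDiffAt ℝ 1 (f x₀) (s + t * r, κ (ψ s (t * r) x)) :=
          ((h.contDiffOn x₀).contDiffAt
            (hU.mem_nhds ⟨mem_univ _, κ.map_source hsr⟩)).of_le one_le_two
        refine contDiffAt_const.smul
          (hfat.comp (r, κ (ψ s (t * r) x)) (f := fun q : ℝ × F => (s + t * q.1, q.2)) ?_)
        exact ((contDiff_const.add (contDiff_const.mul contDiff_fst)).prodMk
          contDiff_snd).contDiffAt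
      · filter_upwards [hcont.eventually ((isOpen_extChartAt_source x₀).mem_nhds hsr)] with r' hr'
        have h1 := h.hasDerivAt s x x₀ (t * r') hr'
        have h2 : HasDerivAt (fun r => t * r) t r' := by
          simpa using (hasDerivAt_id r').const_mul t
        exact HasDerivAt.scomp r' h1 h2
      · filter_upwards [isOpen_Ioo.mem_nhds hr] with r' hr'
        have h1 := hd2 r' hr'
        have h2 : (fun r => κ (κ.symm (c r).2)) = fun r => (c r).2 :=
          funext fun r => κ.right_inv (hpT r)
        rw [h2, κ.right_inv (hpT r'), ← hc1 r' hr']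
        exact h1
    · simp only [mul_zero, h.zero, hp0]
      exact (κ.left_inv hps).symm
  have h1 : (1 : ℝ) ∈ Ioo (-2 : ℝ) 2 := by constructor <;> norm_num
  simpa using key h1

/-- The flow of a `C²` vector field is of class `C²`: the set of times at which it is so along a
given orbit is open, and it is closed by the group property. -/
theorem IsChartFlow.contMDiff (h : IsChartFlow I f ψ) :
    ContMDiff (𝓘(ℝ, ℝ).prod (𝓘(ℝ, ℝ).prod I)) I 2
      (fun p : ℝ × (ℝ × P) => ψ p.2.1 p.1 p.2.2) := by
  rintro ⟨t, s₀, x₀⟩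
  set Φ : ℝ × (ℝ × P) → P := fun p => ψ p.2.1 p.1 p.2.2 with hΦ
  have h2 : (2 : WithTop ℕ∞) ≠ ((⊤ : ℕ∞) : WithTop ℕ∞) := by decide
  have hsub : (univ : Set ℝ) ⊆
      {t | ContMDiffAt (𝓘(ℝ, ℝ).prod (𝓘(ℝ, ℝ).prod I)) I 2 Φ (t, (s₀, x₀))} := by
    refine isPreconnected_univ.subset_of_closure_inter_subset (isOpen_iff_mem_nhds.2 fun t ht => ?_)
      ⟨0, mem_univ _, h.contMDiffAt_zero s₀ x₀⟩ ?_
    · have hc : ContinuousAt (fun t : ℝ => (t, (s₀, x₀))) t := by fun_prop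
      exact hc.eventually ((contMDiffAt_iff_contMDiffAt_nhds h2).1 ht)
    · rintro t₁ ⟨ht₁, -⟩
      have hloc := (contMDiffAt_iff_contMDiffAt_nhds h2).1
        (h.contMDiffAt_zero (s₀ + t₁) (ψ s₀ t₁ x₀))
      have hc : ContinuousAt (fun r : ℝ => (t₁ - r, (s₀ + r, ψ s₀ r x₀))) t₁ := by
        have := h.continuous s₀ x₀
        fun_prop
      rw [← sub_self t₁] at hloc
      obtain ⟨r, hr, hr'⟩ := mem_closure_iff_nhds.1 ht₁ _ (hc.eventually hloc)
      have e : Φ = fun p => Φ (p.1 - r, (p.2.1 + r, Φ (r, p.2))) := by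
        funext p
        have := h.add p.2.1 r (p.1 - r) p.2.2
        simpa [hΦ] using this
      change ContMDiffAt _ _ _ _ _
      rw [e]
      have hsub : ContMDiff 𝓘(ℝ, ℝ) 𝓘(ℝ, ℝ) 2 fun t : ℝ => t - r :=
        (contDiff_id.sub contDiff_const).contMDiff
      have hadd : ContMDiff 𝓘(ℝ, ℝ) 𝓘(ℝ, ℝ) 2 fun t : ℝ => t + r :=
        (contDiff_id.add contDiff_const).contMDiff
      have hΦr : ContMDiffAt (𝓘(ℝ, ℝ).prod (𝓘(ℝ, ℝ).prod I)) I 2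
          (fun p : ℝ × (ℝ × P) => Φ (r, p.2)) (t₁, (s₀, x₀)) :=
        ContMDiffAt.comp (t₁, (s₀, x₀)) (g := Φ) (f := fun p : ℝ × (ℝ × P) => (r, p.2)) hr'
          (contMDiffAt_const.prodMk contMDiffAt_snd)
      refine ContMDiffAt.comp (t₁, (s₀, x₀)) (g := Φ)
        (f := fun p : ℝ × (ℝ × P) => (p.1 - r, (p.2.1 + r, Φ (r, p.2)))) hr ?_
      exact ((hsub _).comp _ contMDiffAt_fst).prodMk
        (((hadd _).comp _ (contMDiffAt_fst.comp _ contMDiffAt_snd)).prodMk hΦr)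
  exact hsub (mem_univ t)

end ManifoldFlow

/-! ### Cotangent coordinates -/

section CotangentCharts

variable {n : ℕ}

/-- The lift `(q, p) ↦ (τ q, p ∘ (Dτ q)⁻¹)` of a change of coordinates `τ` has a symplectic
derivative: differentiate the identity `p' (Dτ q w) = p w` and use the symmetry of `D²τ`. -/
lemma stdForm_fderiv_of_lift {g : StdSpace n → StdSpace n} {g' : StdSpace n →L[ℝ] StdSpace n}
    {τ : EuclideanSpace ℝ (Fin n) → EuclideanSpace ℝ (Fin n)} {x : StdSpace n}
    (hτ : ContDiffAt ℝ 2 τ x.1) (hg : HasFDerivAt g g' x)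
    (h1 : ∀ᶠ y in 𝓝 x, (g y).1 = τ y.1)
    (h2 : ∀ᶠ y in 𝓝 x, ∀ w, (g y).2 (fderiv ℝ τ y.1 w) = y.2 w) (u v : StdSpace n) :
    stdForm n (g' u) (g' v) = stdForm n u v := by
  have hg1 : ∀ u, (g' u).1 = fderiv ℝ τ x.1 u.1 := by
    intro u
    have ha : HasFDerivAt (fun y => (g y).1) ((ContinuousLinearMap.fst ℝ _ _).comp g') x :=
      hasFDerivAt_fst.comp x hg
    have hb : HasFDerivAt (fun y : StdSpace n => τ y.1)
        ((fderiv ℝ τ x.1).comp (ContinuousLinearMap.fst ℝ _ _)) x :=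
      (hτ.differentiableAt two_ne_zero).hasFDerivAt.comp x hasFDerivAt_fst
    exact congrArg (fun A : StdSpace n →L[ℝ] EuclideanSpace ℝ (Fin n) => A u)
      (ha.unique (hb.congr_of_eventuallyEq h1))
  have hτ' : DifferentiableAt ℝ (fderiv ℝ τ) x.1 :=
    (hτ.fderiv_right (m := 1) (by norm_num)).differentiableAt one_ne_zero
  have hg2 : ∀ u w, (g' u).2 (fderiv ℝ τ x.1 w) + (g x).2 (fderiv ℝ (fderiv ℝ τ) x.1 u.1 w)
      = u.2 w := by
    intro u w
    have ha : HasFDerivAt (fun y => (g y).2) ((ContinuousLinearMap.snd ℝ _ _).comp g') x :=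
      hasFDerivAt_snd.comp x hg
    have hb := (hτ'.hasFDerivAt.comp x (f := Prod.fst) hasFDerivAt_fst).clm_apply
      (hasFDerivAt_const w x)
    have hc := (hasFDerivAt_snd (𝕜 := ℝ) (p := x)).clm_apply (hasFDerivAt_const w x)
    have := congrArg (fun A : StdSpace n →L[ℝ] ℝ => A u)
      ((ha.clm_apply hb).unique (hc.congr_of_eventuallyEq (h2.mono fun y hy => hy w)))
    simpa [add_comm] using this
  have hsymm : fderiv ℝ (fderiv ℝ τ) x.1 u.1 v.1 = fderiv ℝ (fderiv ℝ τ) x.1 v.1 u.1 :=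
    (hτ.isSymmSndFDerivAt (by simp)).eq _ _
  change (g' u).2 (g' v).1 - (g' v).2 (g' u).1 = u.2 v.1 - v.2 u.1
  rw [hg1, hg1]
  have e1 := hg2 u v.1
  have e2 := hg2 v u.1
  rw [hsymm] at e1
  linarith

variable {M : Type*} [TopologicalSpace M] [ChartedSpace (EuclideanSpace ℝ (Fin n)) M]
  [IsManifold (𝓡 n) ∞ M]

/-- The trivialization of `T*M` over the chart at `m`: a covector is composed with the inverse of
the differential of the chart. -/
lemma trivializationAt_cotangent (m : M) (y : CotangentBundle n M) :
    trivializationAt (MomentumSpace n)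
      (fun x : M => TangentSpace (𝓡 n) x →L[ℝ] Bundle.Trivial M ℝ x) m y =
      (y.proj, (show TangentSpace (𝓡 n) y.proj →L[ℝ] ℝ from y.snd).comp
        ((trivializationAt (EuclideanSpace ℝ (Fin n)) (TangentSpace (𝓡 n)) m).symmL ℝ
          y.proj)) := by
  rw [hom_trivializationAt_apply]
  refine Prod.ext rfl ?_
  ext w
  simp only [ContinuousLinearMap.inCoordinates, ContinuousLinearMap.comp_apply]
  change (Bundle.Trivial.trivialization M ℝ).continuousLinearMapAt ℝ y.proj _ = _
  rw [Bundle.Trivial.continuousLinearMapAt_trivialization]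
  rfl

lemma extChartAt_cotangent (x y : CotangentBundle n M) :
    extChartAt (cotangentModel n) x y =
      (extChartAt (𝓡 n) x.proj y.proj, (show TangentSpace (𝓡 n) y.proj →L[ℝ] ℝ from y.snd).comp
        ((trivializationAt (EuclideanSpace ℝ (Fin n)) (TangentSpace (𝓡 n)) x.proj).symmL ℝ
          y.proj)) := by
  rw [FiberBundle.extChartAt]
  have := trivializationAt_cotangent x.proj y
  change ((extChartAt (𝓡 n) x.proj) (trivializationAt (MomentumSpace n) _ x.proj y).1,
    (trivializationAt (MomentumSpace n) _ x.proj y).2) = _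
  rw [this]

lemma mem_extChartAt_cotangent_source {x y : CotangentBundle n M} :
    y ∈ (extChartAt (cotangentModel n) x).source ↔ y.proj ∈ (extChartAt (𝓡 n) x.proj).source := by
  rw [FiberBundle.extChartAt]
  simp only [PartialEquiv.trans_source, PartialEquiv.prod_source, PartialEquiv.refl_source,
    mem_inter_iff, mem_preimage, mem_prod, mem_univ, and_true]
  change y ∈ (trivializationAt (MomentumSpace n) _ x.proj).source ∧
    (trivializationAt (MomentumSpace n) _ x.proj y).1 ∈ _ ↔ _
  rw [trivializationAt_cotangent, Bundle.Trivialization.mem_source]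
  simp


/-- The differential of a change of coordinates of `M`, through the trivializations of `TM`. -/
lemma fderiv_extChartAt_comp_symm {x y m : M} (hx : m ∈ (extChartAt (𝓡 n) x).source)
    (hy : m ∈ (extChartAt (𝓡 n) y).source) (w : EuclideanSpace ℝ (Fin n)) :
    fderiv ℝ (extChartAt (𝓡 n) x ∘ (extChartAt (𝓡 n) y).symm) (extChartAt (𝓡 n) y m) w =
      (trivializationAt (EuclideanSpace ℝ (Fin n)) (TangentSpace (𝓡 n)) x).continuousLinearMapAt ℝ m
        ((trivializationAt (EuclideanSpace ℝ (Fin n)) (TangentSpace (𝓡 n)) y).symmL ℝ m w) := by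
  rw [extChartAt_source] at hx hy
  have hy' : m ∈ (extChartAt (𝓡 n) y).source := by rwa [extChartAt_source]
  have : IsManifold (𝓡 n) 1 M := IsManifold.of_le (n := ∞) (by decide)
  have hxd : MDifferentiableAt (𝓡 n) 𝓘(ℝ, EuclideanSpace ℝ (Fin n)) (extChartAt (𝓡 n) x) m :=
    mdifferentiableAt_extChartAt hx
  have hyd : MDifferentiableAt 𝓘(ℝ, EuclideanSpace ℝ (Fin n)) (𝓡 n) (extChartAt (𝓡 n) y).symm
      (extChartAt (𝓡 n) y m) :=
    ((contMDiffOn_extChartAt_symm (n := 1) y).contMDiffAt ((isOpen_extChartAt_target y).mem_nhds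
      ((extChartAt (𝓡 n) y).map_source hy'))).mdifferentiableAt one_ne_zero
  have hl : (extChartAt (𝓡 n) y).symm (extChartAt (𝓡 n) y m) = m :=
    (extChartAt (𝓡 n) y).left_inv hy'
  rw [TangentBundle.continuousLinearMapAt_trivializationAt hx,
    TangentBundle.symmL_trivializationAt hy, ← mfderiv_eq_fderiv,
    mfderiv_comp_of_eq hxd hyd hl, ModelWithCorners.range_eq_univ, mfderivWithin_univ, hl]
  rfl

lemma contDiffAt_extChartAt_comp_symm {x y m : M} (hx : m ∈ (extChartAt (𝓡 n) x).source)
    (hy : m ∈ (extChartAt (𝓡 n) y).source) :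
    ContDiffAt ℝ ∞ (extChartAt (𝓡 n) x ∘ (extChartAt (𝓡 n) y).symm) (extChartAt (𝓡 n) y m) := by
  rw [← contMDiffAt_iff_contDiffAt]
  have h1 : ContMDiffAt 𝓘(ℝ, EuclideanSpace ℝ (Fin n)) (𝓡 n) ∞ (extChartAt (𝓡 n) y).symm
      (extChartAt (𝓡 n) y m) :=
    (contMDiffOn_extChartAt_symm y).contMDiffAt ((isOpen_extChartAt_target y).mem_nhds
      ((extChartAt (𝓡 n) y).map_source hy))
  rw [extChartAt_source] at hx
  refine (contMDiffAt_extChartAt' ?_).comp _ h1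
  rwa [(extChartAt (𝓡 n) y).left_inv hy]

/-- The differential at `y` of the chart of `T*M` at `x`; both spaces are `ℝ²ⁿ` by definition of the
tangent space. -/
noncomputable def chartDeriv (x y : CotangentBundle n M) : StdSpace n →L[ℝ] StdSpace n :=
  mfderiv (cotangentModel n) 𝓘(ℝ, StdSpace n) (extChartAt (cotangentModel n) x) y

lemma hasMFDerivAt_extChartAt_cotangent {x y : CotangentBundle n M}
    (h : y ∈ (extChartAt (cotangentModel n) x).source) :
    HasMFDerivAt (cotangentModel n) 𝓘(ℝ, StdSpace n) (extChartAt (cotangentModel n) x) y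
      (chartDeriv x y) :=
  (mdifferentiableAt_extChartAt (by rwa [extChartAt_source] at h)).hasMFDerivAt

lemma hasFDerivAt_extChartAt_cotangent {x y : CotangentBundle n M}
    (h : y ∈ (extChartAt (cotangentModel n) x).source) :
    HasFDerivAt (extChartAt (cotangentModel n) x ∘ (extChartAt (cotangentModel n) y).symm)
      (chartDeriv x y) (extChartAt (cotangentModel n) y y) := by
  have := (hasMFDerivAt_extChartAt_cotangent h).2
  rw [ModelWithCorners.range_eq_univ] at this
  exact hasFDerivWithinAt_univ.1 this

/-- Cotangent coordinates are symplectic: the differential of a chart of `T*M` maps the canonical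
form to the standard one. -/
lemma stdForm_chartDeriv {x y : CotangentBundle n M}
    (h : y ∈ (extChartAt (cotangentModel n) x).source) (u v : StdSpace n) :
    stdForm n (chartDeriv x y u) (chartDeriv x y v) = stdForm n u v := by
  have hd' := hasFDerivAt_extChartAt_cotangent h
  set κx := extChartAt (cotangentModel n) x with hκx
  set κy := extChartAt (cotangentModel n) y with hκy
  have hyy : y ∈ κy.source := mem_extChartAt_source y
  -- near the point, the coordinates are those of a point which belongs to both charts
  have hev : ∀ᶠ z in 𝓝 (κy y), ∃ y' ∈ κx.source, y' ∈ κy.source ∧ κy y' = z ∧ κy.symm z = y' := by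
    have h1 : ContinuousAt κy.symm (κy y) := continuousAt_extChartAt_symm y
    have h2 : ∀ᶠ z in 𝓝 (κy y), κy.symm z ∈ κx.source := by
      refine h1.eventually ((isOpen_extChartAt_source x).mem_nhds ?_)
      rwa [κy.left_inv hyy]
    filter_upwards [h2, (isOpen_extChartAt_target y).mem_nhds (κy.map_source hyy)] with z hz hz'
    exact ⟨κy.symm z, hz, κy.map_target hz', κy.right_inv hz', rfl⟩
  have hp : y.proj ∈ (extChartAt (𝓡 n) x.proj).source := mem_extChartAt_cotangent_source.1 h
  have hp' : y.proj ∈ (extChartAt (𝓡 n) y.proj).source := mem_extChartAt_source _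
  refine stdForm_fderiv_of_lift
    (τ := extChartAt (𝓡 n) x.proj ∘ (extChartAt (𝓡 n) y.proj).symm) ?_ hd' ?_ ?_ u v
  · rw [hκy, extChartAt_cotangent]
    exact (contDiffAt_extChartAt_comp_symm hp hp').of_le (by decide)
  · filter_upwards [hev] with z hz
    obtain ⟨y', h1, h2, rfl, h4⟩ := hz
    simp only [Function.comp_apply]
    rw [h4, hκx, hκy, extChartAt_cotangent, extChartAt_cotangent]
    rw [(extChartAt (𝓡 n) y.proj).left_inv (mem_extChartAt_cotangent_source.1 h2)]
  · filter_upwards [hev] with z hz w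
    obtain ⟨y', h1, h2, rfl, h4⟩ := hz
    simp only [Function.comp_apply]
    rw [h4, hκx, hκy, extChartAt_cotangent, extChartAt_cotangent]
    have h1' := mem_extChartAt_cotangent_source.1 h1
    rw [fderiv_extChartAt_comp_symm h1' (mem_extChartAt_cotangent_source.1 h2)]
    simp only [ContinuousLinearMap.comp_apply]
    rw [Bundle.Trivialization.symmL_continuousLinearMapAt]
    rwa [extChartAt_source] at h1'

/-- In the preferred coordinates of the tangent space the vertical subspace is the standard one. -/
lemma verticalSpace_eq (x : CotangentBundle n M) :
    verticalSpace x = (stdVertical n : Submodule ℝ (StdSpace n)) := by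
  have hd : HasMFDerivAt (cotangentModel n) (𝓡 n) (fun y : CotangentBundle n M => y.proj) x
      (ContinuousLinearMap.fst ℝ (EuclideanSpace ℝ (Fin n)) (MomentumSpace n)) := by
    refine ⟨(FiberBundle.continuous_proj _ _).continuousAt, ?_⟩
    refine HasFDerivAt.hasFDerivWithinAt
      (HasFDerivAt.congr_of_eventuallyEq (hasFDerivAt_fst (𝕜 := ℝ)) ?_)
    set κ := extChartAt (cotangentModel n) x with hκ
    filter_upwards [(isOpen_extChartAt_target x).mem_nhds (κ.map_source (mem_extChartAt_source x))]
      with z hz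
    have := κ.right_inv hz
    rw [hκ, extChartAt_cotangent] at this
    exact congrArg Prod.fst this
  unfold verticalSpace
  rw [hd.mfderiv]
  rfl

/-- Cotangent coordinates map the vertical subspaces to the standard one. -/
lemma map_stdVertical_chartDeriv {x y : CotangentBundle n M}
    (h : y ∈ (extChartAt (cotangentModel n) x).source) :
    (stdVertical n).map (chartDeriv x y).toLinearMap = stdVertical n := by
  have hinj : Function.Injective (chartDeriv x y).toLinearMap :=
    injective_of_stdForm_eq (stdForm_chartDeriv h)
  have : IsManifold (𝓡 n) 1 M := IsManifold.of_le (n := ∞) (by decide)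
  refine Submodule.eq_of_le_of_finrank_eq ?_
    (Submodule.equivMapOfInjective _ hinj _).finrank_eq.symm
  rintro _ ⟨u, hu, rfl⟩
  have hproj : MDifferentiableAt (cotangentModel n) (𝓡 n)
      (fun y : CotangentBundle n M => y.proj) y :=
    (Bundle.contMDiffAt_proj _ (n := 1)).mdifferentiableAt one_ne_zero
  have h1 : HasMFDerivAt (cotangentModel n) 𝓘(ℝ, EuclideanSpace ℝ (Fin n))
      (fun y' => (extChartAt (cotangentModel n) x y').1) y
      ((ContinuousLinearMap.fst ℝ _ _).comp (chartDeriv x y)) :=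
    HasMFDerivAt.comp y (hasMFDerivAt_iff_hasFDerivAt.2 hasFDerivAt_fst)
      (hasMFDerivAt_extChartAt_cotangent h)
  have h2 := (mdifferentiableAt_extChartAt (I := 𝓡 n) (x := x.proj) (y := y.proj)
    (by simpa [extChartAt_source] using mem_extChartAt_cotangent_source.1 h)).hasMFDerivAt.comp y
      hproj.hasMFDerivAt
  have e : (fun y' : CotangentBundle n M => (extChartAt (cotangentModel n) x y').1) =
      extChartAt (𝓡 n) x.proj ∘ fun y' : CotangentBundle n M => y'.proj :=
    funext fun y' => by rw [extChartAt_cotangent]; rfl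
  rw [← verticalSpace_eq y] at hu
  rw [e] at h1
  have h3 := congrArg (fun A : StdSpace n →L[ℝ] EuclideanSpace ℝ (Fin n) => A u)
    (hasMFDerivAt_unique h1 h2)
  refine h3.trans ?_
  change mfderiv _ _ _ _ (mfderiv _ _ _ _ u) = _
  rw [show mfderiv (cotangentModel n) (𝓡 n) (fun y : CotangentBundle n M => y.proj) y u = 0 from hu]
  exact map_zero _

end CotangentCharts

/-! ### Topology of the cotangent bundle -/

section CotangentTopology

variable {n : ℕ} {M : Type*} [TopologicalSpace M] [ChartedSpace (EuclideanSpace ℝ (Fin n)) M]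
  [IsManifold (𝓡 n) ∞ M]

lemma continuous_cotangent_proj : Continuous fun y : CotangentBundle n M => y.proj :=
  FiberBundle.continuous_proj _ _

instance [T2Space M] : T2Space (CotangentBundle n M) := by
  refine ⟨fun x y hxy => ?_⟩
  by_cases hp : x.proj = y.proj
  · -- two points of one fibre are separated in a trivialization
    have hx : x ∈ (extChartAt (cotangentModel n) x).source := mem_extChartAt_source x
    have hy : y ∈ (extChartAt (cotangentModel n) x).source :=
      mem_extChartAt_cotangent_source.2 (hp ▸ mem_extChartAt_source _)
    have hne : extChartAt (cotangentModel n) x x ≠ extChartAt (cotangentModel n) x y :=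
      fun h => hxy ((extChartAt (cotangentModel n) x).injOn hx hy h)
    obtain ⟨u, v, hu, hv, hxu, hyv, huv⟩ := t2_separation hne
    have hc := continuousOn_extChartAt (I := cotangentModel n) x
    have ho := isOpen_extChartAt_source (I := cotangentModel n) x
    refine ⟨_, _, hc.isOpen_inter_preimage ho hu, hc.isOpen_inter_preimage ho hv,
      ⟨hx, hxu⟩, ⟨hy, hyv⟩, ?_⟩
    exact ((huv.preimage _).mono inter_subset_right inter_subset_right)
  · obtain ⟨u, v, hu, hv, hxu, hyv, huv⟩ := t2_separation hp
    exact ⟨_, _, hu.preimage continuous_cotangent_proj, hv.preimage continuous_cotangent_proj,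
      hxu, hyv, huv.preimage _⟩

instance [CompactSpace M] : SecondCountableTopology (CotangentBundle n M) := by
  obtain ⟨t, ht⟩ := CompactSpace.elim_nhds_subcover
    (fun m : M => (chartAt (EuclideanSpace ℝ (Fin n)) m).source)
    fun m => chart_source_mem_nhds _ m
  have : SecondCountableTopology (ModelProd (EuclideanSpace ℝ (Fin n)) (MomentumSpace n)) :=
    inferInstanceAs (SecondCountableTopology (StdSpace n))
  refine ChartedSpace.secondCountable_of_countable_cover
    (ModelProd (EuclideanSpace ℝ (Fin n)) (MomentumSpace n))
    (s := (fun m : M => (⟨m, 0⟩ : CotangentBundle n M)) '' t) ?_ (t.countable_toSet.image _)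
  refine eq_univ_of_forall fun y => ?_
  have hy : y.proj ∈ ⋃ m ∈ t, (chartAt (EuclideanSpace ℝ (Fin n)) m).source :=
    ht ▸ (trivial : y.proj ∈ (⊤ : Set M))
  simp only [mem_iUnion] at hy ⊢
  obtain ⟨m, hm, hy⟩ := hy
  refine ⟨⟨m, 0⟩, mem_image_of_mem _ hm, ?_⟩
  rw [← extChartAt_source (cotangentModel n), mem_extChartAt_cotangent_source]
  rwa [extChartAt_source]

instance : LocallyCompactSpace (CotangentBundle n M) :=
  have : LocallyCompactSpace (ModelProd (EuclideanSpace ℝ (Fin n)) (MomentumSpace n)) :=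
    inferInstanceAs (LocallyCompactSpace (StdSpace n))
  ChartedSpace.locallyCompactSpace
    (ModelProd (EuclideanSpace ℝ (Fin n)) (MomentumSpace n)) _

end CotangentTopology

/-! ### The Hamiltonian flow is smooth and symplectic -/

section HamiltonianVector

variable {n : ℕ}

/-- The map `x ↦ - ω₀(x, ·)` from `ℝ²ⁿ` to its dual. -/
noncomputable def flatMap (n : ℕ) : StdSpace n →ₗ[ℝ] (StdSpace n →L[ℝ] ℝ) :=
  (LinearMap.toContinuousLinearMap : (StdSpace n →ₗ[ℝ] ℝ) ≃ₗ[ℝ] _).toLinearMap ∘ₗ (-(stdForm n))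

lemma flatMap_apply (x ξ : StdSpace n) : flatMap n x ξ = -stdForm n x ξ := rfl

lemma flatMap_injective : Function.Injective (flatMap n) := by
  rw [injective_iff_map_eq_zero]
  intro x hx
  refine eq_zero_of_stdForm_eq_zero fun v => ?_
  rw [stdForm_swap, ← flatMap_apply, hx]
  rfl

lemma finrank_dual_stdSpace :
    Module.finrank ℝ (StdSpace n) = Module.finrank ℝ (StdSpace n →L[ℝ] ℝ) := by
  rw [← LinearEquiv.finrank_eq (LinearMap.toContinuousLinearMap :
    (StdSpace n →ₗ[ℝ] ℝ) ≃ₗ[ℝ] _), Subspace.dual_finrank_eq]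

lemma flatMap_surjective : Function.Surjective (flatMap n) :=
  (LinearMap.injective_iff_surjective_of_finrank_eq_finrank (K := ℝ) (V := StdSpace n)
    (V₂ := StdSpace n →L[ℝ] ℝ) (finrank_dual_stdSpace (n := n)) (f := flatMap n)).1
      (flatMap_injective (n := n))

/-- The isomorphism `x ↦ - ω₀(x, ·)` of `ℝ²ⁿ` with its dual. -/
noncomputable def flatEquiv (n : ℕ) : StdSpace n ≃L[ℝ] (StdSpace n →L[ℝ] ℝ) :=
  let e : StdSpace n ≃ₗ[ℝ] (StdSpace n →L[ℝ] ℝ) :=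
    LinearEquiv.ofBijective (flatMap n) ⟨flatMap_injective, flatMap_surjective⟩
  { e with
    continuous_toFun := LinearMap.continuous_of_finiteDimensional (𝕜 := ℝ) (E := StdSpace n)
      (F' := StdSpace n →L[ℝ] ℝ) (e : StdSpace n →ₗ[ℝ] (StdSpace n →L[ℝ] ℝ))
    continuous_invFun := LinearMap.continuous_of_finiteDimensional (𝕜 := ℝ)
      (E := StdSpace n →L[ℝ] ℝ) (F' := StdSpace n)
      (e.symm : (StdSpace n →L[ℝ] ℝ) →ₗ[ℝ] StdSpace n) }

lemma flatEquiv_apply (x ξ : StdSpace n) : flatEquiv n x ξ = -stdForm n x ξ := by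
  rw [← flatMap_apply]
  rfl

lemma stdForm_flatEquiv_symm (α : StdSpace n →L[ℝ] ℝ) (ξ : StdSpace n) :
    stdForm n ((flatEquiv n).symm α) ξ = -α ξ := by
  rw [← neg_neg (stdForm n _ _), ← flatEquiv_apply, ContinuousLinearEquiv.apply_symm_apply]

lemma eq_flatEquiv_symm {x : StdSpace n} {α : StdSpace n →L[ℝ] ℝ}
    (h : ∀ ξ, stdForm n x ξ = -α ξ) : x = (flatEquiv n).symm α := by
  rw [ContinuousLinearEquiv.eq_symm_apply]
  refine ContinuousLinearMap.ext fun ξ => ?_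
  rw [flatEquiv_apply, h, neg_neg]

/-- The linearized equation of a Hamiltonian flow `g`, in its weak form. -/
lemma stdForm_fderiv_fderiv_flow {g : ℝ × StdSpace n → StdSpace n} {h : ℝ × StdSpace n → ℝ} {t : ℝ}
    {ζ : StdSpace n} (hg : ContDiffAt ℝ 2 g (t, ζ)) (hh : ContDiffAt ℝ 2 h (t, g (t, ζ)))
    (hode : ∀ᶠ p in 𝓝 (t, ζ), fderiv ℝ g p (1, 0) = (flatEquiv n).symm
      ((fderiv ℝ h (p.1, g p)).comp (ContinuousLinearMap.inr ℝ ℝ (StdSpace n))))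
    (u ξ : StdSpace n) :
    stdForm n (fderiv ℝ (fderiv ℝ g) (t, ζ) (1, 0) (0, u)) ξ =
      -fderiv ℝ (fderiv ℝ h) (t, g (t, ζ)) (0, fderiv ℝ g (t, ζ) (0, u)) (0, ξ) := by
  have hg1 : HasFDerivAt (fderiv ℝ g) (fderiv ℝ (fderiv ℝ g) (t, ζ)) (t, ζ) :=
    ((hg.fderiv_right (m := 1) (by norm_num)).differentiableAt one_ne_zero).hasFDerivAt
  have hh1 : HasFDerivAt (fderiv ℝ h) (fderiv ℝ (fderiv ℝ h) (t, g (t, ζ))) (t, g (t, ζ)) :=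
    ((hh.fderiv_right (m := 1) (by norm_num)).differentiableAt one_ne_zero).hasFDerivAt
  have hgd : HasFDerivAt g (fderiv ℝ g (t, ζ)) (t, ζ) :=
    (hg.differentiableAt two_ne_zero).hasFDerivAt
  have h8 := (hg.isSymmSndFDerivAt (by simp) : IsSymmSndFDerivAt ℝ g (t, ζ)) (1, 0) (0, u)
  generalize fderiv ℝ (fderiv ℝ g) (t, ζ) = B at *
  have h1 := hg1.clm_apply (hasFDerivAt_const ((1 : ℝ), (0 : StdSpace n)) (t, ζ))
  have h3 := HasFDerivAt.comp (t, ζ) (g := fderiv ℝ h)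
      (f := fun p : ℝ × StdSpace n => (p.1, g p)) hh1 (hasFDerivAt_fst.prodMk hgd)
  have h4 := h3.clm_comp (hasFDerivAt_const (ContinuousLinearMap.inr ℝ ℝ (StdSpace n)) (t, ζ))
  have h5 := (flatEquiv n).symm.toContinuousLinearMap.hasFDerivAt.comp (t, ζ) h4
  have h6 := congrArg (fun A : ℝ × StdSpace n →L[ℝ] StdSpace n => A (0, u))
    (h1.unique (h5.congr_of_eventuallyEq hode))
  have h7 : B (0, u) (1, 0) = (flatEquiv n).symm
      ((fderiv ℝ (fderiv ℝ h) (t, g (t, ζ)) (0, fderiv ℝ g (t, ζ) (0, u))).comp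
        (ContinuousLinearMap.inr ℝ ℝ (StdSpace n))) := by
    simpa using h6
  rw [h8, h7, stdForm_flatEquiv_symm]
  rfl

/-- `ω₀` is preserved to first order along the linearization of a Hamiltonian flow: for
`X = ω₀⁻¹ dh` the derivative of `ω₀(Dg u, Dg v)` is `-D²h(a, b) + D²h(b, a) = 0`. -/
lemma hasDerivAt_stdForm_fderiv {g : ℝ × StdSpace n → StdSpace n} {h : ℝ × StdSpace n → ℝ} {t : ℝ}
    {ζ : StdSpace n} (hg : ContDiffAt ℝ 2 g (t, ζ)) (hh : ContDiffAt ℝ 2 h (t, g (t, ζ)))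
    (hode : ∀ᶠ p in 𝓝 (t, ζ), fderiv ℝ g p (1, 0) = (flatEquiv n).symm
      ((fderiv ℝ h (p.1, g p)).comp (ContinuousLinearMap.inr ℝ ℝ (StdSpace n))))
    (u v : StdSpace n) :
    HasDerivAt (fun r => stdForm n (fderiv ℝ g (r, ζ) (0, u)) (fderiv ℝ g (r, ζ) (0, v))) 0 t := by
  have hg1 : HasFDerivAt (fderiv ℝ g) (fderiv ℝ (fderiv ℝ g) (t, ζ)) (t, ζ) :=
    ((hg.fderiv_right (m := 1) (by norm_num)).differentiableAt one_ne_zero).hasFDerivAt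
  have hCs : IsSymmSndFDerivAt ℝ h (t, g (t, ζ)) := hh.isSymmSndFDerivAt (by simp)
  have hpath : ∀ u, HasDerivAt (fun r => fderiv ℝ g (r, ζ) (0, u))
      (fderiv ℝ (fderiv ℝ g) (t, ζ) (1, 0) (0, u)) t := by
    intro u
    have h1 : HasDerivAt (fun r : ℝ => (r, ζ)) ((1 : ℝ), (0 : StdSpace n)) t :=
      (hasDerivAt_id t).prodMk (hasDerivAt_const t ζ)
    have h2 : HasDerivAt (fun r => fderiv ℝ g (r, ζ)) (fderiv ℝ (fderiv ℝ g) (t, ζ) (1, 0)) t :=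
      HasFDerivAt.comp_hasDerivAt t (l := fderiv ℝ g) (f := fun r : ℝ => (r, ζ)) hg1 h1
    simpa using h2.clm_apply (hasDerivAt_const t ((0 : ℝ), u))
  have e1 := stdForm_fderiv_fderiv_flow hg hh hode u (fderiv ℝ g (t, ζ) (0, v))
  have e2 := stdForm_fderiv_fderiv_flow hg hh hode v (fderiv ℝ g (t, ζ) (0, u))
  rw [hCs] at e2
  have key : ∀ {a b : ℝ → StdSpace n} {a' b' : StdSpace n}, HasDerivAt a a' t →
      HasDerivAt b b' t → HasDerivAt (fun r => stdForm n (a r) (b r))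
        (stdForm n a' (b t) - stdForm n b' (a t)) t := by
    intro a b a' b' ha hb
    have h1 := hasFDerivAt_fst.comp_hasDerivAt t ha
    have h2 := hasFDerivAt_snd.comp_hasDerivAt t ha
    have h3 := hasFDerivAt_fst.comp_hasDerivAt t hb
    have h4 := hasFDerivAt_snd.comp_hasDerivAt t hb
    refine ((h2.clm_apply h3).sub (h4.clm_apply h1)).congr_deriv ?_
    simp
    ring
  refine (key (hpath u) (hpath v)).congr_deriv ?_
  rw [e1, e2]
  ring

end HamiltonianVector

section HamiltonianFlow

variable {n : ℕ} {M : Type*} [TopologicalSpace M] [ChartedSpace (EuclideanSpace ℝ (Fin n)) M]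
  [IsManifold (𝓡 n) ∞ M]

/-- The Hamiltonian read in the chart of `T*M` at `x₀` and on the covering `ℝ` of the circle. -/
noncomputable def chartHam (H : ExtPhaseSpace n M → ℝ) (x₀ : CotangentBundle n M)
    (p : ℝ × StdSpace n) : ℝ :=
  H ((p.1 : UnitAddCircle), (extChartAt (cotangentModel n) x₀).symm p.2)

/-- The Hamiltonian vector field read in the chart of `T*M` at `x₀`. -/
noncomputable def chartField (H : ExtPhaseSpace n M → ℝ) (x₀ : CotangentBundle n M)
    (p : ℝ × StdSpace n) : StdSpace n :=
  (flatEquiv n).symm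
    ((fderiv ℝ (chartHam H x₀) p).comp (ContinuousLinearMap.inr ℝ ℝ (StdSpace n)))

lemma isOpen_univ_prod_target (x₀ : CotangentBundle n M) :
    IsOpen ((univ : Set ℝ) ×ˢ (extChartAt (cotangentModel n) x₀).target) :=
  isOpen_univ.prod (isOpen_extChartAt_target x₀)

variable {H : ExtPhaseSpace n M → ℝ}

lemma contDiffOn_chartHam (hH : IsSmoothHamiltonian H) (x₀ : CotangentBundle n M) :
    ContDiffOn ℝ ∞ (chartHam H x₀) (univ ×ˢ (extChartAt (cotangentModel n) x₀).target) := by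
  rw [← contMDiffOn_iff_contDiffOn]
  intro p hp
  refine ContMDiffAt.contMDiffWithinAt ?_
  have h1 : ContMDiffAt 𝓘(ℝ, StdSpace n) (cotangentModel n) ∞
      (extChartAt (cotangentModel n) x₀).symm p.2 :=
    (contMDiffOn_extChartAt_symm x₀).contMDiffAt ((isOpen_extChartAt_target x₀).mem_nhds hp.2)
  have h2 : ContMDiffAt 𝓘(ℝ, ℝ × StdSpace n) 𝓘(ℝ, ℝ) ∞ (Prod.fst : ℝ × StdSpace n → ℝ) p :=
    contDiff_fst.contDiffAt.contMDiffAt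
  have h3 : ContMDiffAt 𝓘(ℝ, ℝ × StdSpace n) 𝓘(ℝ, StdSpace n) ∞
      (Prod.snd : ℝ × StdSpace n → StdSpace n) p := contDiff_snd.contDiffAt.contMDiffAt
  exact (hH _).comp p (h2.prodMk (h1.comp p h3))

lemma contDiffOn_chartField (hH : IsSmoothHamiltonian H) (x₀ : CotangentBundle n M) :
    ContDiffOn ℝ 2 (chartField H x₀) (univ ×ˢ (extChartAt (cotangentModel n) x₀).target) := by
  have h1 : ContDiffOn ℝ 2 (fderiv ℝ (chartHam H x₀))
      (univ ×ˢ (extChartAt (cotangentModel n) x₀).target) :=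
    ((contDiffOn_chartHam hH x₀).of_le (m := 3) (by decide)).fderiv_of_isOpen
      (isOpen_univ_prod_target x₀) (by norm_num)
  exact (flatEquiv n).symm.contDiff.comp_contDiffOn (h1.clm_comp contDiffOn_const)

/-- The differential of the Hamiltonian at a fixed time, in a chart. -/
lemma mfderiv_hamiltonian (hH : IsSmoothHamiltonian H) {x₀ y : CotangentBundle n M}
    (hy : y ∈ (extChartAt (cotangentModel n) x₀).source) (τ : ℝ)
    (ξ : TangentSpace (cotangentModel n) y) :
    (show ℝ from mfderiv (cotangentModel n) 𝓘(ℝ, ℝ)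
      (fun y => H ((τ : UnitAddCircle), y)) y ξ) =
      fderiv ℝ (chartHam H x₀) (τ, extChartAt (cotangentModel n) x₀ y) (0, chartDeriv x₀ y ξ) := by
  set κ := extChartAt (cotangentModel n) x₀ with hκ
  have hd : HasFDerivAt (chartHam H x₀) (fderiv ℝ (chartHam H x₀) (τ, κ y)) (τ, κ y) :=
    (((contDiffOn_chartHam hH x₀).contDiffAt ((isOpen_univ_prod_target x₀).mem_nhds
      ⟨mem_univ _, κ.map_source hy⟩)).differentiableAt (by decide)).hasFDerivAt
  have h1 : HasFDerivAt (fun z => chartHam H x₀ (τ, z))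
      ((fderiv ℝ (chartHam H x₀) (τ, κ y)).comp (ContinuousLinearMap.inr ℝ ℝ (StdSpace n)))
      (κ y) := hd.comp (κ y) (hasFDerivAt_prodMk_right τ (κ y))
  have h2 := (hasMFDerivAt_iff_hasFDerivAt.2 h1).comp y (hasMFDerivAt_extChartAt_cotangent hy)
  have h3 : HasMFDerivAt (cotangentModel n) 𝓘(ℝ, ℝ) (fun y => H ((τ : UnitAddCircle), y)) y
      (((fderiv ℝ (chartHam H x₀) (τ, κ y)).comp
        (ContinuousLinearMap.inr ℝ ℝ (StdSpace n))).comp (chartDeriv x₀ y)) := by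
    refine h2.congr_of_eventuallyEq ?_
    filter_upwards [(isOpen_extChartAt_source x₀).mem_nhds hy] with y' hy'
    simp only [Function.comp_apply, chartHam]
    rw [κ.left_inv hy']
  rw [h3.mfderiv]
  rfl

lemma chartDeriv_surjective {x y : CotangentBundle n M}
    (h : y ∈ (extChartAt (cotangentModel n) x).source) :
    Function.Surjective (chartDeriv x y) :=
  LinearMap.injective_iff_surjective.1
    (injective_of_stdForm_eq (g := (chartDeriv x y).toLinearMap) (stdForm_chartDeriv h))

/-- The chart reading of a solution of Hamilton's equations. -/
lemma IsHamiltonianOrbit.hasDerivAt (hH : IsSmoothHamiltonian H) {s : ℝ}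
    {γ : ℝ → CotangentBundle n M} (hγ : IsHamiltonianOrbit H (s : UnitAddCircle) γ)
    {x₀ : CotangentBundle n M} {t : ℝ} (ht : γ t ∈ (extChartAt (cotangentModel n) x₀).source) :
    HasDerivAt (fun r => extChartAt (cotangentModel n) x₀ (γ r))
      (chartField H x₀ (s + t, extChartAt (cotangentModel n) x₀ (γ t))) t := by
  obtain ⟨X, hX, hd⟩ := hγ t
  have h1 := (hasMFDerivAt_extChartAt_cotangent ht).comp t hd
  have key : ∀ X' : StdSpace n, HasFDerivAt (fun r => extChartAt (cotangentModel n) x₀ (γ r))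
      ((chartDeriv x₀ (γ t)).comp ((1 : ℝ →L[ℝ] ℝ).smulRight X')) t →
      HasDerivAt (fun r => extChartAt (cotangentModel n) x₀ (γ r)) (chartDeriv x₀ (γ t) X') t := by
    intro X' h2
    simpa using h2.hasDerivAt
  refine (key X (hasMFDerivAt_iff_hasFDerivAt.1 h1)).congr_deriv ?_
  refine eq_flatEquiv_symm fun ζ => ?_
  obtain ⟨ξ, rfl⟩ := chartDeriv_surjective ht ζ
  refine (stdForm_chartDeriv ht X ξ).trans ?_
  have h3 := hX ξ
  rw [← AddCircle.coe_add] at h3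
  exact h3.trans (congrArg Neg.neg (mfderiv_hamiltonian hH ht (s + t) ξ))

lemma IsHamiltonianOrbit.continuous {s : UnitAddCircle}
    {γ : ℝ → CotangentBundle n M} (hγ : IsHamiltonianOrbit H s γ) : Continuous γ :=
  continuous_iff_continuousAt.2 fun t => by
    obtain ⟨X, -, hd⟩ := hγ t
    exact hd.continuousAt

variable (hflow : GeneratesGlobalFlow H)

lemma evolution_zero (s : UnitAddCircle) (x : CotangentBundle n M) : evolution hflow s 0 x = x :=
  (hflow s x).choose_spec.1

lemma isHamiltonianOrbit_evolution (s : UnitAddCircle) (x : CotangentBundle n M) :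
    IsHamiltonianOrbit H s fun t => evolution hflow s t x :=
  (hflow s x).choose_spec.2

variable [T2Space M]

lemma evolution_add (hH : IsSmoothHamiltonian H) (s t r : ℝ) (x : CotangentBundle n M) :
    evolution hflow (s : UnitAddCircle) (t + r) x =
      evolution hflow ((s + t : ℝ) : UnitAddCircle) r
        (evolution hflow (s : UnitAddCircle) t x) := by
  set γ := fun t => evolution hflow (s : UnitAddCircle) t x with hγ
  set γ' := fun r => evolution hflow ((s + t : ℝ) : UnitAddCircle) r (γ t) with hγ'
  have o1 : IsHamiltonianOrbit H (s : UnitAddCircle) γ := isHamiltonianOrbit_evolution hflow _ _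
  have o2 : IsHamiltonianOrbit H ((s + t : ℝ) : UnitAddCircle) γ' :=
    isHamiltonianOrbit_evolution hflow _ _
  have hc : Continuous fun r => γ (t + r) := o1.continuous.comp (continuous_const.add continuous_id)
  refine eqOn_of_hasDerivAt_extChartAt (I := cotangentModel n) (γ := fun r => γ (t + r)) (γ' := γ')
    isPreconnected_univ isOpen_univ hc.continuousOn o2.continuous.continuousOn ?_ (mem_univ 0) ?_
    (mem_univ r)
  · intro r _ he
    have hsrc : γ (t + r) ∈ (extChartAt (cotangentModel n) (γ (t + r))).source :=
      mem_extChartAt_source _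
    have hsrc' : γ' r ∈ (extChartAt (cotangentModel n) (γ (t + r))).source := by
      rw [← show γ (t + r) = γ' r from he]; exact hsrc
    refine ⟨γ (t + r), hsrc, fun q => chartField H (γ (t + r)) (s + t + q.1, q.2), ?_, ?_, ?_⟩
    · have h1 : ContDiffAt ℝ 1 (chartField H (γ (t + r)))
          (s + t + r, extChartAt (cotangentModel n) (γ (t + r)) (γ (t + r))) :=
        ((contDiffOn_chartField hH _).contDiffAt ((isOpen_univ_prod_target _).mem_nhds
          ⟨mem_univ _, (extChartAt (cotangentModel n) _).map_source hsrc⟩)).of_le one_le_two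
      exact h1.comp (r, extChartAt (cotangentModel n) (γ (t + r)) (γ (t + r)))
        (f := fun q : ℝ × StdSpace n => (s + t + q.1, q.2))
        ((contDiff_const.add contDiff_fst).prodMk contDiff_snd).contDiffAt
    · filter_upwards [hc.continuousAt.eventually ((isOpen_extChartAt_source _).mem_nhds hsrc)]
        with r' hr'
      have h1 := o1.hasDerivAt hH (t := t + r') hr'
      rw [← add_assoc] at h1
      exact h1.comp_const_add t r'
    · filter_upwards [o2.continuous.continuousAt.eventually
        ((isOpen_extChartAt_source _).mem_nhds hsrc')] with r' hr'
      exact o2.hasDerivAt hH hr'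
  · rw [add_zero]
    exact (evolution_zero hflow _ _).symm

lemma isChartFlow_evolution (hH : IsSmoothHamiltonian H) :
    IsChartFlow (cotangentModel n) (chartField H)
      (fun s t x => evolution hflow (s : UnitAddCircle) t x) where
  contDiffOn := contDiffOn_chartField hH
  zero _ x := evolution_zero hflow _ x
  add s t r x := evolution_add hflow hH s t r x
  continuous _ x := (isHamiltonianOrbit_evolution hflow _ x).continuous
  hasDerivAt _ x _ _ ht := (isHamiltonianOrbit_evolution hflow _ x).hasDerivAt hH ht

/-- The Hamiltonian flow is of class `C²` in time, initial time and initial point jointly. -/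
theorem contMDiff_evolution (hH : IsSmoothHamiltonian H) :
    ContMDiff (𝓘(ℝ, ℝ).prod (𝓘(ℝ, ℝ).prod (cotangentModel n))) (cotangentModel n) 2
      (fun p : ℝ × (ℝ × CotangentBundle n M) =>
        evolution hflow (p.2.1 : UnitAddCircle) p.1 p.2.2) :=
  (isChartFlow_evolution hflow hH).contMDiff

end HamiltonianFlow

section FlowDerivative

variable {n : ℕ} {M : Type*} [TopologicalSpace M] [ChartedSpace (EuclideanSpace ℝ (Fin n)) M]
  [IsManifold (𝓡 n) ∞ M] {H : ExtPhaseSpace n M → ℝ} (hflow : GeneratesGlobalFlow H)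

/-- The differential `D_xφ_t(s, x)` of the flow, as an endomorphism of `ℝ²ⁿ`, which is by definition
the tangent space of `T*M` at every point. -/
noncomputable def flowDeriv (s : UnitAddCircle) (t : ℝ) (x : CotangentBundle n M) :
    StdSpace n →L[ℝ] StdSpace n :=
  mfderiv (cotangentModel n) (cotangentModel n) (evolution hflow s t) x

/-- The flow read in the charts of `T*M` at `x₁` (source) and `x₀` (target). -/
noncomputable def flowChart (x₁ x₀ : CotangentBundle n M) (p : ℝ × (ℝ × StdSpace n)) : StdSpace n :=
  extChartAt (cotangentModel n) x₀ (evolution hflow (p.2.1 : UnitAddCircle) p.1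
    ((extChartAt (cotangentModel n) x₁).symm p.2.2))

lemma flowDeriv_zero (s : UnitAddCircle) (x : CotangentBundle n M) :
    flowDeriv hflow s 0 x = ContinuousLinearMap.id ℝ (StdSpace n) := by
  have : evolution hflow s 0 = id := funext fun y => evolution_zero hflow s y
  rw [flowDeriv, this]
  exact mfderiv_id

variable [T2Space M] (hH : IsSmoothHamiltonian H)

include hH

lemma continuous_evolution : Continuous fun p : ℝ × (ℝ × CotangentBundle n M) =>
    evolution hflow (p.2.1 : UnitAddCircle) p.1 p.2.2 :=
  (contMDiff_evolution hflow hH).continuous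

lemma contDiffAt_flowChart {x₁ x₀ : CotangentBundle n M} {p : ℝ × (ℝ × StdSpace n)}
    (h₁ : p.2.2 ∈ (extChartAt (cotangentModel n) x₁).target)
    (h₀ : evolution hflow (p.2.1 : UnitAddCircle) p.1
      ((extChartAt (cotangentModel n) x₁).symm p.2.2) ∈ (extChartAt (cotangentModel n) x₀).source) :
    ContDiffAt ℝ 2 (flowChart hflow x₁ x₀) p := by
  rw [← contMDiffAt_iff_contDiffAt]
  have e1 : ContMDiffAt 𝓘(ℝ, StdSpace n) (cotangentModel n) 2
      (extChartAt (cotangentModel n) x₁).symm p.2.2 :=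
    (contMDiffOn_extChartAt_symm x₁).contMDiffAt ((isOpen_extChartAt_target x₁).mem_nhds h₁)
  have f1 : ContMDiffAt 𝓘(ℝ, ℝ × (ℝ × StdSpace n)) 𝓘(ℝ, ℝ) 2
      (fun p : ℝ × (ℝ × StdSpace n) => p.1) p := contDiff_fst.contDiffAt.contMDiffAt
  have f2 : ContMDiffAt 𝓘(ℝ, ℝ × (ℝ × StdSpace n)) 𝓘(ℝ, ℝ) 2
      (fun p : ℝ × (ℝ × StdSpace n) => p.2.1) p :=
    (contDiff_fst.comp contDiff_snd).contDiffAt.contMDiffAt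
  have f3 : ContMDiffAt 𝓘(ℝ, ℝ × (ℝ × StdSpace n)) 𝓘(ℝ, StdSpace n) 2
      (fun p : ℝ × (ℝ × StdSpace n) => p.2.2) p :=
    (contDiff_snd.comp contDiff_snd).contDiffAt.contMDiffAt
  have e2 := ContMDiffAt.comp p
    (f := fun p : ℝ × (ℝ × StdSpace n) =>
      (p.1, (p.2.1, (extChartAt (cotangentModel n) x₁).symm p.2.2)))
    (contMDiff_evolution hflow hH _) (f1.prodMk (f2.prodMk (e1.comp p f3)))
  rw [extChartAt_source] at h₀
  exact (contMDiffAt_extChartAt' h₀).comp p e2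

lemma mdifferentiableAt_evolution (s : UnitAddCircle) (t : ℝ) (x : CotangentBundle n M) :
    MDifferentiableAt (cotangentModel n) (cotangentModel n) (evolution hflow s t) x := by
  obtain ⟨s, rfl⟩ := QuotientAddGroup.mk_surjective s
  exact ((contMDiff_evolution hflow hH (t, (s, x))).comp x
    (f := fun x : CotangentBundle n M => (t, (s, x)))
    (contMDiffAt_const.prodMk (contMDiffAt_const.prodMk contMDiffAt_id))).mdifferentiableAt
      two_ne_zero

lemma hasMFDerivAt_evolution (s : UnitAddCircle) (t : ℝ) (x : CotangentBundle n M) :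
    HasMFDerivAt (cotangentModel n) (cotangentModel n) (evolution hflow s t) x
      (flowDeriv hflow s t x) :=
  (mdifferentiableAt_evolution hflow hH s t x).hasMFDerivAt

/-- The chain rule for the flow read in charts. -/
lemma fderiv_flowChart {x₁ x₀ x : CotangentBundle n M} {s t : ℝ}
    (h₁ : x ∈ (extChartAt (cotangentModel n) x₁).source)
    (h₀ : evolution hflow (s : UnitAddCircle) t x ∈ (extChartAt (cotangentModel n) x₀).source)
    (u : StdSpace n) :
    fderiv ℝ (flowChart hflow x₁ x₀) (t, (s, extChartAt (cotangentModel n) x₁ x))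
      (0, (0, chartDeriv x₁ x u)) =
      chartDeriv x₀ (evolution hflow (s : UnitAddCircle) t x)
        (flowDeriv hflow (s : UnitAddCircle) t x u) := by
  set κ := extChartAt (cotangentModel n) x₁ with hκ
  have hd : HasFDerivAt (flowChart hflow x₁ x₀) (fderiv ℝ (flowChart hflow x₁ x₀) (t, (s, κ x)))
      (t, (s, κ x)) :=
    ((contDiffAt_flowChart hflow hH (x₁ := x₁) (x₀ := x₀) (p := (t, (s, κ x))) (κ.map_source h₁)
      (by simp only [← hκ]; rwa [κ.left_inv h₁])).differentiableAt two_ne_zero).hasFDerivAt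
  have h2 : HasFDerivAt (fun z => (t, (s, z)))
      ((ContinuousLinearMap.inr ℝ ℝ (ℝ × StdSpace n)).comp
        (ContinuousLinearMap.inr ℝ ℝ (StdSpace n))) (κ x) :=
    (hasFDerivAt_prodMk_right t (s, κ x)).comp (κ x) (hasFDerivAt_prodMk_right s (κ x))
  have h3 := hd.comp (κ x) (f := fun z => (t, (s, z))) h2
  have h4 := (hasMFDerivAt_iff_hasFDerivAt.2 h3).comp x (hasMFDerivAt_extChartAt_cotangent h₁)
  have h5 := (hasMFDerivAt_extChartAt_cotangent h₀).comp x (hasMFDerivAt_evolution hflow hH s t x)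
  have h6 := h5.congr_of_eventuallyEq (f₁ := (flowChart hflow x₁ x₀ ∘ fun z => (t, (s, z))) ∘ κ) (by
    filter_upwards [(isOpen_extChartAt_source x₁).mem_nhds h₁] with y hy
    simp only [Function.comp_apply, flowChart]
    rw [κ.left_inv hy])
  exact congrArg (fun A : StdSpace n →L[ℝ] StdSpace n => A u) (hasMFDerivAt_unique h4 h6)

/-- The chain rule for the flow property. -/
lemma flowDeriv_add (s t r : ℝ) (x : CotangentBundle n M) :
    flowDeriv hflow (s : UnitAddCircle) (t + r) x =
      (flowDeriv hflow ((s + t : ℝ) : UnitAddCircle) r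
        (evolution hflow (s : UnitAddCircle) t x)).comp
          (flowDeriv hflow (s : UnitAddCircle) t x) := by
  have h := (hasMFDerivAt_evolution hflow hH ((s + t : ℝ) : UnitAddCircle) r
    (evolution hflow (s : UnitAddCircle) t x)).comp x (hasMFDerivAt_evolution hflow hH s t x)
  have e : evolution hflow (s : UnitAddCircle) (t + r) =
      evolution hflow ((s + t : ℝ) : UnitAddCircle) r ∘ evolution hflow (s : UnitAddCircle) t :=
    funext fun y => evolution_add hflow hH s t r y
  rw [flowDeriv, e]
  exact h.mfderiv

/-- The flow is symplectic. -/
lemma stdForm_flowDeriv (s : UnitAddCircle) (t : ℝ) (x : CotangentBundle n M) (u v : StdSpace n) :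
    stdForm n (flowDeriv hflow s t x u) (flowDeriv hflow s t x v) = stdForm n u v := by
  obtain ⟨s, rfl⟩ := QuotientAddGroup.mk_surjective s
  set c : ℝ → ℝ := fun t => stdForm n (flowDeriv hflow (s : UnitAddCircle) t x u)
    (flowDeriv hflow (s : UnitAddCircle) t x v) with hc
  have hder : ∀ t, HasDerivAt c 0 t := by
    intro t
    set x₀ := evolution hflow (s : UnitAddCircle) t x with hx₀
    set κ := extChartAt (cotangentModel n) x with hκ
    have hx : x ∈ κ.source := mem_extChartAt_source x
    have hev : ∀ᶠ q : ℝ × StdSpace n in 𝓝 (t, κ x), q.2 ∈ κ.target ∧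
        evolution hflow (s : UnitAddCircle) q.1 (κ.symm q.2) ∈
          (extChartAt (cotangentModel n) x₀).source := by
      have h1 : ∀ᶠ q : ℝ × StdSpace n in 𝓝 (t, κ x), q.2 ∈ κ.target :=
        continuousAt_snd.eventually ((isOpen_extChartAt_target x).mem_nhds (κ.map_source hx))
      have h2 : ContinuousAt (fun q : ℝ × StdSpace n =>
          evolution hflow (s : UnitAddCircle) q.1 (κ.symm q.2)) (t, κ x) := by
        have hs : ContinuousAt κ.symm (κ x) := continuousAt_extChartAt_symm x
        exact ((continuous_evolution hflow hH).continuousAt).comp (x := (t, κ x))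
          (f := fun q : ℝ × StdSpace n => (q.1, (s, κ.symm q.2)))
          (continuousAt_fst.prodMk (continuousAt_const.prodMk
            (hs.comp (x := (t, κ x)) (f := Prod.snd) continuousAt_snd)))
      refine h1.and (h2.eventually ((isOpen_extChartAt_source x₀).mem_nhds ?_))
      change evolution hflow (s : UnitAddCircle) t (κ.symm (κ x)) ∈ _
      rw [κ.left_inv hx]
      exact mem_extChartAt_source _
    set g : ℝ × StdSpace n → StdSpace n := fun q => flowChart hflow x x₀ (q.1, (s, q.2)) with hg
    have hinc : ContDiff ℝ 2 fun q : ℝ × StdSpace n => (q.1, (s, q.2)) :=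
      contDiff_fst.prodMk (contDiff_const.prodMk contDiff_snd)
    have hgd : ∀ᶠ q in 𝓝 (t, κ x), ContDiffAt ℝ 2 g q := by
      filter_upwards [hev] with q hq
      exact ContDiffAt.comp q (g := flowChart hflow x x₀)
        (f := fun q : ℝ × StdSpace n => (q.1, (s, q.2)))
        (contDiffAt_flowChart hflow hH hq.1 hq.2) hinc.contDiffAt
    have hgx : g (t, κ x) = extChartAt (cotangentModel n) x₀ x₀ := by
      change extChartAt (cotangentModel n) x₀
        (evolution hflow (s : UnitAddCircle) t (κ.symm (κ x))) = _
      rw [κ.left_inv hx]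
    have hfd : ∀ᶠ q in 𝓝 (t, κ x), ∀ w, fderiv ℝ g q (0, w) =
        fderiv ℝ (flowChart hflow x x₀) (q.1, (s, q.2)) (0, (0, w)) := by
      filter_upwards [hev] with q hq w
      have h1 := ((contDiffAt_flowChart hflow hH (p := (q.1, (s, q.2))) hq.1
        hq.2).differentiableAt two_ne_zero).hasFDerivAt
      have h2 : HasFDerivAt (fun q : ℝ × StdSpace n => (q.1, (s, q.2)))
          ((ContinuousLinearMap.fst ℝ ℝ (StdSpace n)).prod
            ((0 : ℝ × StdSpace n →L[ℝ] ℝ).prod (ContinuousLinearMap.snd ℝ ℝ (StdSpace n)))) q :=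
        hasFDerivAt_fst.prodMk ((hasFDerivAt_const s q).prodMk hasFDerivAt_snd)
      have h3 : HasFDerivAt g _ q :=
        h1.comp q (f := fun q : ℝ × StdSpace n => (q.1, (s, q.2))) h2
      rw [h3.fderiv]
      simp
    have key := hasDerivAt_stdForm_fderiv (g := g)
      (h := fun q => chartHam H x₀ ((s, 0) + q)) (t := t) (ζ := κ x) hgd.self_of_nhds ?_ ?_
      (chartDeriv x x u) (chartDeriv x x v)
    · refine key.congr_of_eventuallyEq ?_
      have hcont : ContinuousAt (fun r : ℝ => (r, κ x)) t := by fun_prop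
      filter_upwards [hcont.eventually hfd, hcont.eventually hev] with r hr hr'
      have hsrc : evolution hflow (s : UnitAddCircle) r x ∈
          (extChartAt (cotangentModel n) x₀).source := by
        have := hr'.2
        rwa [show κ.symm (r, κ x).2 = x from κ.left_inv hx] at this
      rw [hr, hr, fderiv_flowChart hflow hH hx hsrc, fderiv_flowChart hflow hH hx hsrc,
        stdForm_chartDeriv hsrc]
    · have h1 : ContDiffAt ℝ 2 (chartHam H x₀) ((s, 0) + (t, g (t, κ x))) := by
        refine ((contDiffOn_chartHam hH x₀).contDiffAt
          ((isOpen_univ_prod_target x₀).mem_nhds ⟨mem_univ _, ?_⟩)).of_le (by decide)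
        simp only [Prod.mk_add_mk, zero_add, hgx]
        exact (extChartAt (cotangentModel n) x₀).map_source (mem_extChartAt_source x₀)
      exact h1.comp (t, g (t, κ x)) (contDiff_const.add contDiff_id).contDiffAt
    · filter_upwards [hev, hgd] with q hq hq'
      have h1 : HasDerivAt (fun r : ℝ => (r, q.2)) ((1 : ℝ), (0 : StdSpace n)) q.1 :=
        (hasDerivAt_id q.1).prodMk (hasDerivAt_const _ _)
      have h2 : HasDerivAt (fun r : ℝ => g (r, q.2)) (fderiv ℝ g q (1, 0)) q.1 :=
        HasFDerivAt.comp_hasDerivAt q.1 (l := g) (f := fun r : ℝ => (r, q.2))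
          (hq'.differentiableAt two_ne_zero).hasFDerivAt h1
      have h3 := (isHamiltonianOrbit_evolution hflow (s : UnitAddCircle)
        (κ.symm q.2)).hasDerivAt hH (t := q.1) hq.2
      rw [fderiv_comp_add_left, h2.unique h3, chartField]
      simp [hg, flowChart, hκ]
  have hconst := is_const_of_deriv_eq_zero (fun t => (hder t).differentiableAt)
    (fun t => (hder t).deriv) t 0
  refine hconst.trans ?_
  simp only [hc, flowDeriv_zero hflow]
  rfl

end FlowDerivative

/-! ### Symplectic maps and the pulled back vertical subspaces -/

section SymplecticInverse

variable {n : ℕ}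

/-- `g` preserves the standard symplectic form. -/
def IsSymplectic (g : StdSpace n →L[ℝ] StdSpace n) : Prop :=
  ∀ v w, stdForm n (g v) (g w) = stdForm n v w

/-- The symplectic adjoint of `g`, which is its inverse if `g` is symplectic.  It depends linearly,
hence continuously, on `g`. -/
noncomputable def sympInv (g : StdSpace n →L[ℝ] StdSpace n) : StdSpace n →L[ℝ] StdSpace n :=
  ((flatEquiv n).symm : (StdSpace n →L[ℝ] ℝ) →L[ℝ] StdSpace n).comp
    (((ContinuousLinearMap.compL ℝ (StdSpace n) (StdSpace n) ℝ).flip g).comp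
      (flatEquiv n : StdSpace n →L[ℝ] (StdSpace n →L[ℝ] ℝ)))

lemma continuous_sympInv : Continuous (sympInv (n := n)) :=
  continuous_const.clm_comp
    (((ContinuousLinearMap.compL ℝ (StdSpace n) (StdSpace n) ℝ).flip.continuous).clm_comp
      continuous_const)

lemma stdForm_sympInv (g : StdSpace n →L[ℝ] StdSpace n) (x y : StdSpace n) :
    stdForm n (sympInv g x) y = stdForm n x (g y) := by
  change stdForm n ((flatEquiv n).symm ((flatEquiv n x).comp g)) y = _
  rw [stdForm_flatEquiv_symm, ContinuousLinearMap.comp_apply, flatEquiv_apply, neg_neg]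

variable {g h : StdSpace n →L[ℝ] StdSpace n}

lemma IsSymplectic.injective (hg : IsSymplectic g) : Function.Injective g :=
  injective_of_stdForm_eq (g := g.toLinearMap) hg

lemma IsSymplectic.comp (hg : IsSymplectic g) (hh : IsSymplectic h) : IsSymplectic (g.comp h) :=
  fun v w => (hg _ _).trans (hh v w)

lemma isSymplectic_id : IsSymplectic (ContinuousLinearMap.id ℝ (StdSpace n)) := fun _ _ => rfl

lemma IsSymplectic.sympInv_apply (hg : IsSymplectic g) (x : StdSpace n) : sympInv g (g x) = x := by
  refine sub_eq_zero.1 (eq_zero_of_stdForm_eq_zero fun v => ?_)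
  rw [stdForm_swap, map_sub, LinearMap.sub_apply, stdForm_sympInv, hg, sub_self, neg_zero]

lemma IsSymplectic.apply_sympInv (hg : IsSymplectic g) (x : StdSpace n) : g (sympInv g x) = x := by
  obtain ⟨y, rfl⟩ := LinearMap.injective_iff_surjective.1
    (show Function.Injective g.toLinearMap from hg.injective) x
  exact congrArg g (hg.sympInv_apply y)

lemma IsSymplectic.sympInv (hg : IsSymplectic g) : IsSymplectic (sympInv g) := fun v w => by
  rw [stdForm_sympInv, hg.apply_sympInv]

lemma IsSymplectic.comap_eq (hg : IsSymplectic g) (S : Submodule ℝ (StdSpace n)) :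
    S.comap g.toLinearMap = S.map (_root_.sympInv g).toLinearMap := by
  ext x
  constructor
  · intro hx
    exact ⟨g x, hx, hg.sympInv_apply x⟩
  · rintro ⟨y, hy, rfl⟩
    change g (_root_.sympInv g y) ∈ S
    rwa [hg.apply_sympInv]

lemma IsSymplectic.map_sympInv_map (hg : IsSymplectic g) (S : Submodule ℝ (StdSpace n)) :
    (S.map g.toLinearMap).map (_root_.sympInv g).toLinearMap = S := by
  rw [← hg.comap_eq, Submodule.comap_map_eq_of_injective]
  exact hg.injective

/-- A symplectic map as an isomorphism. -/
noncomputable def IsSymplectic.equiv (hg : IsSymplectic g) : StdSpace n ≃L[ℝ] StdSpace n :=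
  ContinuousLinearEquiv.equivOfInverse g (_root_.sympInv g) hg.sympInv_apply hg.apply_sympInv

end SymplecticInverse

section PulledBackVertical

variable {n : ℕ} {M : Type*} [TopologicalSpace M] [ChartedSpace (EuclideanSpace ℝ (Fin n)) M]
  [IsManifold (𝓡 n) ∞ M] {H : ExtPhaseSpace n M → ℝ} (hflow : GeneratesGlobalFlow H)

/-- The vertical subspace at the point reached at time `t`, carried back to the initial point by the
differential of the flow. -/
noncomputable def pullVert (s : UnitAddCircle) (t : ℝ) (x : CotangentBundle n M) :
    Submodule ℝ (StdSpace n) :=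
  (stdVertical n).comap (flowDeriv hflow s t x).toLinearMap

lemma isSymplectic_chartDeriv {x y : CotangentBundle n M}
    (h : y ∈ (extChartAt (cotangentModel n) x).source) : IsSymplectic (chartDeriv x y) :=
  stdForm_chartDeriv h

lemma chartDeriv_mem_stdVertical {x y : CotangentBundle n M}
    (h : y ∈ (extChartAt (cotangentModel n) x).source) (u : StdSpace n) :
    chartDeriv x y u ∈ stdVertical n ↔ u ∈ stdVertical n := by
  conv_lhs => rw [← map_stdVertical_chartDeriv h]
  constructor
  · rintro ⟨v, hv, e⟩
    rwa [← (isSymplectic_chartDeriv h).injective e]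
  · exact fun hu => ⟨u, hu, rfl⟩

lemma mem_pullVert {s : UnitAddCircle} {t : ℝ} {x : CotangentBundle n M} {u : StdSpace n} :
    u ∈ pullVert hflow s t x ↔ flowDeriv hflow s t x u ∈ stdVertical n := Iff.rfl

lemma pullVert_zero (s : UnitAddCircle) (x : CotangentBundle n M) :
    pullVert hflow s 0 x = stdVertical n := by
  rw [pullVert, flowDeriv_zero]
  rfl

/-- The differential of the flow, read in the charts of `T*M` at `x₁` (source) and `x₀` (target). -/
noncomputable def chartFlowDeriv (x₁ x₀ : CotangentBundle n M) (p : ℝ × (ℝ × CotangentBundle n M)) :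
    StdSpace n →L[ℝ] StdSpace n :=
  ((chartDeriv x₀ (evolution hflow (p.2.1 : UnitAddCircle) p.1 p.2.2)).comp
    (flowDeriv hflow (p.2.1 : UnitAddCircle) p.1 p.2.2)).comp (sympInv (chartDeriv x₁ p.2.2))

variable [T2Space M] (hH : IsSmoothHamiltonian H)

include hH

lemma isSymplectic_flowDeriv (s : UnitAddCircle) (t : ℝ) (x : CotangentBundle n M) :
    IsSymplectic (flowDeriv hflow s t x) :=
  stdForm_flowDeriv hflow hH s t x

lemma isLagrangian_pullVert (s : UnitAddCircle) (t : ℝ) (x : CotangentBundle n M) :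
    IsLagrangian (pullVert hflow s t x) := by
  have h := isSymplectic_flowDeriv hflow hH s t x
  rw [pullVert, h.comap_eq]
  exact isLagrangian_stdVertical.map h.sympInv.injective h.sympInv

lemma pullVert_add (s t r : ℝ) (x : CotangentBundle n M) :
    pullVert hflow (s : UnitAddCircle) (t + r) x =
      (pullVert hflow ((s + t : ℝ) : UnitAddCircle) r
        (evolution hflow (s : UnitAddCircle) t x)).comap
          (flowDeriv hflow (s : UnitAddCircle) t x).toLinearMap := by
  simp only [pullVert]
  rw [flowDeriv_add hflow hH]
  exact Submodule.comap_comp _ _ _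

/-- The differential of the flow depends continuously on all variables, when read in charts. -/
lemma continuousAt_chartFlowDeriv {x₁ x₀ x : CotangentBundle n M} {s t : ℝ}
    (h₁ : x ∈ (extChartAt (cotangentModel n) x₁).source)
    (h₀ : evolution hflow (s : UnitAddCircle) t x ∈ (extChartAt (cotangentModel n) x₀).source) :
    ContinuousAt (chartFlowDeriv hflow x₁ x₀) (t, (s, x)) := by
  set κ := extChartAt (cotangentModel n) x₁ with hκ
  have hd : ContDiffAt ℝ 2 (flowChart hflow x₁ x₀) (t, (s, κ x)) :=
    contDiffAt_flowChart hflow hH (κ.map_source h₁)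
      (by simp only [← hκ]; rwa [κ.left_inv h₁])
  have hc : ContinuousAt (fderiv ℝ (flowChart hflow x₁ x₀)) (t, (s, κ x)) :=
    (hd.fderiv_right (m := 1) (by norm_num)).continuousAt
  have hκc : ContinuousAt (fun p : ℝ × (ℝ × CotangentBundle n M) => (p.1, (p.2.1, κ p.2.2)))
      (t, (s, x)) :=
    continuousAt_fst.prodMk ((continuousAt_fst.comp continuousAt_snd).prodMk
      (ContinuousAt.comp (x := (t, (s, x))) (f := fun p : ℝ × (ℝ × CotangentBundle n M) => p.2.2)
        (continuousAt_extChartAt' h₁) (continuousAt_snd.comp continuousAt_snd)))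
  have hc2 := ContinuousAt.comp (x := (t, (s, x)))
    (f := fun p : ℝ × (ℝ × CotangentBundle n M) => (p.1, (p.2.1, κ p.2.2))) hc hκc
  have hc3 := ContinuousAt.clm_comp hc2 (continuousAt_const
    (y := (ContinuousLinearMap.inr ℝ ℝ (ℝ × StdSpace n)).comp
        (ContinuousLinearMap.inr ℝ ℝ (StdSpace n))))
  refine hc3.congr ?_
  have e1 : ∀ᶠ p : ℝ × (ℝ × CotangentBundle n M) in 𝓝 (t, (s, x)), p.2.2 ∈ κ.source :=
    (continuous_snd.comp continuous_snd).continuousAt.eventually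
      ((isOpen_extChartAt_source x₁).mem_nhds h₁)
  have e2 : ∀ᶠ p : ℝ × (ℝ × CotangentBundle n M) in 𝓝 (t, (s, x)),
      evolution hflow (p.2.1 : UnitAddCircle) p.1 p.2.2 ∈
        (extChartAt (cotangentModel n) x₀).source :=
    (continuous_evolution hflow hH).continuousAt.eventually
      ((isOpen_extChartAt_source x₀).mem_nhds h₀)
  filter_upwards [e1, e2] with p hp1 hp2
  refine ContinuousLinearMap.ext fun v => ?_
  obtain ⟨u, rfl⟩ := chartDeriv_surjective hp1 v
  have := fderiv_flowChart hflow hH hp1 hp2 u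
  simp only [chartFlowDeriv, ContinuousLinearMap.comp_apply, Function.comp_apply,
    (isSymplectic_chartDeriv hp1).sympInv_apply]
  exact this

lemma isSymplectic_chartFlowDeriv {x₁ x₀ : CotangentBundle n M}
    {p : ℝ × (ℝ × CotangentBundle n M)} (h₁ : p.2.2 ∈ (extChartAt (cotangentModel n) x₁).source)
    (h₀ : evolution hflow (p.2.1 : UnitAddCircle) p.1 p.2.2 ∈
      (extChartAt (cotangentModel n) x₀).source) : IsSymplectic (chartFlowDeriv hflow x₁ x₀ p) :=
  ((isSymplectic_chartDeriv h₀).comp (isSymplectic_flowDeriv hflow hH _ _ _)).comp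
    (isSymplectic_chartDeriv h₁).sympInv

lemma map_pullVert_eq {x₁ x₀ : CotangentBundle n M}
    {p : ℝ × (ℝ × CotangentBundle n M)} (h₁ : p.2.2 ∈ (extChartAt (cotangentModel n) x₁).source)
    (h₀ : evolution hflow (p.2.1 : UnitAddCircle) p.1 p.2.2 ∈
      (extChartAt (cotangentModel n) x₀).source) :
    (pullVert hflow (p.2.1 : UnitAddCircle) p.1 p.2.2).map (chartDeriv x₁ p.2.2).toLinearMap =
      (stdVertical n).map (sympInv (chartFlowDeriv hflow x₁ x₀ p)).toLinearMap := by
  have h1 := isSymplectic_chartDeriv h₁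
  rw [← (isSymplectic_chartFlowDeriv hflow hH h₁ h₀).comap_eq]
  ext v
  rw [Submodule.mem_map, Submodule.mem_comap]
  simp only [chartFlowDeriv, ContinuousLinearMap.coe_coe, ContinuousLinearMap.comp_apply]
  rw [chartDeriv_mem_stdVertical h₀]
  constructor
  · rintro ⟨u, hu, rfl⟩
    rw [h1.sympInv_apply]
    exact (mem_pullVert hflow).1 hu
  · intro hv
    exact ⟨sympInv (chartDeriv x₁ p.2.2) v, (mem_pullVert hflow).2 hv, h1.apply_sympInv v⟩

/-- The pulled back vertical subspaces, read in a chart around the initial point, form a continuous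
family of Lagrangian subspaces. -/
lemma isLagFamily_pullVert (x₁ : CotangentBundle n M) :
    IsLagFamily fun p : ℝ × (ℝ × (extChartAt (cotangentModel n) x₁).source) =>
      (pullVert hflow (p.2.1 : UnitAddCircle) p.1 p.2.2).map
        (chartDeriv x₁ p.2.2).toLinearMap := by
  refine ⟨fun p => (isLagrangian_pullVert hflow hH _ _ _).map
    (isSymplectic_chartDeriv p.2.2.2).injective (isSymplectic_chartDeriv p.2.2.2), fun p => ?_⟩
  obtain ⟨t, s, x, hx⟩ := p
  set x₀ := evolution hflow (s : UnitAddCircle) t x with hx₀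
  let ι : ℝ × (ℝ × (extChartAt (cotangentModel n) x₁).source) → ℝ × (ℝ × CotangentBundle n M) :=
    fun p => (p.1, (p.2.1, (p.2.2 : CotangentBundle n M)))
  have hι : Continuous ι := by fun_prop
  have hc : ContinuousAt (chartFlowDeriv hflow x₁ x₀) (ι (t, (s, ⟨x, hx⟩))) :=
    continuousAt_chartFlowDeriv hflow hH hx (mem_extChartAt_source x₀)
  have e2 : ∀ᶠ p in 𝓝 (ι (t, (s, ⟨x, hx⟩))),
      evolution hflow (p.2.1 : UnitAddCircle) p.1 p.2.2 ∈
        (extChartAt (cotangentModel n) x₀).source :=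
    (continuous_evolution hflow hH).continuousAt.eventually
      ((isOpen_extChartAt_source x₀).mem_nhds (mem_extChartAt_source x₀))
  have hc' : ContinuousAt (fun p => sympInv (chartFlowDeriv hflow x₁ x₀ (ι p)))
      (t, (s, ⟨x, hx⟩)) :=
    (continuous_sympInv.tendsto _).comp (hc.tendsto.comp (hι.tendsto _))
  refine ⟨stdVertical n, _, hc', ?_⟩
  filter_upwards [hι.continuousAt.eventually e2] with p hp
  exact ⟨(isSymplectic_chartFlowDeriv hflow hH (p := ι p) p.2.2.2 hp).sympInv.injective,
    map_pullVert_eq hflow hH (p := ι p) p.2.2.2 hp⟩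

lemma isLagFamily_pullVert_path (s : UnitAddCircle) (x : CotangentBundle n M) :
    IsLagFamily fun t : ℝ => pullVert hflow s t x := by
  obtain ⟨s, rfl⟩ := QuotientAddGroup.mk_surjective s
  have hx : x ∈ (extChartAt (cotangentModel n) x).source := mem_extChartAt_source x
  have h := (isLagFamily_pullVert hflow hH x).comp
    (f := fun t : ℝ => ((t, (s, ⟨x, hx⟩)) : ℝ × (ℝ × (extChartAt (cotangentModel n) x).source)))
    (by fun_prop)
  have h1 := isSymplectic_chartDeriv hx
  have h2 := h.map (k := fun _ => sympInv (chartDeriv x x)) continuous_const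
    (fun _ => h1.sympInv)
  simpa only [h1.map_sympInv_map] using h2

end PulledBackVertical

/-! ### Symplectic trivializations along orbits -/

section Transport

variable {n : ℕ}

/-- A continuous family of symplectic maps `T t` which carries `L a` to `L t` for `t ∈ [a, b]`, and
is constant on both sides of `[a, b]`, starting with the identity. -/
structure IsTransport (L : ℝ → Submodule ℝ (StdSpace n)) (a b : ℝ)
    (T : ℝ → StdSpace n →L[ℝ] StdSpace n) : Prop where
  continuous : Continuous T
  isSymplectic : ∀ t, IsSymplectic (T t)
  map_eq : ∀ t, (L a).map (T t).toLinearMap = L (max a (min t b))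
  eq_id : ∀ t ≤ a, T t = ContinuousLinearMap.id ℝ (StdSpace n)

/-- A path of subspaces which near each time is the image of a fixed one under symplectic maps
depending continuously on the time. -/
def IsLocallyTransported (L : ℝ → Submodule ℝ (StdSpace n)) : Prop :=
  ∀ t₀ : ℝ, ∃ (I : Set ℝ) (S : Submodule ℝ (StdSpace n)) (R : ℝ → StdSpace n →L[ℝ] StdSpace n),
    IsOpen I ∧ t₀ ∈ I ∧ ContinuousOn R I ∧
      ∀ t ∈ I, IsSymplectic (R t) ∧ S.map (R t).toLinearMap = L t

variable {L : ℝ → Submodule ℝ (StdSpace n)} {a b c : ℝ} {T T' : ℝ → StdSpace n →L[ℝ] StdSpace n}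

lemma IsTransport.trans (hab : a ≤ b) (hbc : b ≤ c) (h : IsTransport L a b T)
    (h' : IsTransport L b c T') : IsTransport L a c fun t => (T' t).comp (T t) where
  continuous := h'.continuous.clm_comp h.continuous
  isSymplectic t := (h'.isSymplectic t).comp (h.isSymplectic t)
  map_eq t := by
    rcases le_total t b with ht | ht
    · rw [h'.eq_id t ht, ContinuousLinearMap.id_comp, h.map_eq, min_eq_left ht,
        min_eq_left (ht.trans hbc)]
    · have e := h.map_eq t
      rw [min_eq_right ht, max_eq_right hab] at e
      change (L a).map ((T' t).toLinearMap ∘ₗ (T t).toLinearMap) = _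
      rw [Submodule.map_comp, e, h'.map_eq, max_eq_right (le_min ht hbc),
        max_eq_right (hab.trans (le_min ht hbc))]
  eq_id t ht := by
    rw [h'.eq_id t (ht.trans hab), h.eq_id t ht]
    rfl

lemma isTransport_self (a : ℝ) :
    IsTransport L a a fun _ => ContinuousLinearMap.id ℝ (StdSpace n) where
  continuous := continuous_const
  isSymplectic _ := isSymplectic_id
  map_eq t := by
    rw [max_eq_left (min_le_right _ _)]
    exact Submodule.map_id _
  eq_id _ _ := rfl

lemma exists_isTransport_of_subset {I : Set ℝ} {S : Submodule ℝ (StdSpace n)}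
    {R : ℝ → StdSpace n →L[ℝ] StdSpace n} (hab : a ≤ b) (hI : Icc a b ⊆ I) (hR : ContinuousOn R I)
    (h : ∀ t ∈ I, IsSymplectic (R t) ∧ S.map (R t).toLinearMap = L t) :
    ∃ T, IsTransport L a b T := by
  have hmem : ∀ t, max a (min t b) ∈ I := fun t =>
    hI ⟨le_max_left _ _, max_le hab (min_le_right _ _)⟩
  have ha := h a (hI ⟨le_rfl, hab⟩)
  refine ⟨fun t => (R (max a (min t b))).comp (sympInv (R a)), ?_, ?_, ?_, ?_⟩
  · exact (hR.comp_continuous (by fun_prop) hmem).clm_comp continuous_const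
  · exact fun t => (h _ (hmem t)).1.comp ha.1.sympInv
  · intro t
    change (L a).map ((R (max a (min t b))).toLinearMap ∘ₗ (sympInv (R a)).toLinearMap) = _
    rw [Submodule.map_comp, ← ha.2, ha.1.map_sympInv_map, (h _ (hmem t)).2]
  · intro t ht
    rw [max_eq_left ((min_le_left _ _).trans ht)]
    exact ContinuousLinearMap.ext ha.1.apply_sympInv

lemma IsLocallyTransported.exists_isTransport (hL : IsLocallyTransported L) (hab : a ≤ b) :
    ∃ T, IsTransport L a b T := by
  choose I S R hIo hI hR h using hL
  obtain ⟨τ, h0, hmono, ⟨m, hm⟩, hsub⟩ := exists_monotone_Icc_subset_open_cover_Icc hab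
    (c := fun t₀ : ℝ => ((↑) : Icc a b → ℝ) ⁻¹' I t₀)
    (fun t₀ => (hIo t₀).preimage continuous_subtype_val)
    (fun t _ => mem_iUnion.2 ⟨t, hI t⟩)
  have key : ∀ k, ∃ T, IsTransport L a (τ k) T := by
    intro k
    induction k with
    | zero => rw [h0]; exact ⟨_, isTransport_self a⟩
    | succ k ih =>
      obtain ⟨T, hT⟩ := ih
      obtain ⟨t₀, ht₀⟩ := hsub k
      have hle : (τ k : ℝ) ≤ τ (k + 1) := hmono (Nat.le_succ k)
      obtain ⟨T', hT'⟩ := exists_isTransport_of_subset (L := L) hle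
        (fun t ht => ht₀ (a := ⟨t, (τ k).2.1.trans ht.1, ht.2.trans (τ (k + 1)).2.2⟩) ht)
        (hR t₀) (h t₀)
      exact ⟨_, hT.trans (τ k).2.1 hle hT'⟩
  have := key m
  rwa [hm m le_rfl] at this

/-- The transports over `[k, k + 1]` are put together to one over `[0, ∞)`. -/
lemma IsLocallyTransported.exists_half_line (hL : IsLocallyTransported L) :
    ∃ T : ℝ → StdSpace n →L[ℝ] StdSpace n, Continuous T ∧ (∀ t, IsSymplectic (T t)) ∧
      (∀ t, (L 0).map (T t).toLinearMap = L (max 0 t)) ∧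
      ∀ t ≤ 0, T t = ContinuousLinearMap.id ℝ (StdSpace n) := by
  choose T hT using fun k : ℕ => hL.exists_isTransport (a := k) (b := (k + 1 : ℕ))
    (by exact_mod_cast Nat.le_succ k)
  let Q : ℕ → ℝ → StdSpace n →L[ℝ] StdSpace n := fun k =>
    Nat.rec (fun _ => ContinuousLinearMap.id ℝ (StdSpace n)) (fun k q t => (T k t).comp (q t)) k
  have hQs : ∀ k t, Q (k + 1) t = (T k t).comp (Q k t) := fun _ _ => rfl
  have hQ : ∀ k : ℕ, IsTransport L 0 k (Q k) := by
    intro k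
    induction k with
    | zero =>
      rw [Nat.cast_zero]
      exact isTransport_self 0
    | succ k ih =>
      exact ih.trans (Nat.cast_nonneg k) (by exact_mod_cast Nat.le_succ k) (hT k)
  have hstab : ∀ (k m : ℕ) (t : ℝ), t ≤ k → k ≤ m → Q m t = Q k t := by
    intro k m t ht hkm
    induction m, hkm using Nat.le_induction with
    | base => rfl
    | succ m hm ih =>
      rw [hQs, (hT m).eq_id t (ht.trans (by exact_mod_cast hm)), ContinuousLinearMap.id_comp, ih]
  have heq : ∀ (N : ℕ) (t : ℝ), t < N → Q ⌈t⌉₊ t = Q N t := fun N t ht =>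
    (hstab _ _ t (Nat.le_ceil t) (Nat.ceil_le.2 ht.le)).symm
  refine ⟨fun t => Q ⌈t⌉₊ t, ?_, fun t => (hQ _).isSymplectic t, fun t => ?_, fun t ht => ?_⟩
  · rw [continuous_iff_continuousAt]
    intro t
    obtain ⟨N, hN⟩ := exists_nat_gt t
    refine ((hQ N).continuous.continuousAt).congr ?_
    filter_upwards [gt_mem_nhds hN] with s hs
    exact (heq N s hs).symm
  · rw [(hQ _).map_eq, min_eq_left (Nat.le_ceil t)]
  · exact (hQ _).eq_id t ht

/-- The transports over the two half lines are put together. -/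
lemma IsLocallyTransported.exists_transport (hL : IsLocallyTransported L) :
    ∃ T : ℝ → StdSpace n →L[ℝ] StdSpace n, Continuous T ∧ (∀ t, IsSymplectic (T t)) ∧
      ∀ t, (L 0).map (T t).toLinearMap = L t := by
  have hL' : IsLocallyTransported fun t => L (-t) := by
    intro t₀
    obtain ⟨I, S, R, hI, h0, hR, h⟩ := hL (-t₀)
    exact ⟨Neg.neg ⁻¹' I, S, fun t => R (-t), hI.preimage continuous_neg, h0,
      hR.comp continuous_neg.continuousOn fun t ht => ht, fun t ht => h (-t) ht⟩
  obtain ⟨T, h1, h2, h3, h4⟩ := hL.exists_half_line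
  obtain ⟨T', h1', h2', h3', h4'⟩ := hL'.exists_half_line
  refine ⟨fun t => (T t).comp (T' (-t)), h1.clm_comp (h1'.comp continuous_neg),
    fun t => (h2 t).comp (h2' _), fun t => ?_⟩
  beta_reduce
  rcases le_total t 0 with ht | ht
  · have := h3' (-t)
    rw [neg_zero, max_eq_right (neg_nonneg.2 ht), neg_neg] at this
    rw [h4 t ht, ContinuousLinearMap.id_comp, this]
  · rw [h4' (-t) (neg_nonpos.2 ht), ContinuousLinearMap.comp_id, h3, max_eq_right ht]

end Transport

section Trivialization

variable {n : ℕ} {M : Type*} [TopologicalSpace M] [ChartedSpace (EuclideanSpace ℝ (Fin n)) M]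
  [IsManifold (𝓡 n) ∞ M]

/-- The trivializations of the tangent bundle of `T*M` are the differentials of the charts. -/
lemma trivializationAt_tangent_snd {x₀ y : CotangentBundle n M}
    (h : y ∈ (extChartAt (cotangentModel n) x₀).source) (v : StdSpace n) :
    (trivializationAt (StdSpace n) (TangentSpace (cotangentModel n)) x₀
      (⟨y, v⟩ : TangentBundle (cotangentModel n) (CotangentBundle n M))).2 = chartDeriv x₀ y v := by
  have hI : IsManifold (cotangentModel n) 1 (CotangentBundle n M) :=
    IsManifold.of_le (n := ∞) (by decide)
  rw [extChartAt_source] at h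
  have h1 := TangentBundle.continuousLinearMapAt_trivializationAt (I := cotangentModel n) h
  have h2 : y ∈ (trivializationAt (StdSpace n) (TangentSpace (cotangentModel n)) x₀).baseSet := h
  have h3 := Bundle.Trivialization.coe_linearMapAt_of_mem (R := ℝ) _ h2
  have h4 := congrArg (fun A : StdSpace n →L[ℝ] StdSpace n => A v) h1
  exact (congrFun h3 v).symm.trans h4

/-- Continuity of a family of linear maps into the tangent spaces along a curve, read in charts. -/
lemma continuous_tangent_iff {γ : ℝ → CotangentBundle n M} (hγ : Continuous γ)
    (U : ℝ → StdSpace n →L[ℝ] StdSpace n) :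
    Continuous (fun z : ℝ × StdSpace n =>
      (⟨γ z.1, U z.1 z.2⟩ : TangentBundle (cotangentModel n) (CotangentBundle n M))) ↔
    ∀ t, ContinuousAt (fun r => (chartDeriv (γ t) (γ r)).comp (U r)) t := by
  have hI : IsManifold (cotangentModel n) 1 (CotangentBundle n M) :=
    IsManifold.of_le (n := ∞) (by decide)
  have hev : ∀ t, ∀ᶠ r in 𝓝 t, γ r ∈ (extChartAt (cotangentModel n) (γ t)).source := fun t =>
    hγ.continuousAt.eventually ((isOpen_extChartAt_source _).mem_nhds (mem_extChartAt_source _))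
  have hloc : ∀ z : ℝ × StdSpace n, ContinuousAt (fun z : ℝ × StdSpace n =>
      (⟨γ z.1, U z.1 z.2⟩ : TangentBundle (cotangentModel n) (CotangentBundle n M))) z ↔
      ContinuousAt (fun w : ℝ × StdSpace n => (chartDeriv (γ z.1) (γ w.1)).comp (U w.1) w.2) z := by
    intro z
    rw [FiberBundle.continuousAt_totalSpace]
    have h1 : ContinuousAt (fun w : ℝ × StdSpace n => γ w.1) z :=
      (hγ.comp continuous_fst).continuousAt
    simp only [h1, true_and]
    refine continuousAt_congr ?_
    filter_upwards [continuousAt_fst.eventually (hev z.1)] with w hw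
    exact trivializationAt_tangent_snd hw _
  constructor
  · intro h t
    refine continuousAt_clm_apply.2 fun v => ?_
    exact ContinuousAt.comp (f := fun r : ℝ => (r, v)) ((hloc (t, v)).1 h.continuousAt)
      (by fun_prop)
  · intro h
    rw [continuous_iff_continuousAt]
    intro z
    rw [hloc]
    exact ((h z.1).comp (x := z) (f := Prod.fst) continuousAt_fst).clm_apply continuousAt_snd


variable {H : ExtPhaseSpace n M → ℝ} (hflow : GeneratesGlobalFlow H)

lemma eventually_evolution_mem_source (s : UnitAddCircle) (x : CotangentBundle n M) (t : ℝ) :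
    ∀ᶠ r in 𝓝 t, evolution hflow s r x ∈
      (extChartAt (cotangentModel n) (evolution hflow s t x)).source :=
  (isHamiltonianOrbit_evolution hflow s x).continuous.continuousAt.eventually
    ((isOpen_extChartAt_source _).mem_nhds (mem_extChartAt_source _))

variable [T2Space M] (hH : IsSmoothHamiltonian H)

include hH

/-- Along an orbit, the differential of the flow is continuous in charts of `T*M`. -/
lemma continuousAt_chartDeriv_comp_flowDeriv (s : UnitAddCircle) (x : CotangentBundle n M)
    {x₀ : CotangentBundle n M} {t : ℝ}
    (h₀ : evolution hflow s t x ∈ (extChartAt (cotangentModel n) x₀).source) :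
    ContinuousAt (fun r => (chartDeriv x₀ (evolution hflow s r x)).comp (flowDeriv hflow s r x))
      t := by
  obtain ⟨s, rfl⟩ := QuotientAddGroup.mk_surjective s
  have hx : x ∈ (extChartAt (cotangentModel n) x).source := mem_extChartAt_source x
  have h1 : ContinuousAt (fun r : ℝ => chartFlowDeriv hflow x x₀ (r, (s, x))) t :=
    ContinuousAt.comp (f := fun r : ℝ => (r, (s, x)))
      (continuousAt_chartFlowDeriv hflow hH hx h₀) (by fun_prop)
  refine (h1.clm_comp (continuousAt_const (y := chartDeriv x x))).congr (.of_forall fun r => ?_)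
  refine ContinuousLinearMap.ext fun v => ?_
  simp only [chartFlowDeriv, ContinuousLinearMap.comp_apply,
    (isSymplectic_chartDeriv hx).sympInv_apply]

/-- Locally along an orbit, `pullVert` is the image of the vertical subspace under the inverse of
the differential of the flow read in a chart at the end-point. -/
lemma isLocallyTransported_pullVert (s : UnitAddCircle) (x : CotangentBundle n M) :
    IsLocallyTransported fun t => pullVert hflow s t x := by
  intro t₀
  set x₀ := evolution hflow s t₀ x with hx₀
  refine ⟨(fun t => evolution hflow s t x) ⁻¹' (extChartAt (cotangentModel n) x₀).source,
    stdVertical n, fun r => sympInv ((chartDeriv x₀ (evolution hflow s r x)).comp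
      (flowDeriv hflow s r x)),
    (isOpen_extChartAt_source x₀).preimage (isHamiltonianOrbit_evolution hflow s x).continuous,
    mem_extChartAt_source x₀, fun t ht => ?_, fun t ht => ?_⟩
  · exact ((continuous_sympInv.tendsto _).comp
      (continuousAt_chartDeriv_comp_flowDeriv hflow hH s x ht).tendsto).mono_left
        nhdsWithin_le_nhds
  · have h := (isSymplectic_chartDeriv ht).comp (isSymplectic_flowDeriv hflow hH s t x)
    refine ⟨h.sympInv, ?_⟩
    rw [← h.comap_eq]
    ext v
    exact chartDeriv_mem_stdVertical ht _

/-- The flow moves the pulled back vertical subspaces to the vertical subspaces; hence a transport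
of the former gives a trivialization which preserves the vertical subspaces. -/
lemma exists_isVerticalTrivialization (z : ExtPhaseSpace n M) :
    ∃ U : ∀ t : ℝ, StdSpace n ≃L[ℝ] TangentSpace (cotangentModel n) (evolution hflow z.1 t z.2),
      IsVerticalTrivialization (fun t => evolution hflow z.1 t z.2) U := by
  obtain ⟨T, hT, hTs, hTL⟩ := (isLocallyTransported_pullVert hflow hH z.1 z.2).exists_transport
  have hs := fun t => (isSymplectic_flowDeriv hflow hH z.1 t z.2).comp (hTs t)
  refine ⟨fun t => (hs t).equiv, ?_, fun t v w => hs t v w, fun t => ?_⟩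
  · refine (continuous_tangent_iff (isHamiltonianOrbit_evolution hflow z.1 z.2).continuous
      (fun t => (flowDeriv hflow z.1 t z.2).comp (T t))).2 fun t => ?_
    exact (continuousAt_chartDeriv_comp_flowDeriv hflow hH z.1 z.2
      (mem_extChartAt_source _)).clm_comp hT.continuousAt
  · rw [verticalSpace_eq]
    have h := isSymplectic_flowDeriv hflow hH z.1 t z.2
    have e := hTL t
    rw [pullVert_zero, pullVert] at e
    change (stdVertical n).map ((flowDeriv hflow z.1 t z.2).toLinearMap ∘ₗ (T t).toLinearMap) = _
    rw [Submodule.map_comp, e, Submodule.map_comap_eq_of_surjective]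
    exact fun y => ⟨_, h.apply_sympInv y⟩

end Trivialization

/-! ### The functions `μ_t` as primitives -/

section MaslovFunction

variable {n : ℕ} {M : Type*} [TopologicalSpace M] [ChartedSpace (EuclideanSpace ℝ (Fin n)) M]
  [IsManifold (𝓡 n) ∞ M] {H : ExtPhaseSpace n M → ℝ} (hflow : GeneratesGlobalFlow H)
  [T2Space M] (hH : IsSmoothHamiltonian H)

section

variable (z : ExtPhaseSpace n M)
  (U : ∀ t : ℝ, StdSpace n ≃L[ℝ] TangentSpace (cotangentModel n) (evolution hflow z.1 t z.2))

/-- The maps of a trivialization, read in the preferred charts along the orbit. -/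
noncomputable def trivCLM (t : ℝ) : StdSpace n →L[ℝ] StdSpace n :=
  (U t).toContinuousLinearMap

/-- A trivialization compared with the one given by the differential of the flow. -/
noncomputable def relTriv (t : ℝ) : StdSpace n →L[ℝ] StdSpace n :=
  (sympInv (flowDeriv hflow z.1 t z.2)).comp (trivCLM hflow z U t)

include hH

variable {z U} (hU : IsVerticalTrivialization (fun t => evolution hflow z.1 t z.2) U)

include hU

lemma isSymplectic_relTriv (t : ℝ) : IsSymplectic (relTriv hflow z U t) :=
  (isSymplectic_flowDeriv hflow hH z.1 t z.2).sympInv.comp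
    (show IsSymplectic (trivCLM hflow z U t) from hU.2.1 t)

lemma map_stdVertical_relTriv (t : ℝ) :
    (stdVertical n).map (relTriv hflow z U t).toLinearMap = pullVert hflow z.1 t z.2 := by
  have h1 : (stdVertical n).map (trivCLM hflow z U t).toLinearMap = stdVertical n :=
    (hU.2.2 t).trans (verticalSpace_eq _)
  rw [pullVert, (isSymplectic_flowDeriv hflow hH z.1 t z.2).comap_eq]
  conv_rhs => rw [← h1]
  exact Submodule.map_comp (trivCLM hflow z U t).toLinearMap
    (sympInv (flowDeriv hflow z.1 t z.2)).toLinearMap (stdVertical n)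

/-- The path `λ^U` is the image of the vertical subspace under the inverse of `relTriv`. -/
lemma trivializedPath_eq (t : ℝ) : trivializedPath hflow z U t =
    (stdVertical n).map (sympInv (relTriv hflow z U t)).toLinearMap := by
  have hs := isSymplectic_flowDeriv hflow hH z.1 t z.2
  rw [← (isSymplectic_relTriv hflow hH hU t).comap_eq, trivializedPath, verticalSpace_eq]
  ext v
  constructor
  · rintro ⟨w, hw, e⟩
    change StdSpace n at w
    have e' : flowDeriv hflow z.1 t z.2 w = trivCLM hflow z U t v := e
    change sympInv (flowDeriv hflow z.1 t z.2) (trivCLM hflow z U t v) ∈ stdVertical n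
    rw [← e', hs.sympInv_apply]
    exact hw
  · intro hv
    exact ⟨_, hv, hs.apply_sympInv _⟩

lemma continuous_relTriv : Continuous (relTriv hflow z U) := by
  rw [continuous_iff_continuousAt]
  intro t
  have h1 := (continuous_tangent_iff (isHamiltonianOrbit_evolution hflow z.1 z.2).continuous
    (trivCLM hflow z U)).1 hU.1 t
  have h2 := continuousAt_chartDeriv_comp_flowDeriv hflow hH z.1 z.2 (t := t)
    (mem_extChartAt_source (I := cotangentModel n) _)
  have h3 : ContinuousAt (fun r => sympInv ((chartDeriv (evolution hflow z.1 t z.2)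
      (evolution hflow z.1 r z.2)).comp (flowDeriv hflow z.1 r z.2))) t :=
    (continuous_sympInv.tendsto _).comp h2.tendsto
  refine (h3.clm_comp h1).congr ?_
  filter_upwards [eventually_evolution_mem_source hflow z.1 z.2 t] with r hr
  have hs := isSymplectic_flowDeriv hflow hH z.1 r z.2
  have hs' := (isSymplectic_chartDeriv hr).comp hs
  refine ContinuousLinearMap.ext fun v => ?_
  apply hs'.injective
  refine (hs'.apply_sympInv _).trans ?_
  change chartDeriv _ _ (trivCLM hflow z U r v) =
    chartDeriv _ _ (flowDeriv hflow z.1 r z.2 (relTriv hflow z U r v))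
  rw [relTriv, ContinuousLinearMap.comp_apply, hs.apply_sympInv]

lemma isLagFamily_trivializedPath : IsLagFamily (trivializedPath hflow z U) := by
  rw [funext (trivializedPath_eq hflow hH hU)]
  exact (IsLagFamily.const isLagrangian_stdVertical).map
    (continuous_sympInv.comp (continuous_relTriv hflow hH hU))
    fun t => (isSymplectic_relTriv hflow hH hU t).sympInv

/-- The Maslov index of `λ^U` is a primitive for the pair formed by the pulled back vertical
subspaces and the vertical subspace, which does not involve `U`. -/
lemma isPrimitiveAt_maslovIndex_trivializedPath (t : ℝ) :
    IsPrimitiveAt (fun t => pullVert hflow z.1 (max t 0) z.2) (fun _ => stdVertical n)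
      (fun t => maslovIndex (trivializedPath hflow z U) (stdVertical n) 0 (max t 0)) t := by
  have hlam := isLagFamily_trivializedPath hflow hH hU
  have hm : Continuous fun t : ℝ => max t 0 := by fun_prop
  have h := (isPrimitiveAt_maslovIndex isLagrangian_stdVertical hlam t).map
    (.const isLagrangian_stdVertical) (hlam.comp hm)
    ((continuous_relTriv hflow hH hU).comp hm)
    (fun t => isSymplectic_relTriv hflow hH hU (max t 0))
  refine h.congr (.of_forall fun t => ?_) (.of_forall fun t => ?_) 0
    (.of_forall fun t => (add_zero _).symm)
  · exact (map_stdVertical_relTriv hflow hH hU _).symm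
  · have hs := isSymplectic_relTriv hflow hH hU (max t 0)
    have e := trivializedPath_eq hflow hH hU (max t 0)
    rw [← hs.comap_eq] at e
    change stdVertical n = (trivializedPath hflow z U (max t 0)).map
      (relTriv hflow z U (max t 0)).toLinearMap
    rw [e, Submodule.map_comap_eq_of_surjective]
    exact fun y => ⟨_, hs.apply_sympInv y⟩

lemma maslovIndex_trivializedPath_zero :
    maslovIndex (trivializedPath hflow z U) (stdVertical n) 0 0 = 0 := by
  have hlam := isLagFamily_trivializedPath hflow hH hU
  rw [maslovIndex_eq_sub isLagrangian_stdVertical hlam le_rfl (f := fun _ => 0), sub_zero]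
  intro t l _ _ _
  refine .of_forall fun y => ?_
  have : ∀ y : ℝ, max 0 (min y 0) = 0 := fun y => max_eq_left (min_le_right _ _)
  simp only [this]

end

include hH

lemma isLagFamily_pullVert_max (z : ExtPhaseSpace n M) :
    IsLagFamily fun t : ℝ => pullVert hflow z.1 (max t 0) z.2 :=
  (isLagFamily_pullVert_path hflow hH z.1 z.2).comp (f := fun t => max t 0) (by fun_prop)

/-- The function `μ_t + n / 2` may be computed with a fixed trivialization. -/
lemma maslovFun_eq (z : ExtPhaseSpace n M)
    {U : ∀ t : ℝ, StdSpace n ≃L[ℝ] TangentSpace (cotangentModel n) (evolution hflow z.1 t z.2)}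
    (hU : IsVerticalTrivialization (fun t => evolution hflow z.1 t z.2) U) {t : ℝ} (ht : 0 ≤ t) :
    maslovFun hflow t z =
      maslovIndex (trivializedPath hflow z U) (stdVertical n) 0 t - (n : ℝ) / 2 := by
  obtain ⟨U', hU', e⟩ := Classical.epsilon_spec
    (p := fun m : ℝ => ∃ U : ∀ t : ℝ, StdSpace n ≃L[ℝ]
      TangentSpace (cotangentModel n) (evolution hflow z.1 t z.2),
      IsVerticalTrivialization (fun t => evolution hflow z.1 t z.2) U ∧
      m = maslovIndex (trivializedPath hflow z U) (stdVertical n) 0 t - (n : ℝ) / 2)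
    ⟨_, U, hU, rfl⟩
  rw [maslovFun, e]
  have hl := isLagFamily_pullVert_max hflow hH z
  have hc := (isLocallyConstant_sub_of_isPrimitiveAt hl.1 (fun _ => isLagrangian_stdVertical)
    (isPrimitiveAt_maslovIndex_trivializedPath hflow hH hU')
    (isPrimitiveAt_maslovIndex_trivializedPath hflow hH hU)).apply_eq_of_preconnectedSpace t 0
  simp only [max_self, max_eq_left ht, maslovIndex_trivializedPath_zero hflow hH hU,
    maslovIndex_trivializedPath_zero hflow hH hU'] at hc
  linarith

/-- The function `μ_t + n / 2`, extended by its value at `0` to negative times. -/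
noncomputable def maslovPrim (hflow : GeneratesGlobalFlow H) (t : ℝ) (z : ExtPhaseSpace n M) : ℝ :=
  maslovFun hflow (max t 0) z + (n : ℝ) / 2

lemma maslovPrim_zero (z : ExtPhaseSpace n M) : maslovPrim hflow 0 z = 0 := by
  obtain ⟨U, hU⟩ := exists_isVerticalTrivialization hflow hH z
  rw [maslovPrim, max_self, maslovFun_eq hflow hH z hU le_rfl,
    maslovIndex_trivializedPath_zero hflow hH hU]
  ring

/-- For negative times both the family and the function are constant. -/
lemma isPrimitiveAt_maslovPrim (z : ExtPhaseSpace n M) (t : ℝ) :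
    IsPrimitiveAt (fun t => pullVert hflow z.1 (max t 0) z.2) (fun _ => stdVertical n)
      (fun t => maslovPrim hflow t z) t := by
  obtain ⟨U, hU⟩ := exists_isVerticalTrivialization hflow hH z
  refine (isPrimitiveAt_maslovIndex_trivializedPath hflow hH hU t).congr .rfl .rfl 0
    (.of_forall fun t => ?_)
  rw [maslovPrim, maslovFun_eq hflow hH z hU (le_max_right _ _)]
  ring

/-- The functions `μ_t` form a cocycle up to a bounded error: changing the reference Lagrangian
subspace changes the Maslov index by a difference of two Kashiwara indices. -/
lemma abs_maslovPrim_add_sub_le {s r : ℝ} (hs : 0 ≤ s) (hr : 0 ≤ r) (z : ExtPhaseSpace n M) :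
    |maslovPrim hflow (s + r) z - maslovPrim hflow s z - maslovPrim hflow r (extFlow hflow s z)| ≤
      3 * n := by
  obtain ⟨σ, x⟩ := z
  obtain ⟨σ, rfl⟩ := QuotientAddGroup.mk_surjective σ
  set D := flowDeriv hflow (σ : UnitAddCircle) s x with hD
  have hDs : IsSymplectic D := isSymplectic_flowDeriv hflow hH _ s x
  set z' := extFlow hflow s ((σ : UnitAddCircle), x) with hz'
  set A : ℝ → Submodule ℝ (StdSpace n) :=
    fun r => pullVert hflow (σ : UnitAddCircle) (s + max r 0) x with hA
  set B' := (stdVertical n).map (sympInv D).toLinearMap with hB'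
  have hB'l : IsLagrangian B' := isLagrangian_stdVertical.map hDs.sympInv.injective hDs.sympInv
  have hAf : IsLagFamily A := (isLagFamily_pullVert_path hflow hH (σ : UnitAddCircle) x).comp
    (f := fun r => s + max r 0) (by fun_prop)
  have hmax : ∀ r : ℝ, max (s + max r 0) 0 = s + max r 0 := fun r =>
    max_eq_left (add_nonneg hs (le_max_right _ _))
  have h1 : ∀ r, IsPrimitiveAt A (fun _ => stdVertical n)
      (fun r => maslovPrim hflow (s + max r 0) ((σ : UnitAddCircle), x)) r := by
    intro r
    have := (isPrimitiveAt_maslovPrim hflow hH ((σ : UnitAddCircle), x) (s + max r 0)).comp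
      (φ := fun r => s + max r 0) (by fun_prop)
    simpa only [hmax] using this
  have h2 : ∀ r, IsPrimitiveAt A (fun _ => B') (fun r => maslovPrim hflow r z') r := by
    intro r
    have := (isPrimitiveAt_maslovPrim hflow hH z' r).map (isLagFamily_pullVert_max hflow hH z')
      (.const isLagrangian_stdVertical) (k := fun _ => sympInv D) continuous_const
      (fun _ => hDs.sympInv)
    refine this.congr (.of_forall fun r => ?_) .rfl 0 (.of_forall fun r => (add_zero _).symm)
    simp only [hA]
    rw [pullVert_add hflow hH, hDs.comap_eq, AddCircle.coe_add]
    rfl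
  -- the two functions are primitives for two pairs which differ in the second subspace only
  have hloc : IsLocallyConstant fun r =>
      maslovPrim hflow (s + max r 0) ((σ : UnitAddCircle), x) - maslovPrim hflow r z' -
        (kashiwara (A r) (stdVertical n) B' : ℝ) / 2 := by
    rw [IsLocallyConstant.iff_eventually_eq]
    intro r
    classical
    obtain ⟨l, hl, hc⟩ := exists_isLagrangian_isCompl {A r, stdVertical n, B'}
      (by simp [hAf.1 r, isLagrangian_stdVertical, hB'l])
    filter_upwards [h1 r l hl (hc _ (by simp)) (hc _ (by simp)),
      h2 r l hl (hc _ (by simp)) (hc _ (by simp))] with y e1 e2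
    have c1 := kashiwara_cocycle (hAf.1 y) isLagrangian_stdVertical hB'l hl
    have c2 := kashiwara_cocycle (hAf.1 r) isLagrangian_stdVertical hB'l hl
    have c1' : (kashiwara (A y) (stdVertical n) B' : ℝ) - kashiwara (A y) (stdVertical n) l =
      kashiwara (stdVertical n) B' l - kashiwara (A y) B' l := by exact_mod_cast c1
    have c2' : (kashiwara (A r) (stdVertical n) B' : ℝ) - kashiwara (A r) (stdVertical n) l =
      kashiwara (stdVertical n) B' l - kashiwara (A r) B' l := by exact_mod_cast c2
    linarith
  have key := hloc.apply_eq_of_preconnectedSpace r 0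
  simp only [max_eq_left hr, max_self, add_zero, maslovPrim_zero hflow hH] at key
  have b1 : |(kashiwara (A r) (stdVertical n) B' : ℝ)| ≤ 3 * n := by
    exact_mod_cast abs_kashiwara_le (hAf.1 r) isLagrangian_stdVertical hB'l
  have b2 : |(kashiwara (A 0) (stdVertical n) B' : ℝ)| ≤ 3 * n := by
    exact_mod_cast abs_kashiwara_le (hAf.1 0) isLagrangian_stdVertical hB'l
  rw [abs_le] at *
  constructor <;> linarith [b1.1, b1.2, b2.1, b2.2]

end MaslovFunction

/-! ### Regularity of `μ_t` on the extended phase space -/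

section ExtendedPhaseSpace

variable {n : ℕ} {M : Type*} [TopologicalSpace M] [ChartedSpace (EuclideanSpace ℝ (Fin n)) M]
  [IsManifold (𝓡 n) ∞ M] {H : ExtPhaseSpace n M → ℝ} (hflow : GeneratesGlobalFlow H)
  [T2Space M] (hH : IsSmoothHamiltonian H)

include hH

lemma continuous_extFlow (t : ℝ) : Continuous (extFlow hflow t) := by
  have hq : IsOpenQuotientMap (Prod.map (fun s : ℝ => (s : UnitAddCircle))
      (id : CotangentBundle n M → CotangentBundle n M)) :=
    QuotientAddGroup.isOpenQuotientMap_mk.prodMap .id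
  rw [← hq.continuous_comp_iff]
  have h1 : Continuous fun p : ℝ × CotangentBundle n M =>
      evolution hflow (p.1 : UnitAddCircle) t p.2 :=
    (continuous_evolution hflow hH).comp (continuous_const.prodMk continuous_id)
  have h2 : Continuous fun p : ℝ × CotangentBundle n M =>
      (p.1 : UnitAddCircle) + (t : UnitAddCircle) :=
    ((AddCircle.continuous_mk' 1).comp continuous_fst).add continuous_const
  exact h2.prodMk h1

lemma extFlow_add (s t : ℝ) (z : ExtPhaseSpace n M) :
    extFlow hflow (s + t) z = extFlow hflow t (extFlow hflow s z) := by
  obtain ⟨σ, x⟩ := z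
  obtain ⟨σ, rfl⟩ := QuotientAddGroup.mk_surjective σ
  refine Prod.ext ?_ ?_
  · change (σ : UnitAddCircle) + ((s + t : ℝ) : UnitAddCircle) = σ + (s : UnitAddCircle) + t
    rw [AddCircle.coe_add, add_assoc]
  · change evolution hflow (σ : UnitAddCircle) (s + t) x =
      evolution hflow ((σ : UnitAddCircle) + (s : UnitAddCircle)) t _
    rw [evolution_add hflow hH, AddCircle.coe_add]
    rfl

/-- In a chart, the function `maslovPrim` is a primitive jointly in time, initial time and initial
point. -/
lemma isPrimitiveAt_maslovPrim_chart (x₁ : CotangentBundle n M)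
    (p : ℝ × (ℝ × (extChartAt (cotangentModel n) x₁).source)) :
    IsPrimitiveAt
      (fun p : ℝ × (ℝ × (extChartAt (cotangentModel n) x₁).source) =>
        (pullVert hflow (p.2.1 : UnitAddCircle) (max p.1 0) p.2.2).map
          (chartDeriv x₁ p.2.2).toLinearMap)
      (fun _ => stdVertical n)
      (fun p => maslovPrim hflow p.1 ((p.2.1 : UnitAddCircle), p.2.2)) p := by
  have hA := (isLagFamily_pullVert hflow hH x₁).comp
    (f := fun p : ℝ × (ℝ × (extChartAt (cotangentModel n) x₁).source) => (max p.1 0, p.2))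
    (by fun_prop)
  refine isPrimitiveAt_prod hA (.const isLagrangian_stdVertical) (fun z t => ?_)
    (fun z => maslovPrim_zero hflow hH _) (fun z => ?_) p
  · have h := (isPrimitiveAt_maslovPrim hflow hH
      ((z.1 : UnitAddCircle), (z.2 : CotangentBundle n M)) t).map (isLagFamily_pullVert_max hflow hH _)
      (.const isLagrangian_stdVertical)
      (k := fun _ => chartDeriv x₁ z.2) continuous_const
      (fun _ => isSymplectic_chartDeriv z.2.2)
    refine h.congr .rfl (.of_forall fun r => ?_) 0 (.of_forall fun r => (add_zero _).symm)
    exact (map_stdVertical_chartDeriv z.2.2).symm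
  · simp only [max_self]
    rw [pullVert_zero, map_stdVertical_chartDeriv z.2.2]

lemma isLagFamily_pullVert_chart_max (x₁ : CotangentBundle n M) :
    IsLagFamily (fun p : ℝ × (ℝ × (extChartAt (cotangentModel n) x₁).source) =>
        (pullVert hflow (p.2.1 : UnitAddCircle) (max p.1 0) p.2.2).map
          (chartDeriv x₁ p.2.2).toLinearMap) :=
  (isLagFamily_pullVert hflow hH x₁).comp
    (f := fun p : ℝ × (ℝ × (extChartAt (cotangentModel n) x₁).source) => (max p.1 0, p.2))
    (by fun_prop)

/-- The function `maslovPrim hflow t` is continuous up to a bounded error. -/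
lemma eventually_abs_maslovPrim_sub_le (t : ℝ) (z : ExtPhaseSpace n M) :
    ∀ᶠ z' in 𝓝 z, |maslovPrim hflow t z' - maslovPrim hflow t z| ≤ 3 * n := by
  obtain ⟨σ, x⟩ := z
  obtain ⟨σ, rfl⟩ := QuotientAddGroup.mk_surjective σ
  set S := (extChartAt (cotangentModel n) x).source
  have hx : x ∈ S := mem_extChartAt_source x
  have hS : IsOpen S := isOpen_extChartAt_source x
  have ho : IsOpenMap (Prod.map (fun s : ℝ => (s : UnitAddCircle)) (Subtype.val : S → _)) :=
    QuotientAddGroup.isOpenQuotientMap_mk.isOpenMap.prodMap hS.isOpenMap_subtype_val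
  have h := (isPrimitiveAt_maslovPrim_chart hflow hH x (t, (σ, ⟨x, hx⟩))).eventually_abs_sub_le
    (isLagFamily_pullVert_chart_max hflow hH x).1 (fun _ => isLagrangian_stdVertical)
  have hc : ContinuousAt (fun q : ℝ × S => (t, q)) (σ, ⟨x, hx⟩) := by fun_prop
  exact ho.nhds_le (σ, ⟨x, hx⟩) (hc.eventually h)

lemma measurable_maslovPrim [CompactSpace M] [MeasurableSpace (ExtPhaseSpace n M)]
    [BorelSpace (ExtPhaseSpace n M)] :
    Measurable fun p : ℝ × ExtPhaseSpace n M => maslovPrim hflow p.1 p.2 := by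
  let _ : MeasurableSpace (CotangentBundle n M) := borel _
  have : BorelSpace (CotangentBundle n M) := ⟨rfl⟩
  -- joint measurability on the covering, where charts are available
  have key : Measurable fun p : ℝ × (ℝ × CotangentBundle n M) =>
      maslovPrim hflow p.1 ((p.2.1 : UnitAddCircle), p.2.2) := by
    obtain ⟨T, hT, hU⟩ := TopologicalSpace.isOpen_iUnion_countable
      (fun x : CotangentBundle n M => (extChartAt (cotangentModel n) x).source)
      (fun x => isOpen_extChartAt_source x)
    have hι : ∀ x : CotangentBundle n M, IsOpenEmbedding
        (fun p : ℝ × (ℝ × (extChartAt (cotangentModel n) x).source) =>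
          (p.1, (p.2.1, (p.2.2 : CotangentBundle n M)))) := fun x =>
      IsOpenEmbedding.id.prodMap
        (IsOpenEmbedding.id.prodMap (isOpen_extChartAt_source x).isOpenEmbedding_subtypeVal)
    intro B hB
    have e : (fun p : ℝ × (ℝ × CotangentBundle n M) =>
        maslovPrim hflow p.1 ((p.2.1 : UnitAddCircle), p.2.2)) ⁻¹' B =
        ⋃ x ∈ T, (fun p : ℝ × (ℝ × (extChartAt (cotangentModel n) x).source) =>
          (p.1, (p.2.1, (p.2.2 : CotangentBundle n M)))) ''
          ((fun p => maslovPrim hflow p.1 ((p.2.1 : UnitAddCircle), p.2.2)) ⁻¹' B) := by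
      ext ⟨t, s, x⟩
      simp only [mem_iUnion, mem_image, mem_preimage]
      constructor
      · intro h
        have hx : x ∈ ⋃ x ∈ T, (extChartAt (cotangentModel n) x).source := by
          rw [hU]
          exact mem_iUnion.2 ⟨x, mem_extChartAt_source x⟩
        simp only [mem_iUnion] at hx
        obtain ⟨x₁, h1, h2⟩ := hx
        exact ⟨x₁, h1, (t, (s, ⟨x, h2⟩)), h, rfl⟩
      · rintro ⟨x₁, -, ⟨t', s', y⟩, hy, e⟩
        simp only [Prod.mk.injEq] at e
        obtain ⟨rfl, rfl, rfl⟩ := e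
        exact hy
    rw [e]
    refine MeasurableSet.biUnion hT fun x _ => ?_
    refine (hι x).measurableEmbedding.measurableSet_image' ?_
    exact measurable_of_isPrimitiveAt (isLagFamily_pullVert_chart_max hflow hH x)
      (.const isLagrangian_stdVertical) (isPrimitiveAt_maslovPrim_chart hflow hH x) hB
  -- a measurable section of the covering brings it down to the extended phase space
  have hσ : Measurable fun z : ExtPhaseSpace n M =>
      (((AddCircle.measurableEquivIoc 1 0 z.1 : ℝ)), z.2) := by
    refine Measurable.prodMk ?_ continuous_snd.measurable
    exact measurable_subtype_coe.comp
      ((AddCircle.measurableEquivIoc 1 0).measurable.comp continuous_fst.measurable)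
  have h := key.comp (measurable_fst.prodMk (hσ.comp measurable_snd))
  have e : (fun p : ℝ × ExtPhaseSpace n M => maslovPrim hflow p.1 p.2) = fun p =>
      maslovPrim hflow p.1
        (((AddCircle.measurableEquivIoc 1 0 p.2.1 : ℝ) : UnitAddCircle), p.2.2) := by
    funext p
    rw [show ((AddCircle.measurableEquivIoc 1 0 p.2.1 : ℝ) : UnitAddCircle) = p.2.1 from
      AddCircle.coe_equivIoc]
  rw [e]
  exact h

end ExtendedPhaseSpace

/-! ### The pointwise ergodic theorem -/

section Birkhoff

variable {Ω : Type*} [mΩ : MeasurableSpace Ω] {ν : Measure Ω} {T : Ω → Ω}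

/-- The largest of the first `k + 1` nonempty Birkhoff sums of `X`, defined by recursion. -/
def maxBirkhoffSum (T : Ω → Ω) (X : Ω → ℝ) : ℕ → Ω → ℝ
  | 0 => X
  | k + 1 => fun z => X z + max 0 (maxBirkhoffSum T X k (T z))

omit mΩ in
lemma birkhoffSum_le_maxBirkhoffSum (X : Ω → ℝ) (k : ℕ) :
    ∀ z, birkhoffSum T X (k + 1) z ≤ maxBirkhoffSum T X k z := by
  induction k with
  | zero => intro z; simp [maxBirkhoffSum]
  | succ k ih =>
    intro z
    rw [birkhoffSum_succ']
    exact add_le_add le_rfl ((ih (T z)).trans (le_max_right _ _))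

omit mΩ in
lemma maxBirkhoffSum_le_succ (X : Ω → ℝ) (k : ℕ) :
    ∀ z, maxBirkhoffSum T X k z ≤ maxBirkhoffSum T X (k + 1) z := by
  induction k with
  | zero => intro z; simp [maxBirkhoffSum]
  | succ k ih =>
    intro z
    exact add_le_add le_rfl (max_le_max le_rfl (ih (T z)))

lemma measurable_maxBirkhoffSum (hT : Measurable T) {X : Ω → ℝ} (hX : Measurable X) (k : ℕ) :
    Measurable (maxBirkhoffSum T X k) := by
  induction k with
  | zero => exact hX
  | succ k ih => exact hX.add (measurable_const.max (ih.comp hT))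

lemma integrable_maxBirkhoffSum (hT : MeasurePreserving T ν ν) {X : Ω → ℝ} (hX : Integrable X ν)
    (k : ℕ) : Integrable (maxBirkhoffSum T X k) ν := by
  induction k with
  | zero => exact hX
  | succ k ih =>
    exact hX.add ((integrable_zero _ _ _).sup (hT.integrable_comp_of_integrable ih))

omit mΩ in
lemma bddAbove_maxBirkhoffSum_comp_iff (X : Ω → ℝ) (z : Ω) :
    BddAbove (range fun k => maxBirkhoffSum T X k (T z)) ↔
      BddAbove (range fun k => maxBirkhoffSum T X k z) := by
  constructor
  · rintro ⟨C, hC⟩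
    have hC' : ∀ k, maxBirkhoffSum T X k (T z) ≤ C := fun k => hC ⟨k, rfl⟩
    refine ⟨X z + max 0 C, ?_⟩
    rintro _ ⟨k, rfl⟩
    refine (maxBirkhoffSum_le_succ X k z).trans ?_
    exact add_le_add le_rfl (max_le_max le_rfl (hC' k))
  · rintro ⟨C, hC⟩
    have hC' : ∀ k, maxBirkhoffSum T X k z ≤ C := fun k => hC ⟨k, rfl⟩
    refine ⟨C - X z, ?_⟩
    rintro _ ⟨k, rfl⟩
    have h : X z + max 0 (maxBirkhoffSum T X k (T z)) ≤ C := hC' (k + 1)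
    have := le_max_right 0 (maxBirkhoffSum T X k (T z))
    simp only
    linarith

/-- A maximal ergodic theorem: the integral of `X` over the invariant set where its Birkhoff sums
are unbounded from above is nonnegative. -/
lemma setIntegral_unbounded_birkhoffSum_nonneg (hT : MeasurePreserving T ν ν) {X : Ω → ℝ}
    (hXm : Measurable X) (hX : Integrable X ν) :
    0 ≤ ∫ z in {z | ¬ BddAbove (range fun k => maxBirkhoffSum T X k z)}, X z ∂ν := by
  set A := {z | ¬ BddAbove (range fun k => maxBirkhoffSum T X k z)} with hA
  have hAm : MeasurableSet A :=
    (measurableSet_bddAbove_range fun k => measurable_maxBirkhoffSum hT.measurable hXm k).compl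
  have hAT : T ⁻¹' A = A := by
    ext z
    exact not_congr (bddAbove_maxBirkhoffSum_comp_iff X z)
  have hTA : MeasurePreserving T (ν.restrict A) (ν.restrict A) := by
    have := hT.restrict_preimage hAm
    rwa [hAT] at this
  have hI := fun k => (integrable_maxBirkhoffSum hT hX k).restrict (s := A)
  have hIT := fun k => hTA.integrable_comp_of_integrable (hI k)
  -- the integrand converges to `X` on the set `A`
  have hnn : ∀ k, 0 ≤ ∫ z in A, (maxBirkhoffSum T X (k + 1) z - maxBirkhoffSum T X k (T z)) ∂ν := by
    intro k
    have e : ∫ z in A, maxBirkhoffSum T X k (T z) ∂ν = ∫ z in A, maxBirkhoffSum T X k z ∂ν := by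
      have h := integral_map (μ := ν.restrict A) hTA.measurable.aemeasurable
        (f := maxBirkhoffSum T X k) (by rw [hTA.map_eq]; exact (hI k).1)
      rw [hTA.map_eq] at h
      exact h.symm
    have e' : ∫ z in A, (maxBirkhoffSum T X (k + 1) z - maxBirkhoffSum T X k (T z)) ∂ν =
        ∫ z in A, maxBirkhoffSum T X (k + 1) z ∂ν - ∫ z in A, maxBirkhoffSum T X k (T z) ∂ν :=
      integral_sub (hI (k + 1)) (hIT k)
    rw [e', e, sub_nonneg]
    exact integral_mono (hI k) (hI (k + 1)) (maxBirkhoffSum_le_succ X k)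
  have hmono : ∀ z, Monotone fun k => maxBirkhoffSum T X k z := fun z =>
    monotone_nat_of_le_succ fun k => maxBirkhoffSum_le_succ X k z
  have hlim : Tendsto (fun k =>
      ∫ z in A, (maxBirkhoffSum T X (k + 1) z - maxBirkhoffSum T X k (T z)) ∂ν) atTop
      (𝓝 (∫ z in A, X z ∂ν)) := by
    refine tendsto_integral_of_dominated_convergence (fun z => |X z| + |X (T z)|)
      (fun k => ((hI (k + 1)).sub (hIT k)).1)
      (hX.restrict.abs.add (hT.integrable_comp_of_integrable hX).restrict.abs) (fun k => ?_) ?_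
    · refine .of_forall fun z => ?_
      have h0 : X (T z) ≤ maxBirkhoffSum T X k (T z) := hmono (T z) (Nat.zero_le k)
      have h1 : maxBirkhoffSum T X (k + 1) z = X z + max 0 (maxBirkhoffSum T X k (T z)) := rfl
      rw [h1, Real.norm_eq_abs]
      have h2 := neg_abs_le (X (T z))
      have h3 := neg_abs_le (X z)
      have h4 := le_abs_self (X z)
      have h5 := abs_nonneg (X (T z))
      rcases le_total 0 (maxBirkhoffSum T X k (T z)) with h | h
      · rw [max_eq_right h, abs_le]
        constructor <;> linarith
      · rw [max_eq_left h, abs_le]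
        constructor <;> linarith
    · filter_upwards [ae_restrict_mem hAm] with z hz
      rw [← hAT] at hz
      have hz' : ¬ BddAbove (range fun k => maxBirkhoffSum T X k (T z)) := hz
      have ht := tendsto_atTop_atTop_of_monotone (hmono (T z)) fun b => by
        by_contra! hb
        exact hz' ⟨b, by rintro _ ⟨k, rfl⟩; exact (hb k).le⟩
      refine tendsto_const_nhds.congr' ?_
      filter_upwards [ht.eventually_ge_atTop 0] with k hk
      have h1 : maxBirkhoffSum T X (k + 1) z = X z + max 0 (maxBirkhoffSum T X k (T z)) := rfl
      rw [h1, max_eq_right hk]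
      ring
  exact ge_of_tendsto' hlim hnn

variable [IsProbabilityMeasure ν]

/-- The upper half of the pointwise ergodic theorem. -/
lemma ae_eventually_birkhoffAverage_le (hT : MeasurePreserving T ν ν) {f : Ω → ℝ}
    (hfm : Measurable f) (hf : Integrable f ν) {ε : ℝ} (hε : 0 < ε) :
    ∀ᵐ z ∂ν, ∀ᶠ k : ℕ in atTop, birkhoffAverage ℝ T f k z ≤
      (ν[f | MeasurableSpace.invariants T]) z + 2 * ε := by
  set E := ν[f | MeasurableSpace.invariants T] with hE
  have hle := MeasurableSpace.invariants_le T
  have hEm' : Measurable[MeasurableSpace.invariants T] E := stronglyMeasurable_condExp.measurable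
  have hEm : Measurable E := hEm'.mono hle le_rfl
  have hET : E ∘ T = E := MeasurableSpace.comp_eq_of_measurable_invariants hEm'
  set X : Ω → ℝ := fun z => f z - E z - ε with hX
  have hXm : Measurable X := (hfm.sub hEm).sub_const ε
  have hXi : Integrable X ν := (hf.sub integrable_condExp).sub (integrable_const ε)
  set A := {z | ¬ BddAbove (range fun k => maxBirkhoffSum T X k z)} with hA
  have hAm : MeasurableSet A :=
    (measurableSet_bddAbove_range fun k => measurable_maxBirkhoffSum hT.measurable hXm k).compl
  have hAT : T ⁻¹' A = A := by
    ext z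
    exact not_congr (bddAbove_maxBirkhoffSum_comp_iff X z)
  have h0 := setIntegral_unbounded_birkhoffSum_nonneg hT hXm hXi
  have hint : ∫ z in A, X z ∂ν = -(ε * ν.real A) := by
    have e1 : ∫ z in A, E z ∂ν = ∫ z in A, f z ∂ν :=
      setIntegral_condExp hle hf (MeasurableSpace.measurableSet_invariants.2 ⟨hAm, hAT⟩)
    have e2 : ∫ z in A, X z ∂ν = ∫ z in A, (f z - E z) ∂ν - ∫ z in A, ε ∂ν :=
      integral_sub (hf.sub integrable_condExp).restrict (integrable_const ε)
    rw [e2, integral_sub hf.restrict integrable_condExp.restrict, e1, setIntegral_const]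
    simp [mul_comm]
  have hA0 : ν A = 0 := by
    have h1 : ν.real A = 0 := by
      have h2 := measureReal_nonneg (μ := ν) (s := A)
      rw [hint] at h0
      nlinarith
    rwa [measureReal_eq_zero_iff] at h1
  have hae : ∀ᵐ z ∂ν, z ∉ A := measure_eq_zero_iff_ae_notMem.1 hA0
  filter_upwards [hae] with z hz
  obtain ⟨C, hC⟩ := not_not.1 hz
  have hC' : ∀ k, birkhoffSum T X (k + 1) z ≤ C := fun k =>
    (birkhoffSum_le_maxBirkhoffSum X k z).trans (hC ⟨k, rfl⟩)
  have hsum : ∀ k : ℕ, birkhoffSum T X k z = birkhoffSum T f k z - k * (E z + ε) := by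
    intro k
    have e : ∀ i, X (T^[i] z) = f (T^[i] z) - (E z + ε) := by
      intro i
      have : E (T^[i] z) = E z := by
        induction i with
        | zero => rfl
        | succ i ih =>
          rw [Function.iterate_succ_apply', ← ih]
          exact congrFun hET _
      simp only [hX, this]
      ring
    simp only [birkhoffSum, e, Finset.sum_sub_distrib, Finset.sum_const, Finset.card_range,
      nsmul_eq_mul]
  have hlim : Tendsto (fun k : ℕ => C / (k : ℝ)) atTop (𝓝 0) :=
    tendsto_const_nhds.div_atTop tendsto_natCast_atTop_atTop
  filter_upwards [hlim.eventually_le_const hε, eventually_ge_atTop 1] with k hk hk1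
  obtain ⟨j, rfl⟩ := Nat.exists_eq_add_of_le' hk1
  have h1 := hC' j
  rw [hsum] at h1
  have hpos : (0 : ℝ) < ((j + 1 : ℕ) : ℝ) := by positivity
  rw [birkhoffAverage, smul_eq_mul, inv_mul_le_iff₀ hpos]
  rw [div_le_iff₀ hpos] at hk
  linarith

/-- Birkhoff's ergodic theorem. -/
theorem ae_tendsto_birkhoffAverage (hT : MeasurePreserving T ν ν) {f : Ω → ℝ}
    (hfm : Measurable f) (hf : Integrable f ν) :
    ∀ᵐ z ∂ν, Tendsto (fun k : ℕ => birkhoffAverage ℝ T f k z) atTop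
      (𝓝 ((ν[f | MeasurableSpace.invariants T]) z)) := by
  have hpos : ∀ m : ℕ, (0 : ℝ) < 1 / ((m : ℝ) + 1) := fun m => by positivity
  have h1 := ae_all_iff.2 fun m : ℕ => ae_eventually_birkhoffAverage_le hT hfm hf (hpos m)
  have h2 := ae_all_iff.2 fun m : ℕ => ae_eventually_birkhoffAverage_le hT hfm.neg hf.neg (hpos m)
  filter_upwards [h1, h2, condExp_neg f (MeasurableSpace.invariants T) (μ := ν)] with z u1 u2 u3
  rw [tendsto_order]
  constructor
  · intro a ha
    obtain ⟨m, hm⟩ := exists_nat_one_div_lt (half_pos (sub_pos.2 ha))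
    filter_upwards [u2 m] with k hk
    rw [birkhoffAverage_neg, u3] at hk
    simp only [Pi.neg_apply] at hk
    linarith
  · intro a ha
    obtain ⟨m, hm⟩ := exists_nat_one_div_lt (half_pos (sub_pos.2 ha))
    filter_upwards [u1 m] with k hk
    linarith

end Birkhoff

/-! ### Cocycles up to a bounded error -/

section QuasiCocycle

/-- The values of `a` near the multiples of `N` are approximated by the sums `S`, up to an error `C`
per block and a remainder `R` of lower order. -/
lemma eventually_abs_div_sub_le {a S R : ℕ → ℝ} {N : ℕ} (hN : 1 ≤ N) {b C : ℝ}
    (h : ∀ q r, r < N → |a (N * q + r) - S q| ≤ ((q : ℝ) + 2) * C + R q)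
    (hS : Tendsto (fun q : ℕ => S q / (q : ℝ)) atTop (𝓝 b))
    (hR : Tendsto (fun q : ℕ => R q / (q : ℝ)) atTop (𝓝 0)) :
    ∀ᶠ m : ℕ in atTop, |a m / (m : ℝ) - b / (N : ℝ)| ≤ (C + 1) / (N : ℝ) := by
  have hNpos : (0 : ℝ) < N := by exact_mod_cast hN
  have hq : Tendsto (fun m : ℕ => m / N) atTop atTop :=
    tendsto_atTop_atTop.2 fun k => ⟨k * N, fun m hm => (Nat.le_div_iff_mul_le hN).2 hm⟩
  have hρ : Tendsto (fun m : ℕ => ((m / N : ℕ) : ℝ) / (m : ℝ)) atTop (𝓝 (1 / N)) := by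
    have := (tendsto_nat_floor_mul_div_atTop (R := ℝ) (a := 1 / (N : ℝ)) (by positivity)).comp
      tendsto_natCast_atTop_atTop
    refine this.congr fun m => ?_
    simp only [Function.comp_apply]
    rw [one_div_mul_eq_div, Nat.floor_div_eq_div]
  have hu : Tendsto (fun m : ℕ => |S (m / N) / ((m / N : ℕ) : ℝ) * (((m / N : ℕ) : ℝ) / (m : ℝ))
        - b / N| + C * (((m / N : ℕ) : ℝ) / (m : ℝ)) + (2 * C) / (m : ℝ) +
        R (m / N) / ((m / N : ℕ) : ℝ) * (((m / N : ℕ) : ℝ) / (m : ℝ))) atTop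
      (𝓝 (|b * (1 / N) - b / N| + C * (1 / N) + 0 + 0 * (1 / N))) :=
    (((((hS.comp hq).mul hρ).sub_const _).abs.add (hρ.const_mul C)).add
      (tendsto_const_nhds.div_atTop tendsto_natCast_atTop_atTop)).add ((hR.comp hq).mul hρ)
  have hlt : |b * (1 / N) - b / N| + C * (1 / N) + 0 + 0 * (1 / N) < (C + 1) / (N : ℝ) := by
    rw [mul_one_div, sub_self, abs_zero, zero_mul, mul_one_div, add_zero, add_zero, zero_add]
    exact div_lt_div_of_pos_right (by linarith) hNpos
  filter_upwards [hu.eventually_lt_const hlt, eventually_ge_atTop N] with m hm hmN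
  refine le_trans ?_ hm.le
  have hm0 : (0 : ℝ) < m := by exact_mod_cast lt_of_lt_of_le hN hmN
  have hq1 : 1 ≤ m / N := (Nat.le_div_iff_mul_le hN).2 (by simpa using hmN)
  have hq0 : (((m / N : ℕ) : ℝ)) ≠ 0 := by exact_mod_cast (Nat.pos_of_ne_zero (by omega)).ne'
  have hm' := h (m / N) (m % N) (Nat.mod_lt _ hN)
  rw [Nat.div_add_mod] at hm'
  rw [div_mul_div_cancel₀ hq0, div_mul_div_cancel₀ hq0]
  have e : a m / m - b / N = (S (m / N) / m - b / N) + (a m - S (m / N)) / m := by ring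
  rw [e]
  refine (abs_add_le _ _).trans ?_
  rw [add_assoc, add_assoc]
  refine add_le_add le_rfl ?_
  rw [abs_div, abs_of_pos hm0, div_le_iff₀ hm0]
  refine hm'.trans (le_of_eq ?_)
  field_simp
  ring

variable {Ω : Type*} [MeasurableSpace Ω] {ν : Measure Ω} [IsProbabilityMeasure ν] {T : Ω → Ω}
  {a : ℕ → Ω → ℝ} {C : ℝ}

omit [MeasurableSpace Ω] in
lemma abs_sub_birkhoffSum_le (hC : ∀ k m z, |a (k + m) z - a k z - a m (T^[k] z)| ≤ C) (N q : ℕ)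
    (z : Ω) : |a (N * q) z - birkhoffSum T^[N] (a N) q z| ≤ ((q : ℝ) + 1) * C := by
  induction q with
  | zero =>
    have := hC 0 0 z
    simpa using this
  | succ q ih =>
    have h := hC (N * q) N z
    rw [birkhoffSum_succ, ← Function.iterate_mul, Nat.mul_succ]
    push_cast
    rw [abs_le] at *
    constructor <;> linarith [h.1, h.2, ih.1, ih.2]

omit [MeasurableSpace Ω] in
lemma tendsto_apply_iterate_div {f : Ω → ℝ} {z : Ω} {L : ℝ}
    (h : Tendsto (fun k : ℕ => birkhoffAverage ℝ T f k z) atTop (𝓝 L)) :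
    Tendsto (fun k : ℕ => f (T^[k] z) / (k : ℝ)) atTop (𝓝 0) := by
  have h1 : Tendsto (fun k : ℕ => ((k + 1 : ℕ) : ℝ) / (k : ℝ)) atTop (𝓝 1) := by
    have := (tendsto_inv_atTop_nhds_zero_nat (𝕜 := ℝ)).const_add 1
    rw [add_zero] at this
    refine this.congr' ?_
    filter_upwards [eventually_ge_atTop 1] with k hk
    have : (k : ℝ) ≠ 0 := by positivity
    push_cast
    field_simp
  have h2 := ((h.comp (tendsto_add_atTop_nat 1)).mul h1).sub h
  rw [mul_one, sub_self] at h2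
  refine h2.congr' ?_
  filter_upwards [eventually_ge_atTop 1] with k hk
  have hk0 : (k : ℝ) ≠ 0 := by positivity
  have hk1 : ((k : ℝ) + 1) ≠ 0 := by positivity
  simp only [Function.comp_apply, birkhoffAverage, smul_eq_mul, birkhoffSum_succ]
  push_cast
  field_simp
  ring

/-- The means of a quasi-cocycle are eventually close to the ergodic limit of the means of one of
its terms. -/
lemma ae_eventually_quasiCocycle (hT : MeasurePreserving T ν ν) (ham : ∀ k, Measurable (a k))
    (hai : ∀ k, Integrable (a k) ν) (hC : ∀ k m z, |a (k + m) z - a k z - a m (T^[k] z)| ≤ C)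
    {N : ℕ} (hN : 1 ≤ N) :
    ∀ᵐ z ∂ν, ∀ᶠ m : ℕ in atTop, |a m z / (m : ℝ) -
      (ν[a N | MeasurableSpace.invariants T^[N]]) z / (N : ℝ)| ≤ (C + 1) / (N : ℝ) := by
  set G : Ω → ℝ := fun z => ∑ r ∈ Finset.range N, |a r z| with hG
  have hGm : Measurable G := Finset.measurable_sum _ fun r _ => (ham r).abs
  have hGi : Integrable G ν := integrable_finsetSum _ fun r _ => (hai r).abs
  filter_upwards [ae_tendsto_birkhoffAverage (hT.iterate N) (ham N) (hai N),
    ae_tendsto_birkhoffAverage (hT.iterate N) hGm hGi] with z h1 h2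
  refine eventually_abs_div_sub_le hN (S := fun q => birkhoffSum T^[N] (a N) q z)
    (R := fun q => G ((T^[N])^[q] z)) (fun q r hr => ?_) (h1.congr fun q => ?_)
    (tendsto_apply_iterate_div h2)
  · have e1 := abs_sub_birkhoffSum_le hC N q z
    have e2 := hC (N * q) r z
    have e3 : |a r (T^[N * q] z)| ≤ G ((T^[N])^[q] z) := by
      rw [← Function.iterate_mul]
      exact Finset.single_le_sum (f := fun r => |a r (T^[N * q] z)|) (fun _ _ => abs_nonneg _)
        (Finset.mem_range.2 hr)
    rw [abs_le] at *
    constructor <;> linarith [e1.1, e1.2, e2.1, e2.2, e3.1, e3.2]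
  · rw [birkhoffAverage, smul_eq_mul, inv_mul_eq_div]

/-- An integrable quasi-cocycle has almost everywhere a linear growth rate, which is integrable,
and its integrals grow linearly up to a bounded error. -/
theorem quasiCocycle_growth (hT : MeasurePreserving T ν ν) (ham : ∀ k, Measurable (a k))
    (hai : ∀ k, Integrable (a k) ν) (hC : ∀ k m z, |a (k + m) z - a k z - a m (T^[k] z)| ≤ C) :
    (∀ᵐ z ∂ν, Tendsto (fun k : ℕ => a k z / (k : ℝ)) atTop
      (𝓝 (limUnder atTop fun k : ℕ => a k z / (k : ℝ)))) ∧
    Integrable (fun z => limUnder atTop fun k : ℕ => a k z / (k : ℝ)) ν ∧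
    ∀ N : ℕ, 1 ≤ N →
      |∫ z, a N z ∂ν - N * ∫ z, (limUnder atTop fun k : ℕ => a k z / (k : ℝ)) ∂ν| ≤ C + 1 := by
  set g : Ω → ℝ := fun z => limUnder atTop fun k : ℕ => a k z / (k : ℝ) with hg
  have hall : ∀ᵐ z ∂ν, ∀ N : ℕ, 1 ≤ N → ∀ᶠ m : ℕ in atTop, |a m z / (m : ℝ) -
      (ν[a N | MeasurableSpace.invariants T^[N]]) z / (N : ℝ)| ≤ (C + 1) / (N : ℝ) :=
    ae_all_iff.2 fun N => by
      by_cases hN : 1 ≤ N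
      · filter_upwards [ae_eventually_quasiCocycle hT ham hai hC hN] with z hz _ using hz
      · exact .of_forall fun z h => absurd h hN
  have hlim : ∀ᵐ z ∂ν, Tendsto (fun k : ℕ => a k z / (k : ℝ)) atTop (𝓝 (g z)) := by
    filter_upwards [hall] with z hz
    refine tendsto_nhds_limUnder (cauchySeq_tendsto_of_complete ?_)
    rw [Metric.cauchySeq_iff']
    intro ε hε
    obtain ⟨N, hN⟩ := exists_nat_gt (2 * (C + 1) / ε)
    obtain ⟨m₀, hm₀⟩ := eventually_atTop.1 (hz (N + 1) (by omega))
    have hpos : (0 : ℝ) < ((N + 1 : ℕ) : ℝ) := by positivity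
    have hlt : 2 * ((C + 1) / ((N + 1 : ℕ) : ℝ)) < ε := by
      rw [div_lt_iff₀ hε] at hN
      rw [← mul_div_assoc, div_lt_iff₀ hpos]
      push_cast
      nlinarith
    refine ⟨m₀, fun m hm => ?_⟩
    have e1 := hm₀ m hm
    have e2 := hm₀ m₀ le_rfl
    rw [Real.dist_eq]
    refine lt_of_le_of_lt ?_ hlt
    rw [abs_le] at *
    constructor <;> linarith [e1.1, e1.2, e2.1, e2.2]
  have hclose : ∀ N : ℕ, 1 ≤ N → ∀ᵐ z ∂ν,
      ‖g z - (ν[a N | MeasurableSpace.invariants T^[N]]) z / (N : ℝ)‖ ≤ (C + 1) / (N : ℝ) := by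
    intro N hN
    filter_upwards [hall, hlim] with z h1 h2
    exact le_of_tendsto (h2.sub_const _).norm (h1 N hN)
  have hgm : AEStronglyMeasurable g ν := aestronglyMeasurable_of_tendsto_ae atTop
    (fun k => ((hai k).div_const _).1) hlim
  have hbi : ∀ N : ℕ, Integrable
      (fun z => (ν[a N | MeasurableSpace.invariants T^[N]]) z / (N : ℝ)) ν :=
    fun N => integrable_condExp.div_const _
  have hgi : Integrable g ν := by
    have h := Integrable.of_bound (hgm.sub (hbi 1).1) _ (hclose 1 le_rfl)
    refine (h.add (hbi 1)).congr (.of_forall fun z => ?_)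
    simp
  refine ⟨hlim, hgi, fun N hN => ?_⟩
  have hpos : (0 : ℝ) < N := by exact_mod_cast hN
  have h := norm_integral_le_of_norm_le_const (hclose N hN)
  rw [integral_sub hgi (hbi N), integral_div, integral_condExp (MeasurableSpace.invariants_le _),
    probReal_univ, mul_one, Real.norm_eq_abs, le_div_iff₀ hpos, ← abs_of_pos hpos, ← abs_mul,
    abs_of_pos hpos] at h
  rw [abs_sub_comm]
  refine le_of_eq_of_le (congrArg _ ?_) h
  field_simp

/-- A measurable quasi-additive function is bounded on `[0, 1]`. -/
lemma exists_bound_of_quasiAdditive {α : ℝ → ℝ} (hm : Measurable α)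
    (hC : ∀ s t, 0 ≤ s → 0 ≤ t → |α (s + t) - α s - α t| ≤ C) :
    ∃ B, ∀ t ∈ Icc (0 : ℝ) 1, |α t| ≤ B := by
  set E : ℕ → Set ℝ := fun K => {s | s ∈ Icc (0 : ℝ) 2 ∧ (K : ℝ) < |α s|} with hE
  have hEm : ∀ K, MeasurableSet (E K) := fun K =>
    measurableSet_Icc.inter (measurableSet_lt measurable_const hm.abs)
  -- the set where `|α|` is large has small measure
  have hlim : Tendsto (fun K => volume (E K)) atTop (𝓝 0) := by
    have h := tendsto_measure_iInter_atTop (μ := volume) (fun K => (hEm K).nullMeasurableSet)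
      (fun i j hij s hs => ⟨hs.1, lt_of_le_of_lt (by exact_mod_cast hij) hs.2⟩)
      ⟨0, ((measure_mono fun s hs => hs.1).trans_lt (measure_Icc_lt_top (a := (0 : ℝ))
        (b := 2))).ne⟩
    have e : ⋂ K, E K = ∅ := by
      refine eq_empty_of_forall_notMem fun s hs => ?_
      obtain ⟨K, hK⟩ := exists_nat_ge |α s|
      exact absurd (mem_iInter.1 hs K).2 (not_lt.2 hK)
    rwa [e, measure_empty] at h
  obtain ⟨K, hK⟩ := (hlim.eventually_lt_const (show (0 : ℝ≥0∞) < 1 / 2 by norm_num)).exists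
  refine ⟨2 * K + C, fun t ht => ?_⟩
  -- hence some `x` lies with `x + t` in the complement of that set
  obtain ⟨x, hx, h1, h2⟩ : ∃ x ∈ Icc (0 : ℝ) 1, x ∉ E K ∧ x + t ∉ E K := by
    by_contra! hcon
    have hsub : Icc (0 : ℝ) 1 ⊆ E K ∪ (fun x => x + t) ⁻¹' E K := fun x hx => by
      by_cases h : x ∈ E K
      · exact Or.inl h
      · exact Or.inr (hcon x hx h)
    have h3 := (measure_mono (μ := volume) hsub).trans (measure_union_le _ _)
    rw [measure_preimage_add_right, Real.volume_Icc] at h3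
    have h4 : volume (E K) + volume (E K) < 1 / 2 + 1 / 2 := ENNReal.add_lt_add hK hK
    rw [ENNReal.add_halves] at h4
    simp only [sub_zero, ENNReal.ofReal_one] at h3
    exact absurd h3 (not_le.2 h4)
  have g1 : |α x| ≤ K := by
    by_contra! h
    exact h1 ⟨⟨hx.1, by linarith [hx.2]⟩, h⟩
  have g2 : |α (x + t)| ≤ K := by
    by_contra! h
    exact h2 ⟨⟨by linarith [hx.1, ht.1], by linarith [hx.2, ht.2]⟩, h⟩
  have g3 := hC x t hx.1 ht.1
  rw [abs_le] at *
  constructor <;> linarith [g1.1, g1.2, g2.1, g2.2, g3.1, g3.2]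

/-- The growth rate of a measurable quasi-additive function along the integers is its growth rate
along the reals. -/
lemma tendsto_div_of_quasiAdditive {α : ℝ → ℝ} (hm : Measurable α)
    (hC : ∀ s t, 0 ≤ s → 0 ≤ t → |α (s + t) - α s - α t| ≤ C) {G C' : ℝ}
    (hG : ∀ N : ℕ, 1 ≤ N → |α N - N * G| ≤ C') :
    Tendsto (fun t : ℝ => 1 / t * α t) atTop (𝓝 G) := by
  obtain ⟨B, hB⟩ := exists_bound_of_quasiAdditive hm hC
  have hlim : Tendsto (fun t : ℝ => (C + C' + B + |G|) / t) atTop (𝓝 0) :=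
    tendsto_const_nhds.div_atTop tendsto_id
  rw [tendsto_iff_norm_sub_tendsto_zero]
  refine squeeze_zero' (.of_forall fun _ => norm_nonneg _) ?_ hlim
  filter_upwards [eventually_ge_atTop 1] with t ht
  have hpos : 0 < t := by linarith
  have hk : 1 ≤ ⌊t⌋₊ := Nat.le_floor (by simpa using ht)
  have hf1 := Nat.floor_le hpos.le
  have hf2 := Nat.lt_floor_add_one t
  have g1 := hG _ hk
  have g2 := hB (t - ⌊t⌋₊) ⟨by linarith, by linarith⟩
  have g3 := hC ⌊t⌋₊ (t - ⌊t⌋₊) (by positivity) (by linarith)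
  rw [add_sub_cancel] at g3
  have g4 : |(t - ⌊t⌋₊) * G| ≤ |G| := by
    rw [abs_mul, abs_of_nonneg (by linarith : (0 : ℝ) ≤ t - ⌊t⌋₊)]
    exact mul_le_of_le_one_left (abs_nonneg G) (by linarith)
  have e : 1 / t * α t - G = (α t - t * G) / t := by field_simp
  rw [e, Real.norm_eq_abs, abs_div, abs_of_pos hpos]
  refine div_le_div_of_nonneg_right ?_ hpos.le
  have e' : (t - ⌊t⌋₊) * G = t * G - ⌊t⌋₊ * G := by ring
  rw [e'] at g4
  have g5 : |α t - t * G| = |(α t - α ⌊t⌋₊ - α (t - ⌊t⌋₊)) + (α ⌊t⌋₊ - ⌊t⌋₊ * G) +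
      α (t - ⌊t⌋₊) - (t * G - ⌊t⌋₊ * G)| := by
    congr 1
    ring
  rw [g5]
  refine (abs_sub _ _).trans (add_le_add ?_ g4)
  exact (abs_add_three _ _ _).trans (add_le_add (add_le_add g3 g1) g2)

end QuasiCocycle

/-! ### Narrow limits and uniform integrability -/

section Narrow

variable {Ω : Type*} [MeasurableSpace Ω]

/-- A bound on the integral of `(|g| - K)⁺` controls the error made in truncating `g` at `±K`. -/
lemma integrable_and_abs_integral_sub_truncation_le {ν : Measure Ω} [IsProbabilityMeasure ν]
    {g : Ω → ℝ} (hg : Measurable g) {K ε : ℝ} (hK : 0 ≤ K) (hε : 0 ≤ ε)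
    (h : ∫⁻ z, ENNReal.ofReal (max (|g z| - K) 0) ∂ν ≤ ENNReal.ofReal ε) :
    Integrable g ν ∧ |∫ z, g z ∂ν - ∫ z, max (-K) (min K (g z)) ∂ν| ≤ ε := by
  have htm : Measurable fun z => max (|g z| - K) 0 := (hg.abs.sub_const K).max measurable_const
  have htn : ∀ z, 0 ≤ max (|g z| - K) 0 := fun z => le_max_right _ _
  have hti : Integrable (fun z => max (|g z| - K) 0) ν := by
    refine ⟨htm.aestronglyMeasurable, ?_⟩
    rw [hasFiniteIntegral_iff_ofReal (.of_forall htn)]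
    exact h.trans_lt ENNReal.ofReal_lt_top
  have htr : ∫ z, max (|g z| - K) 0 ∂ν ≤ ε := by
    rw [integral_eq_lintegral_of_nonneg_ae (.of_forall htn) htm.aestronglyMeasurable]
    exact ENNReal.toReal_le_of_le_ofReal hε h
  have hgi : Integrable g ν := by
    refine (hti.add (integrable_const K)).mono' hg.aestronglyMeasurable (.of_forall fun z => ?_)
    have := le_max_left (|g z| - K) 0
    simp only [Pi.add_apply, Real.norm_eq_abs]
    linarith
  have hci : Integrable (fun z => max (-K) (min K (g z))) ν :=
    (integrable_const _).sup ((integrable_const _).inf hgi)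
  refine ⟨hgi, ?_⟩
  rw [← integral_sub hgi hci]
  refine (abs_integral_le_integral_abs).trans ((integral_mono (hgi.sub hci).abs hti ?_).trans htr)
  intro z
  change |g z - max (-K) (min K (g z))| ≤ max (|g z| - K) 0
  rcases le_total (g z) K with h1 | h1
  · rw [min_eq_right h1]
    rcases le_total (-K) (g z) with h2 | h2
    · rw [max_eq_right h2, sub_self, abs_zero]
      exact htn z
    · rw [max_eq_left h2]
      refine le_trans ?_ (le_max_left _ _)
      rw [abs_of_nonpos (by linarith), abs_of_nonpos (by linarith)]
      linarith
  · rw [min_eq_left h1, max_eq_right (by linarith)]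
    refine le_trans ?_ (le_max_left _ _)
    rw [abs_of_nonneg (by linarith), abs_of_nonneg (by linarith)]

/-- Uniform integrability of `h` gives uniformly small tails for a function `g` at bounded distance
from `h`. -/
lemma exists_tail_le {η : ℕ → Measure Ω} {h g : Ω → ℝ} (hm : Measurable h) {C : ℝ}
    (hC : 0 ≤ C) (hg : ∀ z, |g z - h z| ≤ C) (hui : UnifIntegrableWrt h η) {ε : ℝ} (hε : 0 < ε) :
    ∃ K, 0 ≤ K ∧ ∀ j, ∫⁻ z, ENNReal.ofReal (max (|g z| - K) 0) ∂(η j) ≤ ENNReal.ofReal ε := by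
  obtain ⟨c, hc, hc0⟩ := ((hui.eventually_lt_const (ENNReal.ofReal_pos.2 hε)).and
    (eventually_ge_atTop 0)).exists
  refine ⟨c + C, by linarith, fun j => ?_⟩
  refine le_trans ?_ ((le_iSup (fun j => ∫⁻ z in {z | c ≤ |h z|}, ENNReal.ofReal |h z| ∂(η j))
    j).trans hc.le)
  rw [← lintegral_indicator (measurableSet_le measurable_const hm.abs)]
  refine lintegral_mono fun z => ?_
  have h1 := hg z
  have h2 : |g z| ≤ |h z| + C := by
    have := abs_sub_abs_le_abs_sub (g z) (h z)
    linarith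
  by_cases hz : c ≤ |h z|
  · rw [indicator_of_mem (by exact hz)]
    exact ENNReal.ofReal_le_ofReal (max_le (by linarith) (abs_nonneg _))
  · rw [max_eq_right (by linarith [not_le.1 hz]), ENNReal.ofReal_zero]
    exact zero_le

variable [TopologicalSpace Ω] [BorelSpace Ω]

/-- Under narrow convergence, the integrals of a uniformly integrable function which is continuous
up to a bounded error converge up to a bounded error. -/
theorem integrable_and_eventually_abs_integral_sub_le [NormalSpace Ω] [ParacompactSpace Ω]
    [HasOuterApproxClosed Ω] {η : ℕ → ProbabilityMeasure Ω} {η' : ProbabilityMeasure Ω}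
    (hconv : Tendsto η atTop (𝓝 η')) {h : Ω → ℝ} (hm : Measurable h) {C : ℝ} (hC : 0 ≤ C)
    (hloc : ∀ z, ∀ᶠ y in 𝓝 z, |h y - h z| ≤ C)
    (hui : UnifIntegrableWrt h (fun j => (η j : Measure Ω))) :
    (∀ j, Integrable h (η j : Measure Ω)) ∧ Integrable h (η' : Measure Ω) ∧
    ∀ᶠ j in atTop, |∫ z, h z ∂(η j : Measure Ω) - ∫ z, h z ∂(η' : Measure Ω)| ≤ 2 * C + 1 := by
  -- a continuous function at bounded distance from `h`
  obtain ⟨g, hg⟩ := exists_continuous_forall_mem_convex_of_local_const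
    (t := fun z => Metric.closedBall (h z) C) (fun z => convex_closedBall _ _) fun z =>
      ⟨h z, (hloc z).mono fun y hy => by
        rwa [Metric.mem_closedBall, dist_comm, Real.dist_eq]⟩
  have hgh : ∀ z, |g z - h z| ≤ C := fun z => by
    have := hg z
    rwa [Metric.mem_closedBall, Real.dist_eq] at this
  have hgm : Measurable g := g.continuous.measurable
  obtain ⟨K, hK, hη⟩ := exists_tail_le hm hC hgh hui (show (0 : ℝ) < 1 / 4 by norm_num)
  -- the bound on the tails passes to the narrow limit, by the Fatou property
  have hη' : ∫⁻ z, ENNReal.ofReal (max (|g z| - K) 0) ∂(η' : Measure Ω) ≤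
      ENNReal.ofReal (1 / 4) := by
    refine (lintegral_le_liminf_lintegral_of_forall_isOpen_measure_le_liminf_measure
      (f := fun z => max (|g z| - K) 0)
      (μs := fun j => (η j : Measure Ω)) (by fun_prop) (fun z => le_max_right _ _) fun G hG =>
        ProbabilityMeasure.le_liminf_measure_open_of_tendsto hconv hG).trans ?_
    exact liminf_le_of_frequently_le' (.of_forall hη)
  have e1 := fun j => integrable_and_abs_integral_sub_truncation_le hgm hK (by norm_num) (hη j)
  have e2 := integrable_and_abs_integral_sub_truncation_le hgm hK (by norm_num) hη'
  have hint : ∀ ν : Measure Ω, IsProbabilityMeasure ν → Integrable g ν →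
      Integrable h ν ∧ |∫ z, g z ∂ν - ∫ z, h z ∂ν| ≤ C := by
    intro ν _ hgi
    have hd : Integrable (fun z => g z - h z) ν :=
      .of_bound (hgm.sub hm).aestronglyMeasurable C (.of_forall hgh)
    have hi : Integrable h ν := (hgi.sub hd).congr (.of_forall fun z => by simp)
    refine ⟨hi, ?_⟩
    rw [← integral_sub hgi hi]
    have := norm_integral_le_of_norm_le_const (μ := ν) (f := fun z => g z - h z) (.of_forall hgh)
    rwa [probReal_univ, mul_one] at this
  refine ⟨fun j => (hint _ inferInstance (e1 j).1).1, (hint _ inferInstance e2.1).1, ?_⟩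
  -- narrow convergence applies to the truncation of `g`
  let τ : BoundedContinuousFunction Ω ℝ := BoundedContinuousFunction.ofNormedAddCommGroup
    (fun z => max (-K) (min K (g z))) (by fun_prop) K fun z => by
      rw [Real.norm_eq_abs, abs_le]
      exact ⟨le_max_left _ _, max_le (by linarith) (min_le_left _ _)⟩
  have hτ := (ProbabilityMeasure.tendsto_iff_forall_integral_tendsto.1 hconv τ)
  filter_upwards [(Metric.tendsto_nhds.1 hτ (1 / 2) (by norm_num))] with j hj
  have a1 := (e1 j).2
  have a2 := e2.2
  have a3 := (hint _ inferInstance (e1 j).1).2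
  have a4 := (hint _ inferInstance e2.1).2
  have a5 : |∫ z, max (-K) (min K (g z)) ∂(η j : Measure Ω) -
      ∫ z, max (-K) (min K (g z)) ∂(η' : Measure Ω)| < 1 / 2 := hj
  rw [abs_lt] at a5
  rw [abs_le] at *
  constructor <;> linarith [a1.1, a1.2, a2.1, a2.2, a3.1, a3.2, a4.1, a4.2, a5.1, a5.2]

end Narrow

/-! ### The asymptotic Maslov index -/

section AsymptoticMaslov

variable {n : ℕ} {M : Type*} [TopologicalSpace M] [ChartedSpace (EuclideanSpace ℝ (Fin n)) M]
  [IsManifold (𝓡 n) ∞ M] {H : ExtPhaseSpace n M → ℝ} (hflow : GeneratesGlobalFlow H)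

lemma maslovFun_eq_maslovPrim {t : ℝ} (ht : 0 ≤ t) (z : ExtPhaseSpace n M) :
    maslovFun hflow t z = maslovPrim hflow t z - (n : ℝ) / 2 := by
  rw [maslovPrim, max_eq_left ht, add_sub_cancel_right]

variable [T2Space M] (hH : IsSmoothHamiltonian H)

include hH

/-- The constant is the bound `3n` for `maslovPrim`, increased by the shift `n / 2` between the two
functions. -/
lemma abs_maslovFun_add_sub_le {s r : ℝ} (hs : 0 ≤ s) (hr : 0 ≤ r) (z : ExtPhaseSpace n M) :
    |maslovFun hflow (s + r) z - maslovFun hflow s z - maslovFun hflow r (extFlow hflow s z)| ≤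
      4 * n := by
  have h := abs_maslovPrim_add_sub_le hflow hH hs hr z
  rw [maslovFun_eq_maslovPrim hflow hs, maslovFun_eq_maslovPrim hflow hr,
    maslovFun_eq_maslovPrim hflow (add_nonneg hs hr)]
  have hn : (0 : ℝ) ≤ n := by positivity
  rw [abs_le] at *
  constructor <;> linarith [h.1, h.2]

lemma eventually_abs_maslovFun_sub_le {t : ℝ} (ht : 0 ≤ t) (z : ExtPhaseSpace n M) :
    ∀ᶠ z' in 𝓝 z, |maslovFun hflow t z' - maslovFun hflow t z| ≤ 3 * n := by
  filter_upwards [eventually_abs_maslovPrim_sub_le hflow hH t z] with z' hz'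
  rw [maslovFun_eq_maslovPrim hflow ht, maslovFun_eq_maslovPrim hflow ht]
  rwa [sub_sub_sub_cancel_right]

lemma extFlow_iterate (k : ℕ) : (extFlow hflow 1)^[k] = extFlow hflow (k : ℝ) := by
  have h0 : extFlow hflow 0 = id := by
    funext z
    refine Prod.ext ?_ (evolution_zero hflow z.1 z.2)
    change z.1 + ((0 : ℝ) : UnitAddCircle) = z.1
    rw [AddCircle.coe_zero, add_zero]
  induction k with
  | zero => rw [Nat.cast_zero, h0, Function.iterate_zero]
  | succ k ih =>
    funext z
    rw [Function.iterate_succ_apply', ih, Nat.cast_succ, extFlow_add hflow hH]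

variable [CompactSpace M] [MeasurableSpace (ExtPhaseSpace n M)] [BorelSpace (ExtPhaseSpace n M)]

lemma measurable_maslovFun {t : ℝ} (ht : 0 ≤ t) : Measurable (maslovFun hflow t) := by
  rw [funext (maslovFun_eq_maslovPrim hflow ht)]
  exact ((measurable_maslovPrim hflow hH).comp (measurable_prodMk_left (x := t))).sub_const _

lemma measurable_integral_maslovFun (ν : Measure (ExtPhaseSpace n M)) [IsProbabilityMeasure ν] :
    Measurable fun t : ℝ => ∫ z, maslovFun hflow (max t 0) z ∂ν := by
  have h : StronglyMeasurable fun p : ℝ × ExtPhaseSpace n M => maslovFun hflow (max p.1 0) p.2 := by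
    have e : (fun p : ℝ × ExtPhaseSpace n M => maslovFun hflow (max p.1 0) p.2) =
        fun p => maslovPrim hflow p.1 p.2 - (n : ℝ) / 2 :=
      funext fun p => (add_sub_cancel_right _ _).symm
    rw [e]
    exact ((measurable_maslovPrim hflow hH).sub_const _).stronglyMeasurable
  exact h.integral_prod_right.measurable

/-- The asymptotic Maslov index of an invariant measure which integrates the functions `μ_t`, and
the rate of convergence of the means. -/
lemma hasAsymptoticMaslovIndex_of_integrable {ν : Measure (ExtPhaseSpace n M)}
    [IsProbabilityMeasure ν] (hinv : ∀ t : ℝ, MeasurePreserving (extFlow hflow t) ν ν)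
    (hint : ∀ t : ℝ, 0 ≤ t → Integrable (maslovFun hflow t) ν) :
    HasAsymptoticMaslovIndex hflow ν ∧ ∀ N : ℕ, 1 ≤ N →
      |∫ z, maslovFun hflow (N : ℝ) z ∂ν - N * asymptoticMaslovIndex hflow ν| ≤ 4 * n + 1 := by
  obtain ⟨h1, h2, h3⟩ := quasiCocycle_growth (hinv 1) (a := fun k z => maslovFun hflow (k : ℝ) z)
    (C := 4 * n) (fun k => measurable_maslovFun hflow hH (Nat.cast_nonneg k))
    (fun k => hint k (Nat.cast_nonneg k)) (fun k m z => by
      rw [extFlow_iterate hflow hH, Nat.cast_add]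
      exact abs_maslovFun_add_sub_le hflow hH (Nat.cast_nonneg k) (Nat.cast_nonneg m) z)
  refine ⟨⟨hint, h1, h2, ?_⟩, h3⟩
  have key := tendsto_div_of_quasiAdditive (measurable_integral_maslovFun hflow hH ν)
    (C := 4 * n) (C' := 4 * n + 1) (G := asymptoticMaslovIndex hflow ν) (fun s t hs ht => ?_)
    (fun N hN => by
      rw [max_eq_left (Nat.cast_nonneg N : (0 : ℝ) ≤ N)]
      exact h3 N hN)
  · refine key.congr' ?_
    filter_upwards [eventually_ge_atTop 0] with t ht
    rw [max_eq_left ht]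
  · simp only [max_eq_left hs, max_eq_left ht, max_eq_left (add_nonneg hs ht)]
    have e : ∫ z, maslovFun hflow t z ∂ν = ∫ z, maslovFun hflow t (extFlow hflow s z) ∂ν := by
      have h := integral_map (μ := ν) (hinv s).measurable.aemeasurable (f := maslovFun hflow t)
        (measurable_maslovFun hflow hH ht).aestronglyMeasurable
      rwa [(hinv s).map_eq] at h
    have hi : Integrable (fun z => maslovFun hflow t (extFlow hflow s z)) ν :=
      (hinv s).integrable_comp_of_integrable (hint t ht)
    have hd : Integrable (fun z => maslovFun hflow (s + t) z - maslovFun hflow s z) ν :=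
      (hint _ (add_nonneg hs ht)).sub (hint s hs)
    rw [e, ← integral_sub (hint _ (add_nonneg hs ht)) (hint s hs), ← integral_sub hd hi]
    have := norm_integral_le_of_norm_le_const (μ := ν) (C := 4 * n)
      (f := fun z => maslovFun hflow (s + t) z - maslovFun hflow s z -
        maslovFun hflow t (extFlow hflow s z))
      (.of_forall fun z => abs_maslovFun_add_sub_le hflow hH hs ht z)
    rwa [probReal_univ, mul_one] at this

end AsymptoticMaslov

section NarrowInvariant

/-- A narrow limit of measures invariant under a continuous map is invariant. -/
lemma measurePreserving_of_tendsto {Ω : Type*} [TopologicalSpace Ω] [MeasurableSpace Ω]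
    [BorelSpace Ω] [HasOuterApproxClosed Ω] {η : ℕ → ProbabilityMeasure Ω}
    {η' : ProbabilityMeasure Ω} (hconv : Tendsto η atTop (𝓝 η')) {T : Ω → Ω} (hT : Continuous T)
    (hinv : ∀ j, MeasurePreserving T (η j : Measure Ω) (η j : Measure Ω)) :
    MeasurePreserving T (η' : Measure Ω) (η' : Measure Ω) := by
  refine ⟨hT.measurable, ?_⟩
  have h := ProbabilityMeasure.tendsto_map_of_tendsto_of_continuous _ _ hconv hT
  have e : (fun j => (η j).map hT.measurable.aemeasurable) = η := funext fun j =>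
    Subtype.ext (hinv j).map_eq
  rw [e] at h
  exact congrArg (fun μ : ProbabilityMeasure Ω => (μ : Measure Ω)) (tendsto_nhds_unique h hconv)

end NarrowInvariant

theorem mainTheorem5 {n : ℕ} {M : Type*} [TopologicalSpace M]
    [ChartedSpace (EuclideanSpace ℝ (Fin n)) M] [IsManifold (𝓡 n) ∞ M]
    [CompactSpace M] [T2Space M]
    [MeasurableSpace (ExtPhaseSpace n M)] [BorelSpace (ExtPhaseSpace n M)]
    (H : ExtPhaseSpace n M → ℝ) (hH : IsSmoothHamiltonian H) (hflow : GeneratesGlobalFlow H)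
    (η : ℕ → ProbabilityMeasure (ExtPhaseSpace n M)) (η' : ProbabilityMeasure (ExtPhaseSpace n M))
    (hinv : ∀ (j : ℕ) (t : ℝ), MeasurePreserving (extFlow hflow t)
      (η j : Measure (ExtPhaseSpace n M)) (η j : Measure (ExtPhaseSpace n M)))
    (hconv : Tendsto η atTop (𝓝 η'))
    (hui : ∀ t : ℝ, 0 ≤ t → UnifIntegrableWrt (maslovFun hflow t)
      (fun j => (η j : Measure (ExtPhaseSpace n M)))) :
    (∀ t : ℝ, MeasurePreserving (extFlow hflow t)
      (η' : Measure (ExtPhaseSpace n M)) (η' : Measure (ExtPhaseSpace n M))) ∧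
    (∀ j : ℕ, HasAsymptoticMaslovIndex hflow (η j : Measure (ExtPhaseSpace n M))) ∧
    HasAsymptoticMaslovIndex hflow (η' : Measure (ExtPhaseSpace n M)) ∧
    Tendsto (fun j => asymptoticMaslovIndex hflow (η j : Measure (ExtPhaseSpace n M))) atTop
      (𝓝 (asymptoticMaslovIndex hflow (η' : Measure (ExtPhaseSpace n M)))) := by
  have : TopologicalSpace.MetrizableSpace (ExtPhaseSpace n M) :=
    TopologicalSpace.metrizableSpace_of_t3_secondCountable _
  let _ : MetricSpace (ExtPhaseSpace n M) := TopologicalSpace.metrizableSpaceMetric _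
  have hinv' : ∀ t : ℝ, MeasurePreserving (extFlow hflow t)
      (η' : Measure (ExtPhaseSpace n M)) (η' : Measure (ExtPhaseSpace n M)) := fun t =>
    measurePreserving_of_tendsto hconv (continuous_extFlow hflow hH t) fun j => hinv j t
  have key := fun (t : ℝ) (ht : 0 ≤ t) => integrable_and_eventually_abs_integral_sub_le hconv
    (measurable_maslovFun hflow hH ht) (by positivity)
    (eventually_abs_maslovFun_sub_le hflow hH ht) (hui t ht)
  have hj := fun j => hasAsymptoticMaslovIndex_of_integrable hflow hH (hinv j)
    fun t ht => (key t ht).1 j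
  have hj' := hasAsymptoticMaslovIndex_of_integrable hflow hH hinv' fun t ht => (key t ht).2.1
  refine ⟨hinv', fun j => (hj j).1, hj'.1, ?_⟩
  rw [Metric.tendsto_atTop']
  intro ε hε
  -- the integrals of `μ_N` for a large `N` determine the asymptotic indices up to `ε`
  obtain ⟨N, hN⟩ := exists_nat_gt ((2 * (4 * n + 1) + (2 * (3 * n) + 1)) / ε)
  have hN0 : (0 : ℝ) < N := lt_of_le_of_lt (by positivity) hN
  have hN1 : 1 ≤ N := by exact_mod_cast hN0
  rw [div_lt_iff₀ hε] at hN
  obtain ⟨j₀, hj₀⟩ := eventually_atTop.1 (key N hN0.le).2.2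
  refine ⟨j₀, fun j hlt => ?_⟩
  have a1 := hj₀ j hlt.le
  have a2 := (hj j).2 N hN1
  have a3 := hj'.2 N hN1
  rw [Real.dist_eq, ← mul_lt_mul_iff_right₀ hN0, ← abs_of_pos hN0, ← abs_mul, abs_of_pos hN0,
    mul_sub]
  refine lt_of_le_of_lt ?_ hN
  rw [abs_le] at *
  constructor <;> linarith [a1.1, a1.2, a2.1, a2.2, a3.1, a3.2]
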